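/- Let $\ell\ge 3$ be an odd integer and $\xi=\exp(2\pi i/\ell)$, and write $\xi^x=\exp(2\pi i x/\ell)$ for $x\in\mathbb C$. Let $a_{11}=2$, $a_{12}=a_{21}=-1$, $a_{22}=0$. Let $\mathcal U=\mathcal U_\xi\mathfrak{sl}(2|1)/(e_1^\ell,f_1^\ell)$ be the superalgebra over $\mathbb C$ generated by $k_i,k_i^{-1},e_i,f_i$ ($i=1,2$), where $e_2,f_2$ are odd and the other generators are even, with the relations $$k_1k_2=k_2k_1,\quad k_ik_i^{-1}=k_i^{-1}k_i=1,\quad k_ie_jk_i^{-1}=\xi^{a_{ij}}e_j,\quad k_if_jk_i^{-1}=\xi^{-a_{ij}}f_j,$$ $$e_1f_1-f_1e_1=\frac{k_1-k_1^{-1}}{\xi-\xi^{-1}},\quad e_2f_2+f_2e_2=\frac{k_2-k_2^{-1}}{\xi-\xi^{-1}},\quad e_1f_2=f_2e_1,\quad e_2f_1=f_1e_2,$$ $$e_2^2=f_2^2=0,\quad e_1^2e_2-(\xi+\xi^{-1})e_1e_2e_1+e_2e_1^2=0,\quad f_1^2f_2-(\xi+\xi^{-1})f_1f_2f_1+f_2f_1^2=0,\quad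 e_1^\ell=f_1^\ell=0.$$ Let $\mathcal U^\sigma$ be its bosonization: as an algebra it is the semidirect product of $\mathcal U$ with $\{1,\sigma\}\cong\mathbb Z/2\mathbb Z$, where $\sigma x=(-1)^{\deg x}x\sigma$ for homogeneous $x\in\mathcal U$. For $\overline\alpha=(\overline\alpha_1,\overline\alpha_2)\in G=\mathbb C/\mathbb Z\times\mathbb C/\mathbb Z$ let $\mathcal U_{\overline\alpha}$ be the quotient of $\mathcal U^\sigma$ by the relations $k_i^\ell=\xi^{\ell\alpha_i}$ ($i=1,2$), with projection $p_{\overline\alpha}:\mathcal U^\sigma\to\mathcal U_{\overline\alpha}$. Recall that a Hopf $G$-coalgebra (for the additively written group $G$) is a family of $\mathbb C$-algebras $(H_\alpha)_{\alpha\in G}$ with algebra homomorphisms $\Delta_{\alpha,\beta}:H_{\alpha+\beta}\to H_\alpha\otimes H_\beta$ and $\varepsilon:H_0\to\mathbb C$ and linear maps $S_\alpha:H_\alpha\to H_{-\alpha}$ such that $(\Delta_{\alpha,\beta}\otimes\mathrm{Id})\Delta_{\alpha+\beta,\gamma}=(\mathrm{Id}\otimes\Delta_{\beta,\gamma})\Delta_{\alpha,\beta+\gamma}$,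 $(\mathrm{Id}\otimes\varepsilon)\Delta_{\alpha,0}=\mathrm{Id}=(\varepsilon\otimes\mathrm{Id})\Delta_{0,\alpha}$ and $m_\alpha(S_{-\alpha}\otimes\mathrm{Id})\Delta_{-\alpha,\alpha}=\varepsilon 1_\alpha=m_\alpha(\mathrm{Id}\otimes S_{-\alpha})\Delta_{\alpha,-\alpha}$. It is of finite type if every $H_\alpha$ is finite dimensional. **Proposition.** The algebra $\mathcal U^\sigma$ has a Hopf algebra structure $(\Delta^\sigma,\varepsilon^\sigma,S^\sigma)$ given on the generators, with $d_1=0$ and $d_2=1$, by $$\Delta^\sigma(\sigma)=\sigma\otimes\sigma,\quad \Delta^\sigma(k_i)=k_i\otimes k_i,\quad \Delta^\sigma(e_i)=e_i\otimes 1+k_i^{-1}\sigma^{d_i}\otimes e_i,\quad \Delta^\sigma(f_i)=f_i\otimes k_i+\sigma^{d_i}\otimes f_i,$$ $$\varepsilon^\sigma(\sigma)=\varepsilon^\sigma(k_i)=1,\quad \varepsilon^\sigma(e_i)=\varepsilon^\sigma(f_i)=0,$$ $$S^\sigma(\sigma)=\sigma,\quad S^\sigma(k_i)=k_i^{-1},\quad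 S^\sigma(e_i)=-\sigma^{d_i}k_ie_i,\quad S^\sigma(f_i)=-\sigma^{d_i}f_ik_i^{-1},$$ and the family $\{\mathcal U_{\overline\alpha}\}_{\overline\alpha\in G}$ is a Hopf $G$-coalgebra of finite type whose structure maps are induced from $\mathcal U^\sigma$, that is, $$\Delta_{\overline\alpha,\overline\beta}\circ p_{\overline\alpha+\overline\beta}=(p_{\overline\alpha}\otimes p_{\overline\beta})\circ\Delta^\sigma,\qquad \varepsilon\circ p_{\overline 0}=\varepsilon^\sigma,\qquad S_{\overline\alpha}\circ p_{\overline\alpha}=p_{-\overline\alpha}\circ S^\sigma .$$ Moreover $\dim_{\mathbb C}\mathcal U_{\overline\alpha}=32\ell^4$ for every $\overline\alpha\in G$. -/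

import Mathlib

open scoped TensorProduct

noncomputable section

namespace QuantumSL21

/-- `ξ ^ x = exp (2 π i x / ℓ)` for a complex exponent `x`, where `ξ = exp (2 π i / ℓ)`. -/
def xiPow (ℓ : ℕ) (x : ℂ) : ℂ := Complex.exp (2 * Real.pi * Complex.I * x / ℓ)

/-- `ξ = exp (2 π i / ℓ)`. -/
def xi (ℓ : ℕ) : ℂ := xiPow ℓ 1

/-- The matrix `(a_{ij})`: `a₁₁ = 2`, `a₁₂ = a₂₁ = -1`, `a₂₂ = 0`.
The indices `1, 2` are `0, 1 : Fin 2`. -/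
def cartan : Matrix (Fin 2) (Fin 2) ℤ := !![2, -1; -1, 0]

/-- The degrees of the generators `e_i`, `f_i`: those with `i = 1` are even and those with
`i = 2` are odd. The generators `k_i` and `k_i⁻¹` are even. -/
def deg : Fin 2 → ℕ := ![0, 1]

/-! ### The superalgebra `U = U_ξ sl(2|1) / (e₁^ℓ, f₁^ℓ)` -/

/-- The generators `e_i, f_i, k_i, k_i⁻¹`. -/
inductive Gen : Type
  | e (i : Fin 2)
  | f (i : Fin 2)
  | k (i : Fin 2)
  | kinv (i : Fin 2)

/-- The generators in the free algebra. -/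
abbrev freeE (i : Fin 2) : FreeAlgebra ℂ Gen := FreeAlgebra.ι ℂ (Gen.e i)
/-- The generators in the free algebra. -/
abbrev freeF (i : Fin 2) : FreeAlgebra ℂ Gen := FreeAlgebra.ι ℂ (Gen.f i)
/-- The generators in the free algebra. -/
abbrev freeK (i : Fin 2) : FreeAlgebra ℂ Gen := FreeAlgebra.ι ℂ (Gen.k i)
/-- The generators in the free algebra. -/
abbrev freeKinv (i : Fin 2) : FreeAlgebra ℂ Gen := FreeAlgebra.ι ℂ (Gen.kinv i)

/-- The defining relations of `U_ξ sl(2|1)`, followed by `e₁^ℓ = f₁^ℓ = 0`. -/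
inductive Rel (ℓ : ℕ) : FreeAlgebra ℂ Gen → FreeAlgebra ℂ Gen → Prop
  | k_comm : Rel ℓ (freeK 0 * freeK 1) (freeK 1 * freeK 0)
  | k_mul_kinv (i : Fin 2) : Rel ℓ (freeK i * freeKinv i) 1
  | kinv_mul_k (i : Fin 2) : Rel ℓ (freeKinv i * freeK i) 1
  | k_e (i j : Fin 2) :
      Rel ℓ (freeK i * freeE j * freeKinv i) ((xi ℓ ^ cartan i j) • freeE j)
  | k_f (i j : Fin 2) :
      Rel ℓ (freeK i * freeF j * freeKinv i) ((xi ℓ ^ (-cartan i j)) • freeF j)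
  | e_f_even : Rel ℓ (freeE 0 * freeF 0 - freeF 0 * freeE 0)
      ((xi ℓ - (xi ℓ)⁻¹)⁻¹ • (freeK 0 - freeKinv 0))
  | e_f_odd : Rel ℓ (freeE 1 * freeF 1 + freeF 1 * freeE 1)
      ((xi ℓ - (xi ℓ)⁻¹)⁻¹ • (freeK 1 - freeKinv 1))
  | e_f_01 : Rel ℓ (freeE 0 * freeF 1 - freeF 1 * freeE 0) 0
  | e_f_10 : Rel ℓ (freeE 1 * freeF 0 - freeF 0 * freeE 1) 0
  | e_sq : Rel ℓ (freeE 1 ^ 2) 0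
  | f_sq : Rel ℓ (freeF 1 ^ 2) 0
  | serre_e : Rel ℓ (freeE 0 ^ 2 * freeE 1
      - (xi ℓ + (xi ℓ)⁻¹) • (freeE 0 * freeE 1 * freeE 0) + freeE 1 * freeE 0 ^ 2) 0
  | serre_f : Rel ℓ (freeF 0 ^ 2 * freeF 1
      - (xi ℓ + (xi ℓ)⁻¹) • (freeF 0 * freeF 1 * freeF 0) + freeF 1 * freeF 0 ^ 2) 0
  | e_pow : Rel ℓ (freeE 0 ^ ℓ) 0
  | f_pow : Rel ℓ (freeF 0 ^ ℓ) 0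

/-- The algebra `U = U_ξ sl(2|1) / (e₁^ℓ, f₁^ℓ)`. -/
def U (ℓ : ℕ) : Type := RingQuot (Rel ℓ)

instance (ℓ : ℕ) : Ring (U ℓ) := inferInstanceAs (Ring (RingQuot (Rel ℓ)))
instance (ℓ : ℕ) : Algebra ℂ (U ℓ) := inferInstanceAs (Algebra ℂ (RingQuot (Rel ℓ)))

/-- The class in `U` of an element of the free algebra. -/
def U.mk (ℓ : ℕ) : FreeAlgebra ℂ Gen →ₐ[ℂ] U ℓ := RingQuot.mkAlgHom ℂ (Rel ℓ)

theorem U.mk_rel {ℓ : ℕ} {x y : FreeAlgebra ℂ Gen} (h : Rel ℓ x y) : U.mk ℓ x = U.mk ℓ y :=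
  RingQuot.mkAlgHom_rel ℂ h

/-- The universal property of `U`. -/
def U.lift {ℓ : ℕ} {B : Type*} [Ring B] [Algebra ℂ B] (φ : FreeAlgebra ℂ Gen →ₐ[ℂ] B)
    (h : ∀ ⦃x y⦄, Rel ℓ x y → φ x = φ y) : U ℓ →ₐ[ℂ] B :=
  RingQuot.liftAlgHom ℂ ⟨φ, h⟩

theorem U.lift_mk {ℓ : ℕ} {B : Type*} [Ring B] [Algebra ℂ B] (φ : FreeAlgebra ℂ Gen →ₐ[ℂ] B)
    (h : ∀ ⦃x y⦄, Rel ℓ x y → φ x = φ y) (x : FreeAlgebra ℂ Gen) :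
    U.lift φ h (U.mk ℓ x) = φ x :=
  RingQuot.liftAlgHom_mkAlgHom_apply ℂ φ h x

theorem U.algHom_ext {ℓ : ℕ} {B : Type*} [Ring B] [Algebra ℂ B] {φ ψ : U ℓ →ₐ[ℂ] B}
    (h : ∀ g : Gen, φ (U.mk ℓ (FreeAlgebra.ι ℂ g)) = ψ (U.mk ℓ (FreeAlgebra.ι ℂ g))) :
    φ = ψ := by
  refine RingQuot.ringQuot_ext' ℂ φ ψ (FreeAlgebra.hom_ext ?_)
  funext g
  exact h g

/-- The sign `(-1)^{deg g}` of a generator. -/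
def Gen.sign : Gen → ℂ
  | .e i => (-1) ^ deg i
  | .f i => (-1) ^ deg i
  | .k _ => 1
  | .kinv _ => 1

/-- The parity automorphism on the free algebra. -/
def freeParity : FreeAlgebra ℂ Gen →ₐ[ℂ] FreeAlgebra ℂ Gen :=
  FreeAlgebra.lift ℂ fun g => g.sign • FreeAlgebra.ι ℂ g

theorem mk_freeParity_ι (ℓ : ℕ) (g : Gen) :
    (U.mk ℓ).comp freeParity (FreeAlgebra.ι ℂ g) = g.sign • U.mk ℓ (FreeAlgebra.ι ℂ g) := by
  simp [freeParity]

theorem mk_freeParity_rel {ℓ : ℕ} ⦃x y : FreeAlgebra ℂ Gen⦄ (h : Rel ℓ x y) :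
    (U.mk ℓ).comp freeParity x = (U.mk ℓ).comp freeParity y := by
  have h' := U.mk_rel h
  cases h with
  | k_e i j =>
    simp only [map_mul, map_smul, mk_freeParity_ι, Gen.sign, one_smul, smul_mul_assoc,
      mul_smul_comm] at h' ⊢
    rw [h', smul_comm]
  | k_f i j =>
    simp only [map_mul, map_smul, mk_freeParity_ι, Gen.sign, one_smul, smul_mul_assoc,
      mul_smul_comm] at h' ⊢
    rw [h', smul_comm]
  | _ =>
    simp only [map_mul, map_sub, map_add, map_pow, map_one, map_zero, map_smul] at h'
    simp only [map_mul, map_sub, map_add, map_pow, map_one, map_zero, map_smul,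
      mk_freeParity_ι, Gen.sign, deg, Matrix.cons_val_zero, Matrix.cons_val_one,
      Matrix.cons_val_fin_one, pow_zero, pow_one, one_smul, neg_smul, mul_neg, neg_mul, neg_neg,
      sub_neg_eq_add, smul_neg, neg_sq]
    first
      | exact h'
      | (rw [← neg_eq_zero, ← h']; abel)

/-- The parity automorphism `x ↦ (-1)^{deg x} x` of the superalgebra `U`; the odd generators
are `e₂` and `f₂`. -/
def parity (ℓ : ℕ) : U ℓ →ₐ[ℂ] U ℓ := U.lift ((U.mk ℓ).comp freeParity) mk_freeParity_rel

theorem parity_mk_ι (ℓ : ℕ) (g : Gen) :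
    parity ℓ (U.mk ℓ (FreeAlgebra.ι ℂ g)) = g.sign • U.mk ℓ (FreeAlgebra.ι ℂ g) := by
  rw [parity, U.lift_mk, mk_freeParity_ι]

theorem Gen.sign_mul_self (g : Gen) : g.sign * g.sign = 1 := by
  cases g with
  | e i => fin_cases i <;> simp [Gen.sign, deg]
  | f i => fin_cases i <;> simp [Gen.sign, deg]
  | k i => simp [Gen.sign]
  | kinv i => simp [Gen.sign]

theorem parity_parity (ℓ : ℕ) (x : U ℓ) : parity ℓ (parity ℓ x) = x := by
  have h : (parity ℓ).comp (parity ℓ) = AlgHom.id ℂ (U ℓ) := by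
    refine U.algHom_ext fun g => ?_
    rw [AlgHom.comp_apply, parity_mk_ι, map_smul, parity_mk_ι, smul_smul, Gen.sign_mul_self,
      one_smul, AlgHom.id_apply]
  exact DFunLike.congr_fun h x

/-! ### The bosonization `U^σ` -/

/-- The group `ℤ/2ℤ = {1, σ}`, written multiplicatively. -/
abbrev C2 : Type := Multiplicative (ZMod 2)

/-- The nontrivial element of `ℤ/2ℤ` acts on `U` by the parity automorphism. -/
instance (ℓ : ℕ) : MulSemiringAction C2 (U ℓ) where
  smul g x := if g = 1 then x else parity ℓ x
  one_smul x := if_pos rfl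
  mul_smul g h x := by
    change (if g * h = 1 then x else parity ℓ x) =
      if g = 1 then (if h = 1 then x else parity ℓ x)
      else parity ℓ (if h = 1 then x else parity ℓ x)
    have key : ∀ g h : C2, (g = 1 → (g * h = 1 ↔ h = 1)) ∧
        (g ≠ 1 → (g * h = 1 ↔ h ≠ 1)) := by decide
    by_cases hg : g = 1 <;> by_cases hh : h = 1 <;>
      simp [hg, hh, (key g h).2, parity_parity]
  smul_zero g := by
    change (if g = 1 then (0 : U ℓ) else parity ℓ 0) = 0
    simp
  smul_add g x y := by
    change (if g = 1 then x + y else parity ℓ (x + y)) =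
      (if g = 1 then x else parity ℓ x) + (if g = 1 then y else parity ℓ y)
    split_ifs <;> simp
  smul_one g := by
    change (if g = 1 then (1 : U ℓ) else parity ℓ 1) = 1
    simp
  smul_mul g x y := by
    change (if g = 1 then x * y else parity ℓ (x * y)) =
      (if g = 1 then x else parity ℓ x) * (if g = 1 then y else parity ℓ y)
    split_ifs <;> simp

instance (ℓ : ℕ) : SMulCommClass C2 ℂ (U ℓ) where
  smul_comm g c x := by
    change (if g = 1 then c • x else parity ℓ (c • x)) =
      c • (if g = 1 then x else parity ℓ x)
    split_ifs <;> simp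

/-- As an algebra, `U^σ` is the semidirect product of `U` and `ℤ/2ℤ = {1, σ}`, in which
`σ x = (-1)^{deg x} x σ`. -/
def Usigma (ℓ : ℕ) : Type := SkewMonoidAlgebra (U ℓ) C2

instance (ℓ : ℕ) : Ring (Usigma ℓ) := inferInstanceAs (Ring (SkewMonoidAlgebra (U ℓ) C2))
instance (ℓ : ℕ) : Algebra ℂ (Usigma ℓ) :=
  inferInstanceAs (Algebra ℂ (SkewMonoidAlgebra (U ℓ) C2))

namespace Usigma

/-- The element `σ` of `U^σ`. -/
def σ (ℓ : ℕ) : Usigma ℓ := SkewMonoidAlgebra.single (Multiplicative.ofAdd 1) 1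

/-- The inclusion of `U` in `U^σ`. -/
def incl (ℓ : ℕ) (x : U ℓ) : Usigma ℓ := SkewMonoidAlgebra.single 1 x

/-- The generator `e_i` of `U^σ`. -/
def e (ℓ : ℕ) (i : Fin 2) : Usigma ℓ := incl ℓ (U.mk ℓ (freeE i))
/-- The generator `f_i` of `U^σ`. -/
def f (ℓ : ℕ) (i : Fin 2) : Usigma ℓ := incl ℓ (U.mk ℓ (freeF i))
/-- The generator `k_i` of `U^σ`. -/
def k (ℓ : ℕ) (i : Fin 2) : Usigma ℓ := incl ℓ (U.mk ℓ (freeK i))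
/-- The generator `k_i⁻¹` of `U^σ`. -/
def kinv (ℓ : ℕ) (i : Fin 2) : Usigma ℓ := incl ℓ (U.mk ℓ (freeKinv i))

end Usigma

/-! ### The quotients `U_α` -/

/-- The group `G = ℂ/ℤ × ℂ/ℤ`, written additively. -/
abbrev G : Type := Fin 2 → ℂ ⧸ AddSubgroup.zmultiples (1 : ℂ)

/-- The number `ξ ^ (ℓ a)` for `a ∈ ℂ/ℤ`, computed from any representative of `a`. -/
def xiPowEll (ℓ : ℕ) : ℂ ⧸ AddSubgroup.zmultiples (1 : ℂ) → ℂ :=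
  Quotient.lift (fun z : ℂ => xiPow ℓ (ℓ * z)) (by
    intro z w h
    obtain ⟨n, hn⟩ := AddSubgroup.mem_zmultiples_iff.1 (QuotientAddGroup.leftRel_apply.1 h)
    have hw : w = z + n := by
      rw [zsmul_one] at hn
      rw [hn]; ring
    subst hw
    rcases eq_or_ne ℓ 0 with rfl | hl
    · simp [xiPow]
    · have hl' : (ℓ : ℂ) ≠ 0 := Nat.cast_ne_zero.2 hl
      simp only [xiPow]
      rw [Complex.exp_eq_exp_iff_exists_int]
      exact ⟨-n, by push_cast; field_simp; ring⟩)

/-- The relations `k_i^ℓ = ξ^{ℓ α_i}`, `i = 1, 2`. -/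
inductive RelAlpha (ℓ : ℕ) (α : G) : Usigma ℓ → Usigma ℓ → Prop
  | k_pow (i : Fin 2) :
      RelAlpha ℓ α (Usigma.k ℓ i ^ ℓ) (algebraMap ℂ (Usigma ℓ) (xiPowEll ℓ (α i)))

/-- The algebra `U_α`: the quotient of `U^σ` by the relations `k_i^ℓ = ξ^{ℓ α_i}`. -/
def Ualpha (ℓ : ℕ) (α : G) : Type := RingQuot (RelAlpha ℓ α)

instance (ℓ : ℕ) (α : G) : Ring (Ualpha ℓ α) := inferInstanceAs (Ring (RingQuot (RelAlpha ℓ α)))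
instance (ℓ : ℕ) (α : G) : Algebra ℂ (Ualpha ℓ α) :=
  inferInstanceAs (Algebra ℂ (RingQuot (RelAlpha ℓ α)))

/-- The projection `p_α : U^σ → U_α`. -/
def proj (ℓ : ℕ) (α : G) : Usigma ℓ →ₐ[ℂ] Ualpha ℓ α := RingQuot.mkAlgHom ℂ (RelAlpha ℓ α)

/-! ### Hopf algebras and Hopf group-coalgebras -/

/-- A Hopf algebra structure on a given `ℂ`-algebra `A`. (Mathlib's class `HopfAlgebra` has the
algebra structure of `A` as part of its data.) -/
structure HopfStructure (A : Type*) [Ring A] [Algebra ℂ A] where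
  /-- The coproduct `Δ`. -/
  comul : A →ₐ[ℂ] A ⊗[ℂ] A
  /-- The counit `ε`. -/
  counit : A →ₐ[ℂ] ℂ
  /-- The antipode `S`. -/
  antipode : A →ₗ[ℂ] A
  coassoc (x : A) :
    TensorProduct.assoc ℂ A A A (comul.toLinearMap.rTensor A (comul x)) =
      comul.toLinearMap.lTensor A (comul x)
  lTensor_counit (x : A) :
    TensorProduct.rid ℂ A (counit.toLinearMap.lTensor A (comul x)) = x
  rTensor_counit (x : A) :
    TensorProduct.lid ℂ A (counit.toLinearMap.rTensor A (comul x)) = x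
  mul_antipode_rTensor (x : A) :
    LinearMap.mul' ℂ A (antipode.rTensor A (comul x)) = algebraMap ℂ A (counit x)
  mul_antipode_lTensor (x : A) :
    LinearMap.mul' ℂ A (antipode.lTensor A (comul x)) = algebraMap ℂ A (counit x)

/-- A Hopf `π`-coalgebra structure on a family `{H_α}_{α ∈ π}` of `ℂ`-algebras, for a group `π`
written additively.

The coproduct `Δ_{α,β} : H_{α+β} → H_α ⊗ H_β` is written `comul (h : α + β = γ)`, with source
`H γ`, and the antipode `S_α : H_α → H_{-α}` is written `antipode (h : α + β = 0)`, with target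
`H β`. Since the proof `h` determines `γ = α + β`, respectively `β = -α`, these are the same data;
in this form the axioms need no transport along equalities such as `(α + β) + γ = α + (β + γ)`
and `-(-α) = α`. -/
structure HopfGroupCoalgebra {π : Type*} [AddGroup π] (H : π → Type*)
    [∀ α, Ring (H α)] [∀ α, Algebra ℂ (H α)] where
  /-- The coproducts `Δ_{α,β}`, which are algebra homomorphisms. -/
  comul {α β γ : π} (h : α + β = γ) : H γ →ₐ[ℂ] H α ⊗[ℂ] H β
  /-- The counit `ε`, which is an algebra homomorphism. -/
  counit : H 0 →ₐ[ℂ] ℂ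
  /-- The antipodes `S_α`, which are linear maps. -/
  antipode {α β : π} (h : α + β = 0) : H α →ₗ[ℂ] H β
  /-- `(Δ_{α,β} ⊗ id) Δ_{α+β,γ} = (id ⊗ Δ_{β,γ}) Δ_{α,β+γ}`. -/
  coassoc {α β γ αβ βγ δ : π} (h₁ : α + β = αβ) (h₂ : αβ + γ = δ) (h₃ : β + γ = βγ)
    (h₄ : α + βγ = δ) (x : H δ) :
    TensorProduct.assoc ℂ (H α) (H β) (H γ)
        ((comul h₁).toLinearMap.rTensor (H γ) (comul h₂ x)) =
      (comul h₃).toLinearMap.lTensor (H α) (comul h₄ x)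
  /-- `(id ⊗ ε) Δ_{α,0} = id`. -/
  lTensor_counit {α : π} (x : H α) :
    TensorProduct.rid ℂ (H α)
      (counit.toLinearMap.lTensor (H α) (comul (add_zero α) x)) = x
  /-- `(ε ⊗ id) Δ_{0,α} = id`. -/
  rTensor_counit {α : π} (x : H α) :
    TensorProduct.lid ℂ (H α)
      (counit.toLinearMap.rTensor (H α) (comul (zero_add α) x)) = x
  /-- `m_α (S_{-α} ⊗ id) Δ_{-α,α} = ε 1_α`. -/
  mul_antipode_rTensor {α β : π} (h : β + α = 0) (x : H 0) :
    LinearMap.mul' ℂ (H α) ((antipode h).rTensor (H α) (comul h x)) =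
      algebraMap ℂ (H α) (counit x)
  /-- `m_α (id ⊗ S_{-α}) Δ_{α,-α} = ε 1_α`. -/
  mul_antipode_lTensor {α β : π} (h : α + β = 0) (h' : β + α = 0) (x : H 0) :
    LinearMap.mul' ℂ (H α) ((antipode h').lTensor (H α) (comul h x)) =
      algebraMap ℂ (H α) (counit x)

/-- A Hopf `π`-coalgebra is of finite type if every `H_α` is finite dimensional. -/
def HopfGroupCoalgebra.IsFiniteType {π : Type*} [AddGroup π] {H : π → Type*}
    [∀ α, Ring (H α)] [∀ α, Algebra ℂ (H α)] (_ : HopfGroupCoalgebra H) : Prop :=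
  ∀ α, Module.Finite ℂ (H α)

/-- The Hopf algebra structure `(Δ^σ, ε^σ, S^σ)` of the bosonization `U^σ`, given by its values on
the generators. It is obtained from the Hopf superalgebra structure
`Δ(e_i) = e_i ⊗ 1 + k_i⁻¹ ⊗ e_i`, `Δ(f_i) = f_i ⊗ k_i + 1 ⊗ f_i`, `Δ(k_i) = k_i ⊗ k_i`,
`S(e_i) = -k_i e_i`, `S(f_i) = -f_i k_i⁻¹`, `S(k_i) = k_i⁻¹` of `U` by
`Δ^σ(x) = ∑ x' σ^{deg x''} ⊗ x''` for `Δ(x) = ∑ x' ⊗ x''`, and `S^σ(x) = σ^{deg x} S(x)`. -/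
structure IsBosonizedHopf (ℓ : ℕ) (𝓗 : HopfStructure (Usigma ℓ)) : Prop where
  comul_σ : 𝓗.comul (Usigma.σ ℓ) = Usigma.σ ℓ ⊗ₜ Usigma.σ ℓ
  comul_e (i : Fin 2) : 𝓗.comul (Usigma.e ℓ i) =
    Usigma.e ℓ i ⊗ₜ 1 + (Usigma.kinv ℓ i * Usigma.σ ℓ ^ deg i) ⊗ₜ Usigma.e ℓ i
  comul_f (i : Fin 2) : 𝓗.comul (Usigma.f ℓ i) =
    Usigma.f ℓ i ⊗ₜ Usigma.k ℓ i + (Usigma.σ ℓ ^ deg i) ⊗ₜ Usigma.f ℓ i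
  comul_k (i : Fin 2) : 𝓗.comul (Usigma.k ℓ i) = Usigma.k ℓ i ⊗ₜ Usigma.k ℓ i
  counit_σ : 𝓗.counit (Usigma.σ ℓ) = 1
  counit_e (i : Fin 2) : 𝓗.counit (Usigma.e ℓ i) = 0
  counit_f (i : Fin 2) : 𝓗.counit (Usigma.f ℓ i) = 0
  counit_k (i : Fin 2) : 𝓗.counit (Usigma.k ℓ i) = 1
  antipode_σ : 𝓗.antipode (Usigma.σ ℓ) = Usigma.σ ℓ
  antipode_e (i : Fin 2) : 𝓗.antipode (Usigma.e ℓ i) =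
    Usigma.σ ℓ ^ deg i * -(Usigma.k ℓ i * Usigma.e ℓ i)
  antipode_f (i : Fin 2) : 𝓗.antipode (Usigma.f ℓ i) =
    Usigma.σ ℓ ^ deg i * -(Usigma.f ℓ i * Usigma.kinv ℓ i)
  antipode_k (i : Fin 2) : 𝓗.antipode (Usigma.k ℓ i) = Usigma.kinv ℓ i

/-- The Hopf `G`-coalgebra structure on `{U_α}` is induced by the Hopf algebra structure of `U^σ`:
`Δ_{α,β} p_{α+β} = (p_α ⊗ p_β) Δ^σ`, `ε p_0 = ε^σ` and `S_α p_α = p_{-α} S^σ`. -/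
structure IsInduced {ℓ : ℕ} (𝓗 : HopfStructure (Usigma ℓ))
    (𝓖 : HopfGroupCoalgebra (Ualpha ℓ)) : Prop where
  comul_proj (α β : G) (x : Usigma ℓ) :
    𝓖.comul (rfl : α + β = α + β) (proj ℓ (α + β) x) =
      Algebra.TensorProduct.map (proj ℓ α) (proj ℓ β) (𝓗.comul x)
  counit_proj (x : Usigma ℓ) : 𝓖.counit (proj ℓ 0 x) = 𝓗.counit x
  antipode_proj (α : G) (x : Usigma ℓ) :
    𝓖.antipode (add_neg_cancel α) (proj ℓ α x) = proj ℓ (-α) (𝓗.antipode x)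

end QuantumSL21

end

/-! An algebra homomorphism from U^σ to B amounts to a tuple in B that satisfies the defining
relations, a `Realization`. Hence Δ^σ, ε^σ and S^σ are obtained from realizations in U^σ ⊗ U^σ, in ℂ
and in the opposite algebra of U^σ. Two kinds of relation for Δ^σ need an idea. The Serre relations
survive because the two summands of Δ^σ(e_i) q-commute with the right exponents (`IsSerre.add`). The
relations e_1^ℓ = f_1^ℓ = 0 survive because those summands q-commute with parameter ξ^{-2}, a
primitive ℓ-th root of unity as ℓ is odd, so that the q-binomial theorem leaves only the two extreme
terms (`add_pow_of_qcomm_primitiveRoot`). The Hopf axioms then need checking on generators only.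
Everything descends to the quotients U_α because k_i is group-like and α ↦ ξ^{ℓα} is a character.

The dimension is squeezed between two bounds. For the upper bound, U_α is the product of the
subalgebras generated by the f_i, by the k_i^{±1} and σ, and by the e_i
(`mul_lowerBorel_mul_eq_top`). These are spanned by 4ℓ, 2ℓ² and 4ℓ elements, which gives 32ℓ⁴.

For the lower bound, linear independence of monomials is replaced by a surjection onto a space of
dimension 32ℓ⁴. A highest weight module of dimension 4ℓ is built by inducing an ℓ-dimensional Verma
module of the even part; its Chevalley twist is a lowest weight module. The tensor product of a
highest weight module with a fixed lowest weight one has dimension 16ℓ² and is generated by v ⊗ w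
(`tensorEnd_eq_top`). There are 2ℓ² choices of weight for the k_i and sign for σ compatible with α,
and v ⊗ w is a joint eigenvector whose eigenvalues tell them apart. By
`surjective_of_separated_weights`, acting on v ⊗ w in all these modules at once maps U_α onto their
product. -/

noncomputable section

namespace QuantumSL21

/-! ### Gaussian binomial coefficients and the q-binomial theorem at a root of unity -/

section QBinomial

/-- The Gaussian binomial coefficient of `i + j` over `i`, by its `q`-Pascal recursion. -/
def gaussCoeff (ζ : ℂ) : ℕ → ℕ → ℂ
  | 0, _ => 1
  | _ + 1, 0 => 1
  | i + 1, j + 1 => gaussCoeff ζ i (j + 1) + ζ ^ (i + 1) * gaussCoeff ζ (i + 1) j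

theorem gaussCoeff_zero_right (ζ : ℂ) (i : ℕ) : gaussCoeff ζ i 0 = 1 := by
  cases i <;> simp [gaussCoeff]

/-- The product `(1 - ζ) (1 - ζ²) ⋯ (1 - ζⁿ)`. -/
def qPoch (ζ : ℂ) (n : ℕ) : ℂ := ∏ m ∈ Finset.range n, (1 - ζ ^ (m + 1))

theorem qPoch_succ (ζ : ℂ) (n : ℕ) : qPoch ζ (n + 1) = qPoch ζ n * (1 - ζ ^ (n + 1)) :=
  Finset.prod_range_succ _ _

/-- The factorial formula, with denominators cleared because they can vanish at a root of unity. The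
induction rests on 1 - ζ^{i+j+2} = (1 - ζ^{i+1}) + ζ^{i+1}(1 - ζ^{j+1}). -/
theorem gaussCoeff_mul_qPoch (ζ : ℂ) (i j : ℕ) :
    qPoch ζ i * qPoch ζ j * gaussCoeff ζ i j = qPoch ζ (i + j) := by
  induction i generalizing j with
  | zero => simp [gaussCoeff, qPoch]
  | succ i ihi =>
    induction j with
    | zero => simp [gaussCoeff, qPoch]
    | succ j ihj =>
      have h1 := ihi (j + 1)
      rw [show i + 1 + (j + 1) = (i + 1 + j) + 1 by ring, qPoch_succ ζ (i + 1 + j)]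
      rw [show i + (j + 1) = i + 1 + j by ring] at h1
      rw [qPoch_succ ζ i] at ihj ⊢
      rw [qPoch_succ ζ j] at h1 ⊢
      rw [gaussCoeff]
      linear_combination (1 - ζ ^ (i + 1)) * h1 + ζ ^ (i + 1) * (1 - ζ ^ (j + 1)) * ihj

theorem qPoch_ne_zero {ζ : ℂ} {ℓ n : ℕ} (hζ : IsPrimitiveRoot ζ ℓ) (hn : n < ℓ) :
    qPoch ζ n ≠ 0 := by
  refine Finset.prod_ne_zero_iff.2 fun m hm h => ?_
  have := hζ.pow_ne_one_of_pos_of_lt (Nat.succ_ne_zero m)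
    (lt_of_le_of_lt (Finset.mem_range.1 hm) hn)
  exact this (sub_eq_zero.1 h).symm

/-- In the factorial formula the right side contains the factor 1 - ζ^ℓ = 0, while the two
factorials on the left only involve exponents below ℓ and are nonzero. -/
theorem gaussCoeff_eq_zero {ζ : ℂ} {ℓ i j : ℕ} (hζ : IsPrimitiveRoot ζ ℓ) (hi : 0 < i)
    (hj : 0 < j) (hij : i + j = ℓ) : gaussCoeff ζ i j = 0 := by
  have h := gaussCoeff_mul_qPoch ζ i j
  have h0 : qPoch ζ (i + j) = 0 := by
    refine Finset.prod_eq_zero (i := ℓ - 1) (Finset.mem_range.2 (by omega)) ?_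
    rw [Nat.sub_add_cancel (by omega), hζ.pow_eq_one, sub_self]
  rw [h0] at h
  exact (mul_eq_zero.1 h).resolve_left
    (mul_ne_zero (qPoch_ne_zero hζ (by omega)) (qPoch_ne_zero hζ (by omega)))

variable {B : Type*} [Ring B] [Algebra ℂ B]

theorem mul_pow_of_qcomm {ζ : ℂ} {a b : B} (h : b * a = ζ • (a * b)) (n : ℕ) :
    b * a ^ n = ζ ^ n • (a ^ n * b) := by
  induction n with
  | zero => simp
  | succ n ih =>
    rw [pow_succ, ← mul_assoc, ih, smul_mul_assoc, mul_assoc, h, mul_smul_comm, smul_smul,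
      ← pow_succ, mul_assoc]

theorem add_pow_of_qcomm {ζ : ℂ} {a b : B} (h : b * a = ζ • (a * b)) (n : ℕ) :
    (a + b) ^ n = ∑ p ∈ Finset.HasAntidiagonal.antidiagonal n, gaussCoeff ζ p.1 p.2 • (a ^ p.1 * b ^ p.2) := by
  induction n with
  | zero => simp [gaussCoeff]
  | succ n ih =>
    have hb : ∀ i j : ℕ, b * (a ^ i * b ^ j) = ζ ^ i • (a ^ i * b ^ (j + 1)) := fun i j => by
      rw [← mul_assoc, mul_pow_of_qcomm h, smul_mul_assoc, mul_assoc, pow_succ']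
    have ha : ∀ i j : ℕ, a * (a ^ i * b ^ j) = a ^ (i + 1) * b ^ j := fun i j => by
      rw [← mul_assoc, pow_succ']
    rw [pow_succ', ih, add_mul, Finset.mul_sum, Finset.mul_sum]
    simp only [mul_smul_comm, ha, hb, smul_smul]
    cases n with
    | zero => simp [gaussCoeff, Finset.Nat.antidiagonal_succ, add_comm]
    | succ n =>
      -- The extreme terms are split off, so that the remaining sums run over monomials a^{i+1}
      -- b^{j+1}, where the Pascal recursion of `gaussCoeff` applies.
      rw [Finset.Nat.sum_antidiagonal_succ', Finset.Nat.sum_antidiagonal_succ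
        (f := fun p => (gaussCoeff ζ p.1 p.2 * ζ ^ p.1) • (a ^ p.1 * b ^ (p.2 + 1))),
        Finset.Nat.sum_antidiagonal_succ, Finset.Nat.sum_antidiagonal_succ']
      simp only [gaussCoeff, gaussCoeff_zero_right, add_smul, Finset.sum_add_distrib]
      simp only [pow_zero, mul_one, one_mul, one_smul, mul_comm (ζ ^ _)]
      abel

theorem add_pow_of_qcomm_primitiveRoot {ζ : ℂ} {ℓ : ℕ} (hζ : IsPrimitiveRoot ζ ℓ) (hℓ : 0 < ℓ)
    {a b : B} (h : b * a = ζ • (a * b)) : (a + b) ^ ℓ = a ^ ℓ + b ^ ℓ := by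
  obtain ⟨n, rfl⟩ : ∃ n, ℓ = n + 1 := ⟨ℓ - 1, by omega⟩
  rw [add_pow_of_qcomm h]
  cases n with
  | zero => simp [gaussCoeff, Finset.Nat.antidiagonal_succ, add_comm]
  | succ n =>
    rw [Finset.Nat.sum_antidiagonal_succ, Finset.Nat.sum_antidiagonal_succ',
      Finset.sum_eq_zero]
    · simp [gaussCoeff, gaussCoeff_zero_right, add_comm]
    · intro p hp
      rw [gaussCoeff_eq_zero hζ (Nat.succ_pos _) (Nat.succ_pos _), zero_smul]
      have := Finset.HasAntidiagonal.mem_antidiagonal.1 hp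
      omega

/-- Reordering the factors shows that (ab)^m is a scalar multiple of a^m b^m. This gives S(e_1)^ℓ =
0 and S(f_1)^ℓ = 0. -/
theorem mul_pow_eq_zero_of_qcomm {ζ : ℂ} {a b : B} (h : b * a = ζ • (a * b)) {n : ℕ}
    (hb : b ^ n = 0) : (a * b) ^ n = 0 := by
  have key : ∀ m : ℕ, ∃ c : ℂ, (a * b) ^ m = c • (a ^ m * b ^ m) := by
    intro m
    induction m with
    | zero => exact ⟨1, by simp⟩
    | succ m ih =>
      obtain ⟨c, hc⟩ := ih
      refine ⟨ζ ^ m * c, ?_⟩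
      rw [pow_succ', hc, mul_smul_comm, pow_succ' b, mul_assoc, ← mul_assoc b,
        mul_pow_of_qcomm h, smul_mul_assoc, mul_smul_comm, smul_smul, pow_succ' a]
      simp only [mul_assoc, mul_comm c]
  obtain ⟨c, hc⟩ := key n
  rw [hc, hb, mul_zero, smul_zero]

end QBinomial

/-! ### Stability properties of the quantum Serre relation -/

section Serre

variable {B : Type*} [Ring B] [Algebra ℂ B]

/-- The quantum Serre relation `a² b - (q + q⁻¹) a b a + b a² = 0`. -/
def IsSerre (q : ℂ) (a b : B) : Prop :=
  a * (a * b) = (q + q⁻¹) • (a * (b * a)) - b * (a * a)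

/-- Once every b₁, b₂ is moved to the right of the a's, the coefficients of the mixed monomials
cancel. The Serre expression is linear in its second argument, so no rule for exchanging b₂ and a₂
is needed. This is what makes the coproduct respect the Serre relations. -/
theorem IsSerre.add {q : ℂ} (hq : q ≠ 0) {a₁ a₂ b₁ b₂ : B} (ha : IsSerre q a₁ a₂)
    (hb : IsSerre q b₁ b₂) (h₁₁ : b₁ * a₁ = (q ^ 2)⁻¹ • (a₁ * b₁)) (h₁₂ : b₁ * a₂ = q • (a₂ * b₁))
    (h₂₁ : b₂ * a₁ = q • (a₁ * b₂)) : IsSerre q (a₁ + b₁) (a₂ + b₂) := by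
  have h₁₁' (x : B) : b₁ * (a₁ * x) = (q ^ 2)⁻¹ • (a₁ * (b₁ * x)) := by
    rw [← mul_assoc, h₁₁, smul_mul_assoc, mul_assoc]
  have h₁₂' (x : B) : b₁ * (a₂ * x) = q • (a₂ * (b₁ * x)) := by
    rw [← mul_assoc, h₁₂, smul_mul_assoc, mul_assoc]
  have h₂₁' (x : B) : b₂ * (a₁ * x) = q • (a₁ * (b₂ * x)) := by
    rw [← mul_assoc, h₂₁, smul_mul_assoc, mul_assoc]
  unfold IsSerre at *
  simp only [mul_add, add_mul, h₁₁, h₁₂, h₂₁, h₁₁', h₁₂', h₂₁', mul_smul_comm, ha, hb]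
  match_scalars <;> field_simp <;> ring

/-- Moving k₁, k₁, k₂ to the left in each of the three monomials produces powers of q whose product
is 1, so the Serre expression is just multiplied by k₁²k₂ on the left. This is what the antipode
needs. -/
theorem IsSerre.mul {q : ℂ} (hq : q ≠ 0) {k₁ k₂ a₁ a₂ : B} (ha : IsSerre q a₁ a₂)
    (hk : k₂ * k₁ = k₁ * k₂) (h₁₁ : a₁ * k₁ = (q ^ 2)⁻¹ • (k₁ * a₁))
    (h₁₂ : a₁ * k₂ = q • (k₂ * a₁)) (h₂₁ : a₂ * k₁ = q • (k₁ * a₂)) :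
    IsSerre q (k₁ * a₁) (k₂ * a₂) := by
  have hk' (x : B) : k₂ * (k₁ * x) = k₁ * (k₂ * x) := by rw [← mul_assoc, hk, mul_assoc]
  have h₁₁' (x : B) : a₁ * (k₁ * x) = (q ^ 2)⁻¹ • (k₁ * (a₁ * x)) := by
    rw [← mul_assoc, h₁₁, smul_mul_assoc, mul_assoc]
  have h₁₂' (x : B) : a₁ * (k₂ * x) = q • (k₂ * (a₁ * x)) := by
    rw [← mul_assoc, h₁₂, smul_mul_assoc, mul_assoc]
  have h₂₁' (x : B) : a₂ * (k₁ * x) = q • (k₁ * (a₂ * x)) := by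
    rw [← mul_assoc, h₂₁, smul_mul_assoc, mul_assoc]
  unfold IsSerre at *
  simp only [mul_assoc, hk', h₁₁', h₁₂', h₂₁', mul_smul_comm, ha, mul_sub]
  match_scalars <;> field_simp

theorem IsSerre.smul {q : ℂ} {a b : B} (h : IsSerre q a b) (c d : ℂ) :
    IsSerre q (c • a) (d • b) := by
  unfold IsSerre at *
  simp only [mul_smul_comm, smul_mul_assoc, h]
  module

theorem IsSerre.neg_neg {q : ℂ} {a b : B} (h : IsSerre q a b) : IsSerre q (-a) (-b) := by
  simpa using h.smul (-1) (-1)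

/-- The Serre expression is a palindrome: reversing all words exchanges its first and last terms. -/
theorem IsSerre.op {q : ℂ} {a b : B} (h : IsSerre q a b) :
    IsSerre q (MulOpposite.op a) (MulOpposite.op b) := by
  unfold IsSerre at *
  simp only [← MulOpposite.op_mul, ← MulOpposite.op_smul, ← MulOpposite.op_sub, mul_assoc, h]
  congr 1
  abel

theorem IsSerre.map {C : Type*} [Ring C] [Algebra ℂ C] (φ : B →ₐ[ℂ] C) {q : ℂ} {a b : B}
    (h : IsSerre q a b) : IsSerre q (φ a) (φ b) := by
  have := congrArg φ h
  simpa [IsSerre] using this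

/-- Since x and y commute, all three monomials carry the same second tensor factor. -/
theorem IsSerre.tmul_left {C : Type*} [Ring C] [Algebra ℂ C] {q : ℂ} {a b : B}
    (h : IsSerre q a b) {x y : C} (hxy : x * y = y * x) :
    IsSerre q (a ⊗ₜ[ℂ] x) (b ⊗ₜ[ℂ] y) := by
  have h₁ : x * (x * y) = x * (y * x) := by rw [hxy]
  have h₂ : y * (x * x) = x * (y * x) := by rw [← mul_assoc, ← hxy, mul_assoc, hxy]
  unfold IsSerre at *
  simp only [Algebra.TensorProduct.tmul_mul_tmul, h, h₁, h₂, TensorProduct.sub_tmul,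
    TensorProduct.smul_tmul']

theorem IsSerre.tmul_right {C : Type*} [Ring C] [Algebra ℂ C] {q : ℂ} {a b : B}
    (h : IsSerre q a b) {x y : C} (hxy : x * y = y * x) :
    IsSerre q (x ⊗ₜ[ℂ] a) (y ⊗ₜ[ℂ] b) := by
  have h₁ : x * (x * y) = x * (y * x) := by rw [hxy]
  have h₂ : y * (x * x) = x * (y * x) := by rw [← mul_assoc, ← hxy, mul_assoc, hxy]
  unfold IsSerre at *
  simp only [Algebra.TensorProduct.tmul_mul_tmul, h, h₁, h₂, TensorProduct.tmul_sub,
    TensorProduct.tmul_smul]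

end Serre

end QuantumSL21

/-! ### Realizations of the generators, the Chevalley involution and the coproduct -/

namespace QuantumSL21

/-- Elements of an algebra `B` that satisfy the relations of the generators of `U^σ`, for a
parameter `q` in place of `ξ`. The element `l i` is the inverse of `k i`, and `s` is `σ`. -/
structure Realization (q : ℂ) (ℓ : ℕ) (B : Type*) [Ring B] [Algebra ℂ B] where
  /-- The image of `e_i`. -/
  e : Fin 2 → B
  /-- The image of `f_i`. -/
  f : Fin 2 → B
  /-- The image of `k_i`. -/
  k : Fin 2 → B
  /-- The image of `k_i⁻¹`. -/
  l : Fin 2 → B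
  /-- The image of `σ`. -/
  s : B
  k_comm : k 0 * k 1 = k 1 * k 0
  k_l (i : Fin 2) : k i * l i = 1
  l_k (i : Fin 2) : l i * k i = 1
  k_e (i j : Fin 2) : k i * e j = (q ^ cartan i j) • (e j * k i)
  k_f (i j : Fin 2) : k i * f j = (q ^ (-cartan i j)) • (f j * k i)
  e_f_even : e 0 * f 0 = f 0 * e 0 + (q - q⁻¹)⁻¹ • (k 0 - l 0)
  e_f_odd : e 1 * f 1 = -(f 1 * e 1) + (q - q⁻¹)⁻¹ • (k 1 - l 1)
  e_f_01 : e 0 * f 1 = f 1 * e 0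
  e_f_10 : e 1 * f 0 = f 0 * e 1
  e_sq : e 1 * e 1 = 0
  f_sq : f 1 * f 1 = 0
  serre_e : IsSerre q (e 0) (e 1)
  serre_f : IsSerre q (f 0) (f 1)
  e_pow : e 0 ^ ℓ = 0
  f_pow : f 0 ^ ℓ = 0
  s_s : s * s = 1
  s_e (i : Fin 2) : s * e i = ((-1 : ℂ) ^ deg i) • (e i * s)
  s_f (i : Fin 2) : s * f i = ((-1 : ℂ) ^ deg i) • (f i * s)
  s_k (i : Fin 2) : s * k i = k i * s

theorem qcomm_inv {B : Type*} [Ring B] [Algebra ℂ B] {c d : ℂ} (hcd : c * d = 1) {k l x : B}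
    (hkl : k * l = 1) (hlk : l * k = 1) (h : k * x = c • (x * k)) : l * x = d • (x * l) := by
  have h' : x * l = c • (l * x) := by
    calc x * l = l * (k * x) * l := by rw [← mul_assoc, hlk, one_mul]
      _ = c • (l * x) := by
        rw [h, mul_smul_comm, smul_mul_assoc, mul_assoc, mul_assoc, hkl, mul_one]
  rw [h', smul_smul, mul_comm, hcd, one_smul]

theorem assoc_rule {B : Type*} [Ring B] [Algebra ℂ B] {c : ℂ} {a b : B}
    (h : a * b = c • (b * a)) (x : B) : a * (b * x) = c • (b * (a * x)) := by
  rw [← mul_assoc, h, smul_mul_assoc, mul_assoc]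

theorem assoc_comm_rule {B : Type*} [Semigroup B] {a b : B}
    (h : a * b = b * a) (x : B) : a * (b * x) = b * (a * x) := by
  rw [← mul_assoc, h, mul_assoc]

theorem assoc_one_rule {B : Type*} [Monoid B] {a b : B}
    (h : a * b = 1) (x : B) : a * (b * x) = x := by
  rw [← mul_assoc, h, one_mul]

theorem assoc_zero_rule {B : Type*} [Ring B] {a b : B}
    (h : a * b = 0) (x : B) : a * (b * x) = 0 := by
  rw [← mul_assoc, h, zero_mul]

namespace Realization

variable {q : ℂ} {ℓ : ℕ} {B : Type*} [Ring B] [Algebra ℂ B] (R : Realization q ℓ B)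

theorem l_e (hq : q ≠ 0) (i j : Fin 2) :
    R.l i * R.e j = (q ^ (-cartan i j)) • (R.e j * R.l i) :=
  qcomm_inv (by rw [← zpow_add₀ hq, add_neg_cancel, zpow_zero]) (R.k_l i) (R.l_k i) (R.k_e i j)

theorem l_f (hq : q ≠ 0) (i j : Fin 2) :
    R.l i * R.f j = (q ^ cartan i j) • (R.f j * R.l i) :=
  qcomm_inv (by rw [← zpow_add₀ hq, neg_add_cancel, zpow_zero]) (R.k_l i) (R.l_k i) (R.k_f i j)

theorem k_k (i j : Fin 2) : R.k i * R.k j = R.k j * R.k i := by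
  have := R.k_comm
  fin_cases i <;> fin_cases j <;> simp [this]

theorem l_kj (i j : Fin 2) : R.l i * R.k j = R.k j * R.l i := by
  have := qcomm_inv (c := 1) (d := 1) (one_mul 1) (R.k_l i) (R.l_k i)
    (x := R.k j) (by rw [one_smul, R.k_k])
  rwa [one_smul] at this

theorem l_l (i j : Fin 2) : R.l i * R.l j = R.l j * R.l i := by
  have := qcomm_inv (c := 1) (d := 1) (one_mul 1) (R.k_l i) (R.l_k i)
    (x := R.l j) (by rw [one_smul, R.l_kj])
  rwa [one_smul] at this

theorem s_l (i : Fin 2) : R.s * R.l i = R.l i * R.s := by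
  have := qcomm_inv (c := 1) (d := 1) (one_mul 1) (R.k_l i) (R.l_k i)
    (x := R.s) (by rw [one_smul, R.s_k])
  rw [one_smul] at this
  exact this.symm

theorem sPow_comm {x : B} (h : R.s * x = x * R.s) (n : ℕ) : R.s ^ n * x = x * R.s ^ n :=
  (Commute.pow_left (show Commute R.s x from h) n).eq

/-- The image of a realization under an algebra homomorphism. -/
def map {C : Type*} [Ring C] [Algebra ℂ C] (φ : B →ₐ[ℂ] C) : Realization q ℓ C where
  e i := φ (R.e i)
  f i := φ (R.f i)
  k i := φ (R.k i)
  l i := φ (R.l i)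
  s := φ R.s
  k_comm := by rw [← map_mul, R.k_comm, map_mul]
  k_l i := by rw [← map_mul, R.k_l, map_one]
  l_k i := by rw [← map_mul, R.l_k, map_one]
  k_e i j := by rw [← map_mul, R.k_e, map_smul, map_mul]
  k_f i j := by rw [← map_mul, R.k_f, map_smul, map_mul]
  e_f_even := by rw [← map_mul, R.e_f_even]; simp
  e_f_odd := by rw [← map_mul, R.e_f_odd]; simp
  e_f_01 := by rw [← map_mul, R.e_f_01, map_mul]
  e_f_10 := by rw [← map_mul, R.e_f_10, map_mul]
  e_sq := by rw [← map_mul, R.e_sq, map_zero]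
  f_sq := by rw [← map_mul, R.f_sq, map_zero]
  serre_e := R.serre_e.map φ
  serre_f := R.serre_f.map φ
  e_pow := by rw [← map_pow, R.e_pow, map_zero]
  f_pow := by rw [← map_pow, R.f_pow, map_zero]
  s_s := by rw [← map_mul, R.s_s, map_one]
  s_e i := by rw [← map_mul, R.s_e, map_smul, map_mul]
  s_f i := by rw [← map_mul, R.s_f, map_smul, map_mul]
  s_k i := by rw [← map_mul, R.s_k, map_mul]

/-- The twist of a realization by the Chevalley involution, which exchanges the `e_i` and
the `f_i` up to sign. -/
def chevalley (hq : q ≠ 0) : Realization q ℓ B where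
  -- The sign is forced by the odd relation: the anticommutator is symmetric in e₂ and f₂, whereas
  -- k₂ - k₂⁻¹ changes sign under k₂ ↔ k₂⁻¹. For i = 1 the commutator already changes sign by
  -- itself.
  e i := ((-1 : ℂ) ^ deg i) • R.f i
  f := R.e
  k := R.l
  l := R.k
  s := R.s
  k_comm := R.l_l 0 1
  k_l := R.l_k
  l_k := R.k_l
  k_e i j := by
    rw [mul_smul_comm, R.l_f hq, smul_mul_assoc, smul_comm]
  k_f := R.l_e hq
  e_f_even := by
    simp only [deg, Matrix.cons_val_zero, pow_zero, one_smul, R.e_f_even]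
    module
  e_f_odd := by
    simp only [deg, Matrix.cons_val_one, Matrix.cons_val_fin_one, pow_one, smul_mul_assoc,
      mul_smul_comm, R.e_f_odd]
    module
  e_f_01 := by simp [deg, R.e_f_10]
  e_f_10 := by simp [deg, R.e_f_01]
  e_sq := by simp [deg, R.f_sq]
  f_sq := R.e_sq
  serre_e := by simpa using R.serre_f.smul _ _
  serre_f := R.serre_e
  e_pow := by simp [deg, R.f_pow]
  f_pow := R.e_pow
  s_s := R.s_s
  s_e i := by rw [mul_smul_comm, R.s_f, smul_mul_assoc]
  s_f := R.s_e
  s_k := R.s_l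

section Tensor

open Algebra.TensorProduct (tmul_mul_tmul)

variable {C : Type*} [Ring C] [Algebra ℂ C] (T : Realization q ℓ C)

/-- The tensor product of two realizations, formed with the coproduct `Δ^σ`. -/
def tensor (hq : q ≠ 0) (hζ : IsPrimitiveRoot (q ^ 2)⁻¹ ℓ) (hℓ : 0 < ℓ) :
    Realization q ℓ (B ⊗[ℂ] C) where
  e i := R.e i ⊗ₜ 1 + (R.l i * R.s ^ deg i) ⊗ₜ T.e i
  f i := R.f i ⊗ₜ T.k i + (R.s ^ deg i) ⊗ₜ T.f i
  k i := R.k i ⊗ₜ T.k i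
  l i := R.l i ⊗ₜ T.l i
  s := R.s ⊗ₜ T.s
  k_comm := by rw [tmul_mul_tmul, tmul_mul_tmul, R.k_comm, T.k_comm]
  k_l i := by rw [tmul_mul_tmul, R.k_l, T.k_l, Algebra.TensorProduct.one_def]
  l_k i := by rw [tmul_mul_tmul, R.l_k, T.l_k, Algebra.TensorProduct.one_def]
  k_e i j := by
    have h : R.k i * (R.l j * R.s ^ deg j) = (R.l j * R.s ^ deg j) * R.k i := by
      rw [← mul_assoc, ← R.l_kj, mul_assoc, ← R.sPow_comm (R.s_k i), mul_assoc]
    simp only [mul_add, add_mul, tmul_mul_tmul, h, R.k_e, T.k_e, one_mul, mul_one,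
      TensorProduct.tmul_smul, ← TensorProduct.smul_tmul', smul_add]
  k_f i j := by
    simp only [mul_add, add_mul, tmul_mul_tmul, ← R.sPow_comm (R.s_k i), R.k_f, T.k_f, T.k_k i j,
      TensorProduct.tmul_smul, ← TensorProduct.smul_tmul', smul_add]
  e_f_even := by
    simp [deg, mul_add, add_mul, tmul_mul_tmul, R.e_f_even, T.e_f_even, R.l_f hq, T.k_e, cartan,
      TensorProduct.tmul_smul, ← TensorProduct.smul_tmul', TensorProduct.tmul_add,
      TensorProduct.add_tmul, TensorProduct.tmul_sub, TensorProduct.sub_tmul]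
    match_scalars <;> field_simp <;> ring
  e_f_odd := by
    -- The mixed terms cancel because σ anticommutes with e₂ and f₂. The others telescope: (k - l) ⊗
    -- k + l ⊗ (k - l) = k ⊗ k - l ⊗ l.
    have h : R.s * (R.l 1 * R.s) = R.l 1 := by rw [← mul_assoc, R.s_l, mul_assoc, R.s_s, mul_one]
    simp [h, deg, mul_add, add_mul, tmul_mul_tmul, R.e_f_odd, T.e_f_odd, T.k_e, cartan,
      TensorProduct.tmul_smul, ← TensorProduct.smul_tmul', TensorProduct.tmul_add,
      TensorProduct.add_tmul, TensorProduct.tmul_sub, TensorProduct.sub_tmul, mul_assoc,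
      R.s_f, R.s_s, R.s_e, TensorProduct.tmul_neg, TensorProduct.neg_tmul,
      assoc_rule (R.l_f hq 1 1)]
    match_scalars <;> field_simp <;> ring
  e_f_01 := by
    simp [deg, mul_add, add_mul, tmul_mul_tmul, R.e_f_01, T.e_f_01, R.l_f hq, T.k_e, cartan,
      TensorProduct.tmul_smul, ← TensorProduct.smul_tmul', R.s_e, R.s_l]
    match_scalars <;> field_simp
  e_f_10 := by
    simp [deg, mul_add, add_mul, tmul_mul_tmul, R.e_f_10, T.e_f_10, T.k_e, cartan,
      TensorProduct.tmul_smul, ← TensorProduct.smul_tmul', R.s_f, mul_assoc,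
      assoc_rule (R.l_f hq 1 0)]
    match_scalars <;> field_simp
  e_sq := by
    simp [deg, mul_add, add_mul, tmul_mul_tmul, R.e_sq, T.e_sq, cartan,
      R.s_e, mul_assoc, assoc_rule (R.l_e hq 1 1), TensorProduct.neg_tmul]
  f_sq := by
    simp [deg, mul_add, add_mul, tmul_mul_tmul, R.f_sq, T.f_sq, T.k_f, cartan,
      R.s_f, TensorProduct.neg_tmul]
  serre_e := by
    refine IsSerre.add hq (R.serre_e.tmul_left rfl) (T.serre_e.tmul_right ?_) ?_ ?_ ?_
    · simp [deg, ← mul_assoc, R.l_l 0 1]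
      rw [mul_assoc, mul_assoc, R.s_l]
    · simp [deg, tmul_mul_tmul, R.l_e hq, cartan, ← TensorProduct.smul_tmul']
    · simp [deg, tmul_mul_tmul, R.l_e hq, cartan, ← TensorProduct.smul_tmul']
    · simp [deg, tmul_mul_tmul, cartan, ← TensorProduct.smul_tmul', mul_assoc, R.s_e,
        assoc_rule (R.l_e hq 1 0)]
  serre_f := by
    -- For the f_i it is the summand f ⊗ k that picks up q^{-2} when moved to the right past 1 ⊗ f,
    -- so the summands are swapped to match `IsSerre.add`.
    rw [add_comm (R.f 0 ⊗ₜ[ℂ] T.k 0), add_comm (R.f 1 ⊗ₜ[ℂ] T.k 1)]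
    refine IsSerre.add hq (T.serre_f.tmul_right ?_) (R.serre_f.tmul_left T.k_comm) ?_ ?_ ?_
    · simp [deg]
    · simp [deg, tmul_mul_tmul, T.k_f, cartan]
    · simp [deg, tmul_mul_tmul, T.k_f, cartan, R.s_f]
    · simp [deg, tmul_mul_tmul, T.k_f, cartan]
  e_pow := by
    -- The summands a = e₁ ⊗ 1 and b = k₁⁻¹ ⊗ e₁ satisfy b a = q^{-2} a b, and each has vanishing
    -- ℓ-th power.
    rw [add_pow_of_qcomm_primitiveRoot hζ hℓ]
    · simp [deg, R.e_pow, T.e_pow, Algebra.TensorProduct.tmul_pow]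
    · simp [deg, tmul_mul_tmul, R.l_e hq, cartan, ← TensorProduct.smul_tmul']
  f_pow := by
    rw [add_comm, add_pow_of_qcomm_primitiveRoot hζ hℓ]
    · simp [deg, R.f_pow, T.f_pow, Algebra.TensorProduct.tmul_pow]
    · simp [deg, tmul_mul_tmul, T.k_f, cartan]
  s_s := by rw [tmul_mul_tmul, R.s_s, T.s_s, Algebra.TensorProduct.one_def]
  s_e i := by
    simp only [mul_add, add_mul, tmul_mul_tmul, R.s_e, T.s_e, mul_one, one_mul,
      ← TensorProduct.smul_tmul', TensorProduct.tmul_smul, smul_add]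
    rw [← mul_assoc, R.s_l, mul_assoc, mul_assoc, ← pow_succ, ← pow_succ']
  s_f i := by
    simp only [mul_add, add_mul, tmul_mul_tmul, R.s_f, T.s_f, T.s_k,
      ← TensorProduct.smul_tmul', TensorProduct.tmul_smul, smul_add]
    rw [← pow_succ, ← pow_succ']
  s_k i := by rw [tmul_mul_tmul, R.s_k, T.s_k, tmul_mul_tmul]

end Tensor

end Realization

end QuantumSL21

/-! ### The antipode as a realization in the opposite algebra -/

namespace QuantumSL21

namespace Realization

variable {q : ℂ} {ℓ : ℕ} {B : Type*} [Ring B] [Algebra ℂ B] (R : Realization q ℓ B)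

theorem s_s_assoc (x : B) : R.s * (R.s * x) = x := assoc_one_rule R.s_s x
theorem s_k_assoc (i : Fin 2) (x : B) : R.s * (R.k i * x) = R.k i * (R.s * x) :=
  assoc_comm_rule (R.s_k i) x
theorem s_l_assoc (i : Fin 2) (x : B) : R.s * (R.l i * x) = R.l i * (R.s * x) :=
  assoc_comm_rule (R.s_l i) x
theorem l_k_assoc (i : Fin 2) (x : B) : R.l i * (R.k i * x) = x := assoc_one_rule (R.l_k i) x
theorem l_kj_assoc (i j : Fin 2) (x : B) : R.l i * (R.k j * x) = R.k j * (R.l i * x) :=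
  assoc_comm_rule (R.l_kj i j) x
theorem s_e_assoc (i : Fin 2) (x : B) :
    R.s * (R.e i * x) = ((-1 : ℂ) ^ deg i) • (R.e i * (R.s * x)) := assoc_rule (R.s_e i) x
theorem s_f_assoc (i : Fin 2) (x : B) :
    R.s * (R.f i * x) = ((-1 : ℂ) ^ deg i) • (R.f i * (R.s * x)) := assoc_rule (R.s_f i) x
theorem k_e_assoc (i j : Fin 2) (x : B) :
    R.k i * (R.e j * x) = (q ^ cartan i j) • (R.e j * (R.k i * x)) := assoc_rule (R.k_e i j) x
theorem k_f_assoc (i j : Fin 2) (x : B) :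
    R.k i * (R.f j * x) = (q ^ (-cartan i j)) • (R.f j * (R.k i * x)) := assoc_rule (R.k_f i j) x
theorem l_e_assoc (hq : q ≠ 0) (i j : Fin 2) (x : B) :
    R.l i * (R.e j * x) = (q ^ (-cartan i j)) • (R.e j * (R.l i * x)) :=
  assoc_rule (R.l_e hq i j) x
theorem l_f_assoc (hq : q ≠ 0) (i j : Fin 2) (x : B) :
    R.l i * (R.f j * x) = (q ^ cartan i j) • (R.f j * (R.l i * x)) :=
  assoc_rule (R.l_f hq i j) x

theorem cartan_comm (i j : Fin 2) : cartan i j = cartan j i := by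
  fin_cases i <;> fin_cases j <;> rfl

theorem e_k (hq : q ≠ 0) (i j : Fin 2) :
    R.e i * R.k j = (q ^ (-cartan i j)) • (R.k j * R.e i) := by
  rw [R.k_e, smul_smul, ← zpow_add₀ hq, cartan_comm i j, neg_add_cancel, zpow_zero, one_smul]

theorem e_l (hq : q ≠ 0) (i j : Fin 2) :
    R.e i * R.l j = (q ^ cartan i j) • (R.l j * R.e i) := by
  rw [R.l_e hq, smul_smul, ← zpow_add₀ hq, cartan_comm i j, add_neg_cancel, zpow_zero, one_smul]

theorem f_l (hq : q ≠ 0) (i j : Fin 2) :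
    R.f i * R.l j = (q ^ (-cartan i j)) • (R.l j * R.f i) := by
  rw [R.l_f hq, smul_smul, ← zpow_add₀ hq, cartan_comm i j, neg_add_cancel, zpow_zero, one_smul]

open MulOpposite in
/-- The realization in the opposite algebra given by the antipode `S^σ`. -/
def antipode (hq : q ≠ 0) : Realization q ℓ Bᵐᵒᵖ where
  e i := op (R.s ^ deg i * -(R.k i * R.e i))
  f i := op (R.s ^ deg i * -(R.f i * R.l i))
  k i := op (R.l i)
  l i := op (R.k i)
  s := op R.s
  k_comm := by rw [← op_mul, ← op_mul, R.l_l]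
  k_l i := by rw [← op_mul, R.k_l, op_one]
  l_k i := by rw [← op_mul, R.l_k, op_one]
  k_e i j := by
    have h : R.e j * R.l i = (q ^ cartan i j) • (R.l i * R.e j) := by
      rw [R.e_l hq, cartan_comm]
    rw [← op_mul, ← op_mul, ← op_smul]
    simp only [mul_neg, neg_mul, smul_neg, mul_assoc, h, mul_smul_comm]
    rw [← R.l_kj_assoc, ← assoc_comm_rule (R.sPow_comm (R.s_l i) _).symm]
  k_f i j := by
    have h : R.f j * R.l i = (q ^ (-cartan i j)) • (R.l i * R.f j) := by
      rw [R.f_l hq, cartan_comm]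
    rw [← op_mul, ← op_mul, ← op_smul]
    simp only [mul_neg, neg_mul, smul_neg, mul_assoc, R.l_l j i]
    rw [← mul_assoc (R.f j), h, smul_mul_assoc, mul_smul_comm, mul_assoc,
      ← assoc_comm_rule (R.sPow_comm (R.s_l i) _).symm]
  e_f_even := by
    simp only [← op_mul, ← op_sub, ← op_add, ← op_smul]
    congr 1
    simp [deg, cartan, mul_assoc, R.l_k_assoc, R.k_e_assoc, R.k_f_assoc, R.e_f_even, R.k_l, hq]
    module
  e_f_odd := by
    have h₁ : R.s * (R.f 1 * R.l 1) * (R.s * (R.k 1 * R.e 1)) = -(R.f 1 * R.e 1) := by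
      simp [deg, mul_assoc, ← R.s_l_assoc, R.l_k_assoc, R.s_f_assoc, R.s_s_assoc]
    have h₂ : R.s * (R.k 1 * R.e 1) * (R.s * (R.f 1 * R.l 1)) = -(R.e 1 * R.f 1) := by
      simp [deg, cartan, mul_assoc, R.s_f_assoc, R.s_e_assoc, R.s_l, R.s_k_assoc, R.k_e_assoc,
        R.k_f_assoc, R.s_l_assoc, R.k_l, R.s_s]
    simp only [← op_mul, ← op_sub, ← op_add, ← op_smul, ← op_neg]
    congr 1
    simp only [deg, Matrix.cons_val_one, Matrix.cons_val_fin_one, pow_one, mul_neg, neg_mul,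
      _root_.neg_neg, h₁, h₂, R.e_f_odd]
    module
  e_f_01 := by
    simp only [← op_mul]
    congr 1
    simp [deg, cartan, mul_assoc, R.k_f_assoc, R.s_e_assoc, assoc_comm_rule R.e_f_01,
      R.l_kj_assoc, R.s_f_assoc, R.l_e_assoc hq, R.s_l, R.k_e,
      R.s_k]
  e_f_10 := by
    simp only [← op_mul]
    congr 1
    simp [deg, cartan, mul_assoc, R.k_f_assoc, R.s_e_assoc, assoc_comm_rule R.e_f_10,
      R.l_kj_assoc, R.s_f_assoc, R.l_e_assoc hq, R.s_l, R.k_e,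
      R.s_k]
  e_sq := by
    rw [← op_mul]
    simp [deg, cartan, mul_assoc, R.k_e_assoc, R.s_k_assoc, R.s_e_assoc, R.k_e,
      assoc_zero_rule R.e_sq]
  f_sq := by
    rw [← op_mul]
    simp [deg, cartan, mul_assoc, R.l_f_assoc hq, R.s_l_assoc, R.s_f_assoc,
      assoc_zero_rule R.f_sq]
  serre_e := by
    -- The σ in S(e₂) is absorbed into the torus factor; since σ commutes with e₁ and k₁ it does not
    -- affect the exponents required by `IsSerre.mul`.
    have h := R.serre_e.mul hq (k₁ := R.k 0) (k₂ := R.s * R.k 1) ?_ ?_ ?_ ?_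
    · simpa [deg, mul_assoc] using h.neg_neg.op
    · rw [mul_assoc, R.k_k 1 0, R.s_k_assoc]
    · simpa [cartan] using R.e_k hq 0 0
    · have := R.e_k hq 0 1
      rw [← mul_assoc, show R.e 0 * R.s = R.s * R.e 0 by simp [R.s_e, deg], mul_assoc, this]
      simp [cartan, mul_assoc]
    · simpa [cartan] using R.e_k hq 1 0
  serre_f := by
    have h := R.serre_f.mul hq (k₁ := R.l 0) (k₂ := R.s * R.l 1) ?_ ?_ ?_ ?_
    -- The antipode has f_i on the left of k_i⁻¹. Exchanging them costs q^{-a_ii}, which is q^{-2}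
    -- for i = 1 and 1 for i = 2.
    · have h₂ := (h.smul (q ^ 2)⁻¹ 1).neg_neg.op
      have h₃ := R.f_l hq 0 0
      have h₄ := R.f_l hq 1 1
      simp only [cartan, Matrix.of_apply, Matrix.cons_val_zero, Matrix.cons_val_one,
        Matrix.cons_val_fin_one, zpow_neg, neg_zero, zpow_zero, one_smul] at h₂ h₃ h₄
      simpa [deg, mul_assoc, h₃, h₄, -MulOpposite.op_smul, -MulOpposite.op_mul] using h₂
    · rw [mul_assoc, R.l_l 1 0, R.s_l_assoc]
    · simpa [cartan] using R.f_l hq 0 0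
    · have := R.f_l hq 0 1
      rw [← mul_assoc, show R.f 0 * R.s = R.s * R.f 0 by simp [R.s_f, deg], mul_assoc, this]
      simp [cartan, mul_assoc]
    · simpa [cartan] using R.f_l hq 1 0
  e_pow := by
    rw [← op_pow]
    have h := mul_pow_eq_zero_of_qcomm (R.e_k hq 0 0) R.e_pow
    simp [deg, neg_pow (R.k 0 * R.e 0), h]
  f_pow := by
    rw [← op_pow]
    have h := mul_pow_eq_zero_of_qcomm (R.f_l hq 0 0) R.f_pow
    rw [R.f_l hq 0 0, deg, Matrix.cons_val_zero, pow_zero, one_mul, neg_pow, smul_pow, h,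
      smul_zero, mul_zero, op_zero]
  s_s := by rw [← op_mul, R.s_s, op_one]
  s_e i := by
    rw [← op_mul, ← op_mul, ← op_smul]
    congr 1
    fin_cases i
    · simp [deg, R.s_k_assoc, R.s_e, mul_assoc]
    · simp [deg, R.s_k_assoc, R.s_e, R.s_e_assoc, mul_assoc]
  s_f i := by
    rw [← op_mul, ← op_mul, ← op_smul]
    congr 1
    fin_cases i
    · simp [deg, R.s_f_assoc, R.s_l, mul_assoc]
    · simp [deg, R.s_f_assoc, ← R.s_l, mul_assoc]
  s_k i := by rw [← op_mul, ← op_mul, R.s_l]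

end Realization

end QuantumSL21

/-! ### The universal property of the bosonization -/

namespace QuantumSL21

namespace Usigma

/-- The inclusion of `U` in `U^σ` as an algebra homomorphism. -/
def inclHom (ℓ : ℕ) : U ℓ →ₐ[ℂ] Usigma ℓ where
  toFun := incl ℓ
  map_one' := rfl
  map_mul' x y := by
    unfold incl
    exact ((SkewMonoidAlgebra.single_mul_single (k := U ℓ) (G := C2)).trans
      (by rw [one_smul, one_mul])).symm
  map_zero' := SkewMonoidAlgebra.single_zero _
  map_add' x y := SkewMonoidAlgebra.single_add _ _ _
  commutes' c := rfl

theorem σ_mul_incl (ℓ : ℕ) (x : U ℓ) : σ ℓ * incl ℓ x = incl ℓ (parity ℓ x) * σ ℓ := by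
  unfold incl σ
  refine (SkewMonoidAlgebra.single_mul_single (k := U ℓ) (G := C2)).trans ?_
  refine Eq.trans ?_ (SkewMonoidAlgebra.single_mul_single (k := U ℓ) (G := C2)).symm
  rw [one_smul, mul_one, one_mul, mul_one, one_mul]
  congr 1

theorem σ_mul_σ (ℓ : ℕ) : σ ℓ * σ ℓ = 1 := by
  unfold σ
  refine (SkewMonoidAlgebra.single_mul_single (k := U ℓ) (G := C2)).trans ?_
  rw [smul_one, mul_one]
  rfl

theorem exists_eq_incl_add_incl_mul_σ (ℓ : ℕ) (x : Usigma ℓ) :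
    ∃ a b : U ℓ, x = incl ℓ a + incl ℓ b * σ ℓ := by
  have h (g : C2) (r : U ℓ) : ∃ a b : U ℓ,
      (SkewMonoidAlgebra.single g r : Usigma ℓ) = incl ℓ a + incl ℓ b * σ ℓ := by
    by_cases hg : g = 1
    · refine ⟨r, 0, ?_⟩
      have : incl ℓ (0 : U ℓ) = 0 := map_zero (inclHom ℓ)
      rw [this, zero_mul, add_zero, hg]
      rfl
    · have hg' : g = Multiplicative.ofAdd 1 := by
        revert g; decide
      refine ⟨0, r, ?_⟩
      have : incl ℓ (0 : U ℓ) = 0 := map_zero (inclHom ℓ)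
      rw [this, zero_add, hg']
      refine Eq.trans ?_ (SkewMonoidAlgebra.single_mul_single (k := U ℓ) (G := C2)).symm
      rw [one_smul, mul_one, one_mul]
  refine SkewMonoidAlgebra.induction_on (k := U ℓ) (G := C2)
    (p := fun x : Usigma ℓ => ∃ a b : U ℓ, x = incl ℓ a + incl ℓ b * σ ℓ) x ?_ h ?_
  · have h0 := h 1 0
    rwa [SkewMonoidAlgebra.single_zero] at h0
  · rintro x y ⟨a, b, rfl⟩ ⟨c, d, rfl⟩
    refine ⟨a + c, b + d, ?_⟩
    have h (x y : U ℓ) : incl ℓ (x + y) = incl ℓ x + incl ℓ y := map_add (inclHom ℓ) x y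
    refine Eq.trans ?_ (congrArg₂ (fun x y => x + y * σ ℓ) (h a c) (h b d)).symm
    have key (p q r s t : Usigma ℓ) : (p + q * t) + (r + s * t) = p + r + (q + s) * t := by
      rw [add_mul]; abel
    exact key _ _ _ _ _

end Usigma

variable {ℓ : ℕ} {B : Type*} [Ring B] [Algebra ℂ B]

/-- The value of a realization on the generators of `U`. -/
def Realization.gen {q : ℂ} (R : Realization q ℓ B) : Gen → B
  | .e i => R.e i
  | .f i => R.f i
  | .k i => R.k i
  | .kinv i => R.l i

/-- The homomorphism from `U` given by a realization. -/
def Realization.liftU (R : Realization (xi ℓ) ℓ B) : U ℓ →ₐ[ℂ] B :=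
  U.lift (FreeAlgebra.lift ℂ R.gen) (by
    intro x y h
    cases h with
    | k_comm => simpa [Realization.gen] using R.k_comm
    | k_mul_kinv i => simpa [Realization.gen] using R.k_l i
    | kinv_mul_k i => simpa [Realization.gen] using R.l_k i
    | k_e i j => simp [Realization.gen, mul_assoc, R.k_l, R.k_e_assoc]
    | k_f i j => simp [Realization.gen, mul_assoc, R.k_l, R.k_f_assoc]
    | e_f_even => simp [Realization.gen, R.e_f_even]
    | e_f_odd => simp [Realization.gen, R.e_f_odd]
    | e_f_01 => simp [Realization.gen, R.e_f_01]
    | e_f_10 => simp [Realization.gen, R.e_f_10]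
    | e_sq => simp [Realization.gen, pow_two, R.e_sq]
    | f_sq => simp [Realization.gen, pow_two, R.f_sq]
    | serre_e =>
      have := R.serre_e
      simp only [IsSerre] at this
      simp [Realization.gen, pow_two, mul_assoc, this]
    | serre_f =>
      have := R.serre_f
      simp only [IsSerre] at this
      simp [Realization.gen, pow_two, mul_assoc, this]
    | e_pow => simp [Realization.gen, R.e_pow]
    | f_pow => simp [Realization.gen, R.f_pow])

theorem Realization.liftU_mk_ι (R : Realization (xi ℓ) ℓ B) (g : Gen) :
    R.liftU (U.mk ℓ (FreeAlgebra.ι ℂ g)) = R.gen g := by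
  rw [Realization.liftU, U.lift_mk, FreeAlgebra.lift_ι_apply]

theorem Realization.s_gen {q : ℂ} (R : Realization q ℓ B) (g : Gen) :
    R.s * R.gen g = g.sign • (R.gen g * R.s) := by
  cases g with
  | e i => exact R.s_e i
  | f i => exact R.s_f i
  | k i => simpa [Gen.sign, Realization.gen] using R.s_k i
  | kinv i => simpa [Gen.sign, Realization.gen] using R.s_l i

/-- Since s² = 1, conjugation by s is an algebra homomorphism. Composed with `liftU`, it agrees on
the generators with `liftU` after parity. This is the compatibility that lets `liftU` and σ ↦ s
combine into a map from the semidirect product. -/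
theorem Realization.liftU_parity (R : Realization (xi ℓ) ℓ B) (x : U ℓ) :
    R.liftU (parity ℓ x) * R.s = R.s * R.liftU x := by
  let c : U ℓ →ₐ[ℂ] B := AlgHom.ofLinearMap
    ((LinearMap.mulLeft ℂ R.s).comp ((LinearMap.mulRight ℂ R.s).comp R.liftU.toLinearMap))
    (by simp [R.s_s]) (fun x y => by simp [mul_assoc, R.s_s_assoc])
  have h : R.liftU.comp (parity ℓ) = c := by
    refine U.algHom_ext fun g => ?_
    have hg : c (U.mk ℓ (FreeAlgebra.ι ℂ g)) = R.s * (R.gen g * R.s) := by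
      simp [c, R.liftU_mk_ι]
    rw [hg, AlgHom.comp_apply, parity_mk_ι, map_smul, R.liftU_mk_ι, ← mul_assoc, R.s_gen,
      smul_mul_assoc, mul_assoc, R.s_s, mul_one]
  have h' := DFunLike.congr_fun h x
  rw [AlgHom.comp_apply] at h'
  rw [h']
  simp [c, mul_assoc, R.s_s]

/-- The homomorphism from `ℤ/2ℤ` given by a realization. -/
def Realization.liftC2 {q : ℂ} (R : Realization q ℓ B) : C2 →* B where
  toFun g := if g = 1 then 1 else R.s
  map_one' := if_pos rfl
  map_mul' g h := by
    have key : ∀ g h : C2, g ≠ 1 → (g * h = 1 ↔ h ≠ 1) := by decide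
    by_cases hg : g = 1 <;> by_cases hh : h = 1 <;> simp [hg, hh, key g h, R.s_s]

/-- The homomorphism from `U^σ` given by a realization. -/
def Realization.lift (R : Realization (xi ℓ) ℓ B) : Usigma ℓ →ₐ[ℂ] B :=
  SkewMonoidAlgebra.liftNCAlgHom (k := ℂ) (G := C2) R.liftU R.liftC2 (by
    intro x y
    by_cases hy : y = 1
    · simp [hy]
    · have h₁ : y • x = parity ℓ x := if_neg hy
      have h₂ : R.liftC2 y = R.s := if_neg hy
      rw [h₁, h₂, R.liftU_parity])

theorem Realization.lift_incl (R : Realization (xi ℓ) ℓ B) (x : U ℓ) :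
    R.lift (Usigma.incl ℓ x) = R.liftU x := by
  refine (SkewMonoidAlgebra.liftNC_single (k := U ℓ) (G := C2) _ _ _ _).trans ?_
  simp

theorem Realization.lift_σ (R : Realization (xi ℓ) ℓ B) : R.lift (Usigma.σ ℓ) = R.s := by
  refine (SkewMonoidAlgebra.liftNC_single (k := U ℓ) (G := C2) _ _ _ _).trans ?_
  have : R.liftC2 (Multiplicative.ofAdd 1) = R.s :=
    if_neg (t := (1 : B)) (c := (Multiplicative.ofAdd 1 : C2) = 1) (by decide)
  exact (congrArg₂ (· * ·) (map_one R.liftU) this).trans (one_mul _)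

theorem Realization.lift_e (R : Realization (xi ℓ) ℓ B) (i : Fin 2) :
    R.lift (Usigma.e ℓ i) = R.e i := by
  rw [Usigma.e, R.lift_incl, R.liftU_mk_ι]; rfl

theorem Realization.lift_f (R : Realization (xi ℓ) ℓ B) (i : Fin 2) :
    R.lift (Usigma.f ℓ i) = R.f i := by
  rw [Usigma.f, R.lift_incl, R.liftU_mk_ι]; rfl

theorem Realization.lift_k (R : Realization (xi ℓ) ℓ B) (i : Fin 2) :
    R.lift (Usigma.k ℓ i) = R.k i := by
  rw [Usigma.k, R.lift_incl, R.liftU_mk_ι]; rfl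

theorem Realization.lift_kinv (R : Realization (xi ℓ) ℓ B) (i : Fin 2) :
    R.lift (Usigma.kinv ℓ i) = R.l i := by
  rw [Usigma.kinv, R.lift_incl, R.liftU_mk_ι]; rfl

/-- The tautological realization, in `U^σ` itself. -/
def Usigma.realization (ℓ : ℕ) : Realization (xi ℓ) ℓ (Usigma ℓ) :=
  let φ : FreeAlgebra ℂ Gen →ₐ[ℂ] Usigma ℓ := (Usigma.inclHom ℓ).comp (U.mk ℓ)
  have hφ {x y : FreeAlgebra ℂ Gen} (h : Rel ℓ x y) : φ x = φ y :=
    congrArg (Usigma.inclHom ℓ) (U.mk_rel h)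
  have hs (g : Gen) : σ ℓ * φ (FreeAlgebra.ι ℂ g) = g.sign • (φ (FreeAlgebra.ι ℂ g) * σ ℓ) := by
    have h := Usigma.σ_mul_incl ℓ (U.mk ℓ (FreeAlgebra.ι ℂ g))
    rw [parity_mk_ι] at h
    refine h.trans ?_
    rw [← smul_mul_assoc]
    exact congrArg (· * σ ℓ) (map_smul (Usigma.inclHom ℓ) _ _)
  have hkl (i : Fin 2) : φ (freeK i) * φ (freeKinv i) = 1 := by
    rw [← map_mul, hφ (Rel.k_mul_kinv i), map_one]
  have hlk (i : Fin 2) : φ (freeKinv i) * φ (freeK i) = 1 := by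
    rw [← map_mul, hφ (Rel.kinv_mul_k i), map_one]
  { e := fun i => φ (freeE i)
    f := fun i => φ (freeF i)
    k := fun i => φ (freeK i)
    l := fun i => φ (freeKinv i)
    s := σ ℓ
    k_comm := by simpa only [map_mul] using hφ Rel.k_comm
    k_l := hkl
    l_k := hlk
    k_e := fun i j => by
      have := hφ (Rel.k_e i j)
      rw [map_mul, map_mul, map_smul] at this
      rw [← smul_mul_assoc, ← this, mul_assoc, hlk, mul_one]
    k_f := fun i j => by
      have := hφ (Rel.k_f i j)
      rw [map_mul, map_mul, map_smul] at this
      rw [← smul_mul_assoc, ← this, mul_assoc, hlk, mul_one]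
    e_f_even := by
      have := hφ Rel.e_f_even
      rw [map_sub, map_mul, map_mul, map_smul, map_sub] at this
      rw [← this]; abel
    e_f_odd := by
      have := hφ Rel.e_f_odd
      rw [map_add, map_mul, map_mul, map_smul, map_sub] at this
      rw [← this]; abel
    e_f_01 := by
      have := hφ Rel.e_f_01
      rw [map_sub, map_mul, map_mul, map_zero] at this
      exact sub_eq_zero.1 this
    e_f_10 := by
      have := hφ Rel.e_f_10
      rw [map_sub, map_mul, map_mul, map_zero] at this
      exact sub_eq_zero.1 this
    e_sq := by
      have := hφ Rel.e_sq
      rwa [map_pow, map_zero, pow_two] at this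
    f_sq := by
      have := hφ Rel.f_sq
      rwa [map_pow, map_zero, pow_two] at this
    serre_e := by
      have := hφ Rel.serre_e
      simp only [map_add, map_sub, map_mul, map_smul, map_zero, pow_two, mul_assoc] at this
      rw [IsSerre, ← sub_eq_zero, ← this]; abel
    serre_f := by
      have := hφ Rel.serre_f
      simp only [map_add, map_sub, map_mul, map_smul, map_zero, pow_two, mul_assoc] at this
      rw [IsSerre, ← sub_eq_zero, ← this]; abel
    e_pow := by
      have := hφ Rel.e_pow
      rwa [map_pow, map_zero] at this
    f_pow := by
      have := hφ Rel.f_pow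
      rwa [map_pow, map_zero] at this
    s_s := Usigma.σ_mul_σ ℓ
    s_e := fun i => hs (Gen.e i)
    s_f := fun i => hs (Gen.f i)
    s_k := fun i => by simpa [Gen.sign] using hs (Gen.k i) }

/-- A subalgebra of `U^σ` that contains the generators is everything. -/
theorem Usigma.subalgebra_eq_top {S : Subalgebra ℂ (Usigma ℓ)} (he : ∀ i, e ℓ i ∈ S)
    (hf : ∀ i, f ℓ i ∈ S) (hk : ∀ i, k ℓ i ∈ S) (hl : ∀ i, kinv ℓ i ∈ S) (hs : σ ℓ ∈ S) :
    S = ⊤ := by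
  have hU (x : U ℓ) : incl ℓ x ∈ S := by
    obtain ⟨y, rfl⟩ := RingQuot.mkAlgHom_surjective ℂ (Rel ℓ) x
    change (inclHom ℓ).comp (U.mk ℓ) y ∈ S
    induction y using FreeAlgebra.induction with
    | grade0 r => rw [AlgHom.commutes]; exact S.algebraMap_mem r
    | grade1 g =>
      cases g with
      | e i => exact he i
      | f i => exact hf i
      | k i => exact hk i
      | kinv i => exact hl i
    | mul a b ha hb => rw [map_mul]; exact S.mul_mem ha hb
    | add a b ha hb => rw [map_add]; exact S.add_mem ha hb
  refine eq_top_iff.2 fun x _ => ?_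
  obtain ⟨a, b, rfl⟩ := exists_eq_incl_add_incl_mul_σ ℓ x
  exact S.add_mem (hU a) (S.mul_mem (hU b) hs)

theorem Usigma.algHom_ext {φ ψ : Usigma ℓ →ₐ[ℂ] B} (he : ∀ i, φ (e ℓ i) = ψ (e ℓ i))
    (hf : ∀ i, φ (f ℓ i) = ψ (f ℓ i)) (hk : ∀ i, φ (k ℓ i) = ψ (k ℓ i))
    (hl : ∀ i, φ (kinv ℓ i) = ψ (kinv ℓ i)) (hs : φ (σ ℓ) = ψ (σ ℓ)) : φ = ψ := by
  have h : AlgHom.equalizer φ ψ = ⊤ := Usigma.subalgebra_eq_top he hf hk hl hs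
  ext x
  have : x ∈ AlgHom.equalizer φ ψ := h ▸ Algebra.mem_top
  exact this

end QuantumSL21

/-! ### The Hopf algebra structure of the bosonization -/

namespace QuantumSL21

section Roots

theorem xi_eq (ℓ : ℕ) : xi ℓ = Complex.exp (2 * Real.pi * Complex.I / ℓ) := by
  rw [xi, xiPow, mul_one]

theorem xi_isPrimitiveRoot {ℓ : ℕ} (hℓ : 3 ≤ ℓ) : IsPrimitiveRoot (xi ℓ) ℓ := by
  rw [xi_eq]
  exact Complex.isPrimitiveRoot_exp ℓ (by omega)

theorem xi_ne_zero (ℓ : ℕ) : xi ℓ ≠ 0 := by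
  rw [xi_eq]
  exact Complex.exp_ne_zero _

theorem xi_sq_inv_isPrimitiveRoot {ℓ : ℕ} (hℓ : 3 ≤ ℓ) (hodd : Odd ℓ) :
    IsPrimitiveRoot (xi ℓ ^ 2)⁻¹ ℓ :=
  ((xi_isPrimitiveRoot hℓ).pow_of_coprime 2 (Nat.coprime_two_left.2 hodd)).inv

theorem xiPowEll_mk (ℓ : ℕ) (z : ℂ) :
    xiPowEll ℓ (QuotientAddGroup.mk z) = xiPow ℓ (ℓ * z) := rfl

theorem xiPowEll_add (ℓ : ℕ) (a b : ℂ ⧸ AddSubgroup.zmultiples (1 : ℂ)) :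
    xiPowEll ℓ (a + b) = xiPowEll ℓ a * xiPowEll ℓ b := by
  induction a using QuotientAddGroup.induction_on
  induction b using QuotientAddGroup.induction_on
  rw [← QuotientAddGroup.mk_add, xiPowEll_mk, xiPowEll_mk, xiPowEll_mk, xiPow, xiPow, xiPow,
    ← Complex.exp_add]
  congr 1
  ring

theorem xiPowEll_zero (ℓ : ℕ) : xiPowEll ℓ 0 = 1 := by
  rw [← QuotientAddGroup.mk_zero, xiPowEll_mk, xiPow]
  simp

theorem xiPowEll_ne_zero (ℓ : ℕ) (a : ℂ ⧸ AddSubgroup.zmultiples (1 : ℂ)) :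
    xiPowEll ℓ a ≠ 0 := by
  induction a using QuotientAddGroup.induction_on
  exact Complex.exp_ne_zero _

end Roots

section Antipode

variable {A B C : Type*} [Ring A] [Algebra ℂ A] [Ring B] [Algebra ℂ B] [Ring C] [Algebra ℂ C]

/-- An algebra homomorphism to the opposite algebra, as a linear map. -/
def unopLinear (S : A →ₐ[ℂ] Bᵐᵒᵖ) : A →ₗ[ℂ] B :=
  (MulOpposite.opLinearEquiv ℂ).symm.toLinearMap.comp S.toLinearMap

theorem unopLinear_apply (S : A →ₐ[ℂ] Bᵐᵒᵖ) (x : A) : unopLinear S x = (S x).unop := rfl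

/-- As S reverses products, m(S ⊗ id) sends X (a ⊗ b) to S(a) · m(S ⊗ id)(X) · b, and a scalar in
the middle can be pulled out. Consequently the elements satisfying the left antipode axiom are
closed under products. -/
theorem mul'_rTensor_mul (S : A →ₐ[ℂ] Bᵐᵒᵖ) {c : ℂ} {X : A ⊗[ℂ] B}
    (hX : LinearMap.mul' ℂ B ((unopLinear S).rTensor B X) = algebraMap ℂ B c) (Y : A ⊗[ℂ] B) :
    LinearMap.mul' ℂ B ((unopLinear S).rTensor B (X * Y)) =
      c • LinearMap.mul' ℂ B ((unopLinear S).rTensor B Y) := by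
  induction Y with
  | zero => simp
  | add Y₁ Y₂ h₁ h₂ => rw [mul_add, map_add, map_add, h₁, h₂, map_add, map_add, smul_add]
  | tmul a b =>
    have key : LinearMap.mul' ℂ B ((unopLinear S).rTensor B (X * (a ⊗ₜ b))) =
        unopLinear S a * LinearMap.mul' ℂ B ((unopLinear S).rTensor B X) * b := by
      clear hX
      induction X with
      | zero => simp
      | add X₁ X₂ h₁ h₂ => simp only [add_mul, mul_add, map_add, h₁, h₂]
      | tmul x y => simp [unopLinear_apply, mul_assoc]
    rw [key, hX, ← Algebra.commutes, mul_assoc, ← Algebra.smul_def]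
    simp

/-- The mirror image of `mul'_rTensor_mul`: for m(id ⊗ S) it is the right-hand factor that ends up
in the middle, so the hypothesis is on Y. -/
theorem mul'_lTensor_mul (S : A →ₐ[ℂ] Bᵐᵒᵖ) {c : ℂ} {Y : B ⊗[ℂ] A}
    (hY : LinearMap.mul' ℂ B ((unopLinear S).lTensor B Y) = algebraMap ℂ B c) (X : B ⊗[ℂ] A) :
    LinearMap.mul' ℂ B ((unopLinear S).lTensor B (X * Y)) =
      c • LinearMap.mul' ℂ B ((unopLinear S).lTensor B X) := by
  induction X with
  | zero => simp
  | add X₁ X₂ h₁ h₂ => rw [add_mul, map_add, map_add, h₁, h₂, map_add, map_add, smul_add]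
  | tmul b a =>
    have key : LinearMap.mul' ℂ B ((unopLinear S).lTensor B ((b ⊗ₜ a) * Y)) =
        b * LinearMap.mul' ℂ B ((unopLinear S).lTensor B Y) * unopLinear S a := by
      clear hY
      induction Y with
      | zero => simp
      | add X₁ X₂ h₁ h₂ => simp only [add_mul, mul_add, map_add, h₁, h₂]
      | tmul x y => simp [unopLinear_apply, mul_assoc]
    rw [key, hY, ← Algebra.commutes, mul_assoc, ← Algebra.smul_def]
    simp

end Antipode

/-- The realization that defines the counit. -/
def counitRealization (q : ℂ) {ℓ : ℕ} (hℓ : ℓ ≠ 0) : Realization q ℓ ℂ where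
  e _ := 0
  f _ := 0
  k _ := 1
  l _ := 1
  s := 1
  k_comm := rfl
  k_l _ := one_mul 1
  l_k _ := one_mul 1
  k_e _ _ := by simp
  k_f _ _ := by simp
  e_f_even := by simp
  e_f_odd := by simp
  e_f_01 := rfl
  e_f_10 := rfl
  e_sq := zero_mul 0
  f_sq := zero_mul 0
  serre_e := by simp [IsSerre]
  serre_f := by simp [IsSerre]
  e_pow := zero_pow hℓ
  f_pow := zero_pow hℓ
  s_s := one_mul 1
  s_e _ := by simp
  s_f _ := by simp
  s_k _ := rfl

namespace Usigma

variable (ℓ : ℕ) (hℓ : 3 ≤ ℓ) (hodd : Odd ℓ)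

/-- The coproduct `Δ^σ`. -/
def comul : Usigma ℓ →ₐ[ℂ] Usigma ℓ ⊗[ℂ] Usigma ℓ :=
  ((realization ℓ).tensor (realization ℓ) (xi_ne_zero ℓ) (xi_sq_inv_isPrimitiveRoot hℓ hodd)
    (by omega)).lift

/-- The counit `ε^σ`. -/
def counit : Usigma ℓ →ₐ[ℂ] ℂ := (counitRealization (xi ℓ) (show ℓ ≠ 0 by omega)).lift

/-- The antipode `S^σ`, as a homomorphism to the opposite algebra. -/
def antipode : Usigma ℓ →ₐ[ℂ] (Usigma ℓ)ᵐᵒᵖ := ((realization ℓ).antipode (xi_ne_zero ℓ)).lift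

theorem comul_e (i : Fin 2) : comul ℓ hℓ hodd (e ℓ i) =
    e ℓ i ⊗ₜ 1 + (kinv ℓ i * σ ℓ ^ deg i) ⊗ₜ e ℓ i := Realization.lift_e _ i
theorem comul_f (i : Fin 2) : comul ℓ hℓ hodd (f ℓ i) =
    f ℓ i ⊗ₜ k ℓ i + (σ ℓ ^ deg i) ⊗ₜ f ℓ i := Realization.lift_f _ i
theorem comul_k (i : Fin 2) : comul ℓ hℓ hodd (k ℓ i) = k ℓ i ⊗ₜ k ℓ i := Realization.lift_k _ i
theorem comul_kinv (i : Fin 2) : comul ℓ hℓ hodd (kinv ℓ i) = kinv ℓ i ⊗ₜ kinv ℓ i :=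
  Realization.lift_kinv _ i
theorem comul_σ : comul ℓ hℓ hodd (σ ℓ) = σ ℓ ⊗ₜ σ ℓ := Realization.lift_σ _

theorem counit_e (i : Fin 2) : counit ℓ hℓ (e ℓ i) = 0 := Realization.lift_e _ i
theorem counit_f (i : Fin 2) : counit ℓ hℓ (f ℓ i) = 0 := Realization.lift_f _ i
theorem counit_k (i : Fin 2) : counit ℓ hℓ (k ℓ i) = 1 := Realization.lift_k _ i
theorem counit_kinv (i : Fin 2) : counit ℓ hℓ (kinv ℓ i) = 1 := Realization.lift_kinv _ i
theorem counit_σ : counit ℓ hℓ (σ ℓ) = 1 := Realization.lift_σ _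

theorem antipode_e (i : Fin 2) : unopLinear (antipode ℓ) (e ℓ i) =
    σ ℓ ^ deg i * -(k ℓ i * e ℓ i) :=
  congrArg MulOpposite.unop (Realization.lift_e _ i)
theorem antipode_f (i : Fin 2) : unopLinear (antipode ℓ) (f ℓ i) =
    σ ℓ ^ deg i * -(f ℓ i * kinv ℓ i) :=
  congrArg MulOpposite.unop (Realization.lift_f _ i)
theorem antipode_k (i : Fin 2) : unopLinear (antipode ℓ) (k ℓ i) = kinv ℓ i :=
  congrArg MulOpposite.unop (Realization.lift_k _ i)
theorem antipode_kinv (i : Fin 2) : unopLinear (antipode ℓ) (kinv ℓ i) = k ℓ i :=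
  congrArg MulOpposite.unop (Realization.lift_kinv _ i)
theorem antipode_σ : unopLinear (antipode ℓ) (σ ℓ) = σ ℓ :=
  congrArg MulOpposite.unop (Realization.lift_σ _)

theorem antipode_one : unopLinear (antipode ℓ) 1 = 1 := by
  rw [unopLinear_apply, map_one, MulOpposite.unop_one]

theorem antipode_mul (x y : Usigma ℓ) : unopLinear (antipode ℓ) (x * y) =
    unopLinear (antipode ℓ) y * unopLinear (antipode ℓ) x := by
  simp only [unopLinear_apply, map_mul, MulOpposite.unop_mul]

theorem antipode_σ_pow (i : Fin 2) : unopLinear (antipode ℓ) (σ ℓ ^ deg i) = σ ℓ ^ deg i := by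
  fin_cases i
  · simp [deg, antipode_one]
  · simp [deg, antipode_σ]

theorem comul_coassoc (x : Usigma ℓ) :
    TensorProduct.assoc ℂ _ _ _ ((comul ℓ hℓ hodd).toLinearMap.rTensor _ (comul ℓ hℓ hodd x)) =
      (comul ℓ hℓ hodd).toLinearMap.lTensor _ (comul ℓ hℓ hodd x) := by
  have h : ((Algebra.TensorProduct.assoc ℂ ℂ ℂ (Usigma ℓ) (Usigma ℓ) (Usigma ℓ)).toAlgHom.comp
      (Algebra.TensorProduct.map (comul ℓ hℓ hodd) (AlgHom.id ℂ _))).comp (comul ℓ hℓ hodd) =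
      (Algebra.TensorProduct.map (AlgHom.id ℂ _) (comul ℓ hℓ hodd)).comp (comul ℓ hℓ hodd) := by
    refine algHom_ext (fun i => ?_) (fun i => ?_) (fun i => ?_) (fun i => ?_) ?_ <;>
      simp [comul_e, comul_f, comul_k, comul_kinv, comul_σ, Algebra.TensorProduct.one_def,
        TensorProduct.add_tmul, TensorProduct.tmul_add, add_assoc, Algebra.TensorProduct.tmul_pow]
  exact DFunLike.congr_fun h x

theorem lTensor_counit (x : Usigma ℓ) :
    TensorProduct.rid ℂ _ ((counit ℓ hℓ).toLinearMap.lTensor _ (comul ℓ hℓ hodd x)) = x := by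
  have h : ((Algebra.TensorProduct.rid ℂ ℂ (Usigma ℓ)).toAlgHom.comp
      (Algebra.TensorProduct.map (AlgHom.id ℂ _) (counit ℓ hℓ))).comp (comul ℓ hℓ hodd) =
      AlgHom.id ℂ _ := by
    refine algHom_ext (fun i => ?_) (fun i => ?_) (fun i => ?_) (fun i => ?_) ?_ <;>
      simp [comul_e, comul_f, comul_k, comul_kinv, comul_σ, counit_e, counit_f, counit_k,
        counit_kinv, counit_σ]
  exact DFunLike.congr_fun h x

theorem rTensor_counit (x : Usigma ℓ) :
    TensorProduct.lid ℂ _ ((counit ℓ hℓ).toLinearMap.rTensor _ (comul ℓ hℓ hodd x)) = x := by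
  have h : ((Algebra.TensorProduct.lid ℂ (Usigma ℓ)).toAlgHom.comp
      (Algebra.TensorProduct.map (counit ℓ hℓ) (AlgHom.id ℂ _))).comp (comul ℓ hℓ hodd) =
      AlgHom.id ℂ _ := by
    refine algHom_ext (fun i => ?_) (fun i => ?_) (fun i => ?_) (fun i => ?_) ?_ <;>
      simp [comul_e, comul_f, comul_k, comul_kinv, comul_σ, counit_e, counit_f, counit_k,
        counit_kinv, counit_σ]
  exact DFunLike.congr_fun h x

theorem k_mul_kinv (i : Fin 2) : k ℓ i * kinv ℓ i = 1 := (realization ℓ).k_l i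
theorem kinv_mul_k (i : Fin 2) : kinv ℓ i * k ℓ i = 1 := (realization ℓ).l_k i

theorem σ_pow_mul_σ_pow (i : Fin 2) : σ ℓ ^ deg i * σ ℓ ^ deg i = 1 := by
  rw [← pow_add, ← two_mul, pow_mul, pow_two, σ_mul_σ, one_pow]

theorem mul_antipode_rTensor (x : Usigma ℓ) :
    LinearMap.mul' ℂ _ ((unopLinear (antipode ℓ)).rTensor _ (comul ℓ hℓ hodd x)) =
      algebraMap ℂ _ (counit ℓ hℓ x) := by
  -- The two sides are not algebra homomorphisms in x, so comparing them on generators is not enough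
  -- by itself. The elements on which they agree nevertheless form a subalgebra.
  let S : Subalgebra ℂ (Usigma ℓ) :=
    { carrier := {x | LinearMap.mul' ℂ _ ((unopLinear (antipode ℓ)).rTensor _
        (comul ℓ hℓ hodd x)) = algebraMap ℂ _ (counit ℓ hℓ x)}
      mul_mem' := fun {x y} hx hy => by
        rw [Set.mem_ofPred_eq] at hx hy ⊢
        rw [map_mul, mul'_rTensor_mul _ hx, hy, map_mul, map_mul, Algebra.smul_def]
      add_mem' := fun {x y} hx hy => by
        rw [Set.mem_ofPred_eq] at hx hy ⊢
        simp only [map_add, hx, hy]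
      algebraMap_mem' := fun c => by
        simp [Algebra.TensorProduct.algebraMap_apply, unopLinear_apply] }
  have h : S = ⊤ := by
    refine subalgebra_eq_top (fun i => ?_) (fun i => ?_) (fun i => ?_) (fun i => ?_) ?_ <;>
      change LinearMap.mul' ℂ _ ((unopLinear (antipode ℓ)).rTensor _
        (comul ℓ hℓ hodd _)) = algebraMap ℂ _ (counit ℓ hℓ _)
    · simp [comul_e, counit_e, antipode_e, antipode_mul, antipode_kinv, antipode_σ_pow, mul_assoc]
    · simp [comul_f, counit_f, antipode_f, antipode_σ_pow, mul_assoc, kinv_mul_k]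
    · simp [comul_k, counit_k, antipode_k, kinv_mul_k]
    · simp [comul_kinv, counit_kinv, antipode_kinv, k_mul_kinv]
    · simp [comul_σ, counit_σ, antipode_σ, σ_mul_σ]
  exact (h ▸ Algebra.mem_top : x ∈ S)

theorem mul_antipode_lTensor (x : Usigma ℓ) :
    LinearMap.mul' ℂ _ ((unopLinear (antipode ℓ)).lTensor _ (comul ℓ hℓ hodd x)) =
      algebraMap ℂ _ (counit ℓ hℓ x) := by
  let S : Subalgebra ℂ (Usigma ℓ) :=
    { carrier := {x | LinearMap.mul' ℂ _ ((unopLinear (antipode ℓ)).lTensor _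
        (comul ℓ hℓ hodd x)) = algebraMap ℂ _ (counit ℓ hℓ x)}
      mul_mem' := fun {x y} hx hy => by
        rw [Set.mem_ofPred_eq] at hx hy ⊢
        rw [map_mul, mul'_lTensor_mul _ hy, hx, map_mul, map_mul, Algebra.smul_def,
          Algebra.commutes]
      add_mem' := fun {x y} hx hy => by
        rw [Set.mem_ofPred_eq] at hx hy ⊢
        simp only [map_add, hx, hy]
      algebraMap_mem' := fun c => by
        simp [Algebra.TensorProduct.algebraMap_apply, antipode_one] }
  have h : S = ⊤ := by
    refine subalgebra_eq_top (fun i => ?_) (fun i => ?_) (fun i => ?_) (fun i => ?_) ?_ <;>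
      change LinearMap.mul' ℂ _ ((unopLinear (antipode ℓ)).lTensor _
        (comul ℓ hℓ hodd _)) = algebraMap ℂ _ (counit ℓ hℓ _)
    · have h₁ : kinv ℓ i * (σ ℓ ^ deg i * (σ ℓ ^ deg i * (k ℓ i * e ℓ i))) = e ℓ i := by
        rw [assoc_one_rule (σ_pow_mul_σ_pow ℓ i), assoc_one_rule (kinv_mul_k ℓ i)]
      simp [comul_e, counit_e, antipode_e, antipode_one, mul_assoc, h₁]
    · have h₁ : σ ℓ ^ deg i * (σ ℓ ^ deg i * (f ℓ i * kinv ℓ i)) = f ℓ i * kinv ℓ i :=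
        assoc_one_rule (σ_pow_mul_σ_pow ℓ i) _
      simp [comul_f, counit_f, antipode_f, antipode_k, h₁]
    · simp [comul_k, counit_k, antipode_k, k_mul_kinv]
    · simp [comul_kinv, counit_kinv, antipode_kinv, kinv_mul_k]
    · simp [comul_σ, counit_σ, antipode_σ, σ_mul_σ]
  exact (h ▸ Algebra.mem_top : x ∈ S)

/-- The Hopf algebra structure of `U^σ`. -/
def hopfStructure : HopfStructure (Usigma ℓ) where
  comul := comul ℓ hℓ hodd
  counit := counit ℓ hℓ
  antipode := unopLinear (antipode ℓ)
  coassoc := comul_coassoc ℓ hℓ hodd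
  lTensor_counit := lTensor_counit ℓ hℓ hodd
  rTensor_counit := rTensor_counit ℓ hℓ hodd
  mul_antipode_rTensor := mul_antipode_rTensor ℓ hℓ hodd
  mul_antipode_lTensor := mul_antipode_lTensor ℓ hℓ hodd

theorem isBosonizedHopf : IsBosonizedHopf ℓ (hopfStructure ℓ hℓ hodd) where
  comul_σ := comul_σ ℓ hℓ hodd
  comul_e := comul_e ℓ hℓ hodd
  comul_f := comul_f ℓ hℓ hodd
  comul_k := comul_k ℓ hℓ hodd
  counit_σ := counit_σ ℓ hℓ
  counit_e := counit_e ℓ hℓ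
  counit_f := counit_f ℓ hℓ
  counit_k := counit_k ℓ hℓ
  antipode_σ := antipode_σ ℓ
  antipode_e := antipode_e ℓ
  antipode_f := antipode_f ℓ
  antipode_k := antipode_k ℓ

end Usigma

end QuantumSL21

/-! ### Descent of the structure maps to the quotients U_α -/

namespace QuantumSL21

section Ualpha

variable {ℓ : ℕ} {B : Type*} [Ring B] [Algebra ℂ B]

theorem proj_surjective (ℓ : ℕ) (α : G) : Function.Surjective (proj ℓ α) :=
  RingQuot.mkAlgHom_surjective ℂ _

theorem proj_k_pow (ℓ : ℕ) (α : G) (i : Fin 2) :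
    proj ℓ α (Usigma.k ℓ i) ^ ℓ = algebraMap ℂ _ (xiPowEll ℓ (α i)) := by
  have := RingQuot.mkAlgHom_rel ℂ (RelAlpha.k_pow (ℓ := ℓ) (α := α) i)
  rwa [map_pow, AlgHom.commutes] at this

/-- The universal property of `U_α`. -/
def Ualpha.lift {α : G} (φ : Usigma ℓ →ₐ[ℂ] B)
    (h : ∀ i, φ (Usigma.k ℓ i) ^ ℓ = algebraMap ℂ B (xiPowEll ℓ (α i))) : Ualpha ℓ α →ₐ[ℂ] B :=
  RingQuot.liftAlgHom ℂ ⟨φ, fun x y hxy => by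
    obtain ⟨i⟩ := hxy
    rw [map_pow, h, AlgHom.commutes]⟩

theorem Ualpha.lift_proj {α : G} (φ : Usigma ℓ →ₐ[ℂ] B)
    (h : ∀ i, φ (Usigma.k ℓ i) ^ ℓ = algebraMap ℂ B (xiPowEll ℓ (α i))) (x : Usigma ℓ) :
    Ualpha.lift φ h (proj ℓ α x) = φ x :=
  RingQuot.liftAlgHom_mkAlgHom_apply ℂ _ _ x

end Ualpha

namespace Ualpha

variable (ℓ : ℕ) (hℓ : 3 ≤ ℓ) (hodd : Odd ℓ)

/-- The coproduct `Δ_{α,β}`. -/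
def comul {α β γ : G} (h : α + β = γ) : Ualpha ℓ γ →ₐ[ℂ] Ualpha ℓ α ⊗[ℂ] Ualpha ℓ β :=
  Ualpha.lift ((Algebra.TensorProduct.map (proj ℓ α) (proj ℓ β)).comp (Usigma.comul ℓ hℓ hodd))
    fun i => by
      subst h
      -- As k_i is group-like, its ℓ-th power maps to k_i^ℓ ⊗ k_i^ℓ = ξ^{ℓα_i} ξ^{ℓβ_i}, which is
      -- the scalar imposed in U_{α+β}.
      rw [AlgHom.comp_apply, Usigma.comul_k, Algebra.TensorProduct.map_tmul,
        Algebra.TensorProduct.tmul_pow, proj_k_pow, proj_k_pow, Pi.add_apply, xiPowEll_add,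
        Algebra.TensorProduct.algebraMap_apply, Algebra.algebraMap_eq_smul_one,
        Algebra.algebraMap_eq_smul_one, Algebra.algebraMap_eq_smul_one,
        TensorProduct.tmul_smul, TensorProduct.smul_tmul', smul_smul, mul_comm]

theorem comul_proj {α β γ : G} (h : α + β = γ) (x : Usigma ℓ) :
    comul ℓ hℓ hodd h (proj ℓ γ x) =
      Algebra.TensorProduct.map (proj ℓ α) (proj ℓ β) (Usigma.comul ℓ hℓ hodd x) :=
  Ualpha.lift_proj _ _ x

/-- The counit. -/
def counit : Ualpha ℓ 0 →ₐ[ℂ] ℂ :=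
  Ualpha.lift (Usigma.counit ℓ hℓ) fun i => by
    rw [Usigma.counit_k, one_pow, Pi.zero_apply, xiPowEll_zero, map_one]

theorem counit_proj (x : Usigma ℓ) : counit ℓ hℓ (proj ℓ 0 x) = Usigma.counit ℓ hℓ x :=
  Ualpha.lift_proj _ _ x

/-- In U_{-α} one has k_i^ℓ = ξ^{-ℓα_i}, so the inverse k_i⁻¹ = S(k_i) satisfies the relation of
U_α. This is why S sends U_α to U_{-α}. -/
theorem proj_kinv_pow (α β : G) (h : α + β = 0) (i : Fin 2) :
    proj ℓ β (Usigma.kinv ℓ i) ^ ℓ = algebraMap ℂ _ (xiPowEll ℓ (α i)) := by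
  have h₁ : proj ℓ β (Usigma.k ℓ i) ^ ℓ * proj ℓ β (Usigma.kinv ℓ i) ^ ℓ = 1 := by
    rw [← (show Commute (proj ℓ β (Usigma.k ℓ i)) (proj ℓ β (Usigma.kinv ℓ i)) from ?_).mul_pow,
      ← map_mul, Usigma.k_mul_kinv, map_one, one_pow]
    rw [commute_iff_eq, ← map_mul, ← map_mul, Usigma.k_mul_kinv, Usigma.kinv_mul_k]
  have h₂ : xiPowEll ℓ (α i) * xiPowEll ℓ (β i) = 1 := by
    rw [← xiPowEll_add, ← Pi.add_apply, h, Pi.zero_apply, xiPowEll_zero]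
  rw [proj_k_pow] at h₁
  calc _ = algebraMap ℂ (Ualpha ℓ β) (xiPowEll ℓ (α i) * xiPowEll ℓ (β i)) *
        proj ℓ β (Usigma.kinv ℓ i) ^ ℓ := by rw [h₂, map_one, one_mul]
    _ = _ := by rw [map_mul, mul_assoc, h₁, mul_one]

/-- The antipode `S_α`, as a homomorphism to the opposite algebra. -/
def antipode {α β : G} (h : α + β = 0) : Ualpha ℓ α →ₐ[ℂ] (Ualpha ℓ β)ᵐᵒᵖ :=
  Ualpha.lift ((AlgHom.op (proj ℓ β)).comp (Usigma.antipode ℓ)) fun i => by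
    have h₁ : Usigma.antipode ℓ (Usigma.k ℓ i) = MulOpposite.op (Usigma.kinv ℓ i) :=
      Realization.lift_k _ i
    rw [AlgHom.comp_apply, h₁]
    change MulOpposite.op (proj ℓ β (Usigma.kinv ℓ i)) ^ ℓ = _
    rw [← MulOpposite.op_pow, proj_kinv_pow ℓ α β h]
    rfl

theorem antipode_proj {α β : G} (h : α + β = 0) (x : Usigma ℓ) :
    unopLinear (antipode ℓ h) (proj ℓ α x) = proj ℓ β (unopLinear (Usigma.antipode ℓ) x) :=
  congrArg MulOpposite.unop (Ualpha.lift_proj _ _ x)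

/-- The Hopf `G`-coalgebra structure of `{U_α}`. -/
def hopfGroupCoalgebra : HopfGroupCoalgebra (Ualpha ℓ) where
  comul h := comul ℓ hℓ hodd h
  counit := counit ℓ hℓ
  antipode h := unopLinear (antipode ℓ h)
  coassoc {α β γ αβ βγ δ} h₁ h₂ h₃ h₄ x := by
    obtain ⟨x, rfl⟩ := proj_surjective ℓ δ x
    rw [comul_proj, comul_proj]
    -- Each side of the axiom is the corresponding side in U^σ followed by the projections. The
    -- other axioms are treated in the same way.
    have hl (z : Usigma ℓ ⊗[ℂ] Usigma ℓ) : TensorProduct.assoc ℂ _ _ _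
        ((comul ℓ hℓ hodd h₁).toLinearMap.rTensor _
          (Algebra.TensorProduct.map (proj ℓ αβ) (proj ℓ γ) z)) =
        TensorProduct.map (proj ℓ α).toLinearMap
          (TensorProduct.map (proj ℓ β).toLinearMap (proj ℓ γ).toLinearMap)
          (TensorProduct.assoc ℂ _ _ _ ((Usigma.comul ℓ hℓ hodd).toLinearMap.rTensor _ z)) := by
      induction z with
      | zero => simp
      | add a b ha hb => simp only [map_add, ha, hb]
      | tmul a b =>
        simp only [Algebra.TensorProduct.map_tmul, LinearMap.rTensor_tmul,
          AlgHom.toLinearMap_apply, comul_proj]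
        generalize Usigma.comul ℓ hℓ hodd a = w
        induction w with
        | zero => simp
        | add a b ha hb => simp only [map_add, TensorProduct.add_tmul, ha, hb]
        | tmul a b => simp
    have hr (z : Usigma ℓ ⊗[ℂ] Usigma ℓ) : (comul ℓ hℓ hodd h₃).toLinearMap.lTensor _
          (Algebra.TensorProduct.map (proj ℓ α) (proj ℓ βγ) z) =
        TensorProduct.map (proj ℓ α).toLinearMap
          (TensorProduct.map (proj ℓ β).toLinearMap (proj ℓ γ).toLinearMap)
          ((Usigma.comul ℓ hℓ hodd).toLinearMap.lTensor _ z) := by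
      induction z with
      | zero => simp
      | add a b ha hb => simp only [map_add, ha, hb]
      | tmul a b =>
        simp only [Algebra.TensorProduct.map_tmul, LinearMap.lTensor_tmul,
          AlgHom.toLinearMap_apply, comul_proj, TensorProduct.map_tmul]
        rfl
    rw [hl, hr, Usigma.comul_coassoc]
  lTensor_counit {α} x := by
    obtain ⟨x, rfl⟩ := proj_surjective ℓ α x
    rw [comul_proj]
    have h (z : Usigma ℓ ⊗[ℂ] Usigma ℓ) : TensorProduct.rid ℂ _
        ((counit ℓ hℓ).toLinearMap.lTensor _
          (Algebra.TensorProduct.map (proj ℓ α) (proj ℓ 0) z)) =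
        proj ℓ α (TensorProduct.rid ℂ _ ((Usigma.counit ℓ hℓ).toLinearMap.lTensor _ z)) := by
      induction z with
      | zero => simp
      | add a b ha hb => simp only [map_add, ha, hb]
      | tmul a b => simp [counit_proj]
    rw [h, Usigma.lTensor_counit]
  rTensor_counit {α} x := by
    obtain ⟨x, rfl⟩ := proj_surjective ℓ α x
    rw [comul_proj]
    have h (z : Usigma ℓ ⊗[ℂ] Usigma ℓ) : TensorProduct.lid ℂ _
        ((counit ℓ hℓ).toLinearMap.rTensor _
          (Algebra.TensorProduct.map (proj ℓ 0) (proj ℓ α) z)) =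
        proj ℓ α (TensorProduct.lid ℂ _ ((Usigma.counit ℓ hℓ).toLinearMap.rTensor _ z)) := by
      induction z with
      | zero => simp
      | add a b ha hb => simp only [map_add, ha, hb]
      | tmul a b => simp [counit_proj]
    rw [h, Usigma.rTensor_counit]
  mul_antipode_rTensor {α β} h x := by
    obtain ⟨x, rfl⟩ := proj_surjective ℓ 0 x
    rw [comul_proj, counit_proj]
    have h (z : Usigma ℓ ⊗[ℂ] Usigma ℓ) : LinearMap.mul' ℂ _
        ((unopLinear (antipode ℓ h)).rTensor _
          (Algebra.TensorProduct.map (proj ℓ β) (proj ℓ α) z)) =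
        proj ℓ α (LinearMap.mul' ℂ _ ((unopLinear (Usigma.antipode ℓ)).rTensor _ z)) := by
      induction z with
      | zero => simp
      | add a b ha hb => simp only [map_add, ha, hb]
      | tmul a b => simp [antipode_proj]
    rw [h, Usigma.mul_antipode_rTensor, AlgHom.commutes]
  mul_antipode_lTensor {α β} h h' x := by
    obtain ⟨x, rfl⟩ := proj_surjective ℓ 0 x
    rw [comul_proj, counit_proj]
    have h (z : Usigma ℓ ⊗[ℂ] Usigma ℓ) : LinearMap.mul' ℂ _
        ((unopLinear (antipode ℓ h')).lTensor _
          (Algebra.TensorProduct.map (proj ℓ α) (proj ℓ β) z)) =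
        proj ℓ α (LinearMap.mul' ℂ _ ((unopLinear (Usigma.antipode ℓ)).lTensor _ z)) := by
      induction z with
      | zero => simp
      | add a b ha hb => simp only [map_add, ha, hb]
      | tmul a b => simp [antipode_proj]
    rw [h, Usigma.mul_antipode_lTensor, AlgHom.commutes]

theorem isInduced : IsInduced (Usigma.hopfStructure ℓ hℓ hodd) (hopfGroupCoalgebra ℓ hℓ hodd) where
  comul_proj _ _ x := comul_proj ℓ hℓ hodd rfl x
  counit_proj x := counit_proj ℓ hℓ x
  antipode_proj α x := antipode_proj ℓ (add_neg_cancel α) x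

end Ualpha

end QuantumSL21

/-! ### Kac modules: induction from the even part -/

namespace QuantumSL21

/-- Elements of an algebra that satisfy the relations of the subalgebra of `U` generated by `e₁`,
`f₁` and the `k_i`. -/
structure EvenRealization (q : ℂ) (ℓ : ℕ) (A : Type*) [Ring A] [Algebra ℂ A] where
  /-- The image of `e₁`. -/
  e : A
  /-- The image of `f₁`. -/
  f : A
  /-- The image of `k_i`. -/
  k : Fin 2 → A
  /-- The image of `k_i⁻¹`. -/
  l : Fin 2 → A
  k_comm : k 0 * k 1 = k 1 * k 0
  k_l (i : Fin 2) : k i * l i = 1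
  l_k (i : Fin 2) : l i * k i = 1
  k_e (i : Fin 2) : k i * e = (q ^ cartan i 0) • (e * k i)
  k_f (i : Fin 2) : k i * f = (q ^ (-cartan i 0)) • (f * k i)
  e_f : e * f = f * e + (q - q⁻¹)⁻¹ • (k 0 - l 0)
  e_pow : e ^ ℓ = 0
  f_pow : f ^ ℓ = 0

namespace EvenRealization

variable {q : ℂ} {ℓ : ℕ} {A : Type*} [Ring A] [Algebra ℂ A] (E : EvenRealization q ℓ A)

theorem l_e (hq : q ≠ 0) (i : Fin 2) : E.l i * E.e = (q ^ (-cartan i 0)) • (E.e * E.l i) :=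
  qcomm_inv (by rw [← zpow_add₀ hq, add_neg_cancel, zpow_zero]) (E.k_l i) (E.l_k i) (E.k_e i)

theorem l_f (hq : q ≠ 0) (i : Fin 2) : E.l i * E.f = (q ^ cartan i 0) • (E.f * E.l i) :=
  qcomm_inv (by rw [← zpow_add₀ hq, neg_add_cancel, zpow_zero]) (E.k_l i) (E.l_k i) (E.k_f i)

theorem l_k_comm : E.l 1 * E.k 0 = E.k 0 * E.l 1 := by
  have := qcomm_inv (c := 1) (d := 1) (one_mul 1) (E.k_l 1) (E.l_k 1)
    (x := E.k 0) (by rw [one_smul, E.k_comm])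
  rwa [one_smul] at this

/-- The action of `e₁` and `e₂` on the module induced from the subalgebra generated by the `e_i`,
`f₁` and the `k_i`, in the basis `1, f₂, f₃, f₂ f₃`, where `f₃ = f₁ f₂ - q⁻¹ f₂ f₁`. -/
def kacE : Fin 2 → Matrix (Fin 4) (Fin 4) A :=
  -- Column j is the image of the j-th basis vector, with coefficients in A written to the right of
  -- 1, f₂, f₃, f₂f₃. The entries come from e₁f₃ = f₃e₁ + f₂k₁, and from e₂f₂ + f₂e₂ = (k₂ -
  -- k₂⁻¹)/(q - q⁻¹) and e₂f₃ + f₃e₂ = -q⁻¹ f₁k₂⁻¹, where e₂ kills the inducing module.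
  ![!![E.e, 0, 0, 0; 0, E.e, E.k 0, 0; 0, 0, E.e, 0; 0, 0, 0, E.e],
    !![0, (q - q⁻¹)⁻¹ • (E.k 1 - E.l 1), -(q⁻¹ • (E.f * E.l 1)), 0;
      0, 0, 0, q⁻¹ • (E.f * E.l 1);
      0, 0, 0, (q - q⁻¹)⁻¹ • (q • E.k 1 - q⁻¹ • E.l 1);
      0, 0, 0, 0]]

/-- The action of `f₁` and `f₂` on the induced module. -/
def kacF : Fin 2 → Matrix (Fin 4) (Fin 4) A :=
  ![!![E.f, 0, 0, 0; 0, q⁻¹ • E.f, 0, 0; 0, 1, q • E.f, 0; 0, 0, 0, E.f],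
    !![0, 0, 0, 0; 1, 0, 0, 0; 0, 0, 0, 0; 0, 0, 1, 0]]

/-- The action of `k₁` and `k₂` on the induced module. -/
def kacK : Fin 2 → Matrix (Fin 4) (Fin 4) A :=
  ![Matrix.diagonal ![E.k 0, q • E.k 0, q⁻¹ • E.k 0, E.k 0],
    Matrix.diagonal ![E.k 1, E.k 1, q • E.k 1, q • E.k 1]]

/-- The action of `k₁⁻¹` and `k₂⁻¹` on the induced module. -/
def kacL : Fin 2 → Matrix (Fin 4) (Fin 4) A :=
  ![Matrix.diagonal ![E.l 0, q⁻¹ • E.l 0, q • E.l 0, E.l 0],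
    Matrix.diagonal ![E.l 1, E.l 1, q⁻¹ • E.l 1, q⁻¹ • E.l 1]]

/-- The action of `σ` on the induced module. -/
def kacS (A : Type*) [Ring A] [Algebra ℂ A] (ε : ℂ) : Matrix (Fin 4) (Fin 4) A :=
  -- The signs are the parities of 1, f₂, f₃, f₂f₃.
  Matrix.diagonal fun i => algebraMap ℂ A (![ε, -ε, -ε, ε] i)

theorem kacK_kacL (hq : q ≠ 0) (i : Fin 2) : E.kacK i * E.kacL i = 1 := by
  fin_cases i <;> simp [kacK, kacL, ← Matrix.diagonal_one] <;> intro j <;> fin_cases j <;>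
    simp [E.k_l, hq]

theorem kacL_kacK (hq : q ≠ 0) (i : Fin 2) : E.kacL i * E.kacK i = 1 := by
  fin_cases i <;> simp [kacK, kacL, ← Matrix.diagonal_one] <;> intro j <;> fin_cases j <;>
    simp [E.l_k, hq]

theorem kacK_kacE (hq : q ≠ 0) (i j : Fin 2) :
    E.kacK i * E.kacE j = (q ^ cartan i j) • (E.kacE j * E.kacK i) := by
  have h₀ := E.k_e 0
  have h₁ := E.k_e 1
  have h₂ := assoc_rule (E.k_f 0)
  have h₃ := assoc_rule (E.k_f 1)
  have h₄ : E.k 0 * E.l 1 = E.l 1 * E.k 0 := E.l_k_comm.symm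
  have h₅ : E.k 1 * E.l 1 = E.l 1 * E.k 1 := by rw [E.k_l, E.l_k]
  have h₆ := E.k_comm
  simp only [cartan, Matrix.of_apply, Matrix.cons_val_zero, Matrix.cons_val_one,
    Matrix.cons_val_fin_one, zpow_neg] at h₀ h₁ h₂ h₃
  fin_cases i <;> fin_cases j <;> ext a b <;> fin_cases a <;> fin_cases b <;>
    simp [kacK, kacE, Matrix.diagonal_mul, Matrix.vecMul_diagonal, cartan, mul_assoc, h₀, h₁, h₂, h₃,
      h₄, h₅, h₆, mul_sub, sub_mul]
  all_goals match_scalars <;> (try field_simp)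

theorem kacK_kacF (hq : q ≠ 0) (i j : Fin 2) :
    E.kacK i * E.kacF j = (q ^ (-cartan i j)) • (E.kacF j * E.kacK i) := by
  have h₂ := E.k_f 0
  have h₃ := E.k_f 1
  simp only [cartan, Matrix.of_apply, Matrix.cons_val_zero, Matrix.cons_val_one,
    Matrix.cons_val_fin_one, zpow_neg] at h₂ h₃
  fin_cases i <;> fin_cases j <;> ext a b <;> fin_cases a <;> fin_cases b <;>
    simp [kacK, kacF, Matrix.diagonal_mul, Matrix.vecMul_diagonal, cartan, h₂, h₃]
  all_goals (match_scalars; (try field_simp))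

theorem kacE_kacF_even (hq : q ≠ 0) (hq' : q ^ 2 - 1 ≠ 0) : E.kacE 0 * E.kacF 0 =
    E.kacF 0 * E.kacE 0 + (q - q⁻¹)⁻¹ • (E.kacK 0 - E.kacL 0) := by
  have h := E.k_f 0
  simp only [cartan, Matrix.of_apply, Matrix.cons_val_zero, zpow_neg] at h
  ext a b
  fin_cases a <;> fin_cases b <;>
    simp [kacK, kacF, kacE, kacL, Matrix.diagonal, Matrix.mul_apply, Fin.sum_univ_four, E.e_f, h]
  all_goals match_scalars <;> (try field_simp) <;> (try ring)

theorem kacE_kacF_odd : E.kacE 1 * E.kacF 1 =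
    -(E.kacF 1 * E.kacE 1) + (q - q⁻¹)⁻¹ • (E.kacK 1 - E.kacL 1) := by
  ext a b
  fin_cases a <;> fin_cases b <;>
    simp [kacK, kacF, kacE, kacL, Matrix.diagonal, Matrix.mul_apply, Fin.sum_univ_four]

theorem kacE_kacF_01 : E.kacE 0 * E.kacF 1 = E.kacF 1 * E.kacE 0 := by
  ext a b
  fin_cases a <;> fin_cases b <;>
    simp [kacF, kacE, Matrix.mul_apply, Fin.sum_univ_four]

theorem kacE_kacF_10 (hq : q ≠ 0) (hq' : q ^ 2 - 1 ≠ 0) :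
    E.kacE 1 * E.kacF 0 = E.kacF 0 * E.kacE 1 := by
  have h₁ := E.k_f 1
  have h₂ := E.l_f hq 1
  simp only [cartan, Matrix.of_apply, Matrix.cons_val_zero, Matrix.cons_val_one,
    Matrix.cons_val_fin_one, zpow_neg] at h₁ h₂
  ext a b
  fin_cases a <;> fin_cases b <;>
    simp [kacF, kacE, Matrix.mul_apply, Fin.sum_univ_four, h₁, h₂, mul_sub, sub_mul, mul_assoc]
  all_goals match_scalars <;> (try field_simp) <;> (try ring)

theorem kacE_sq (hq : q ≠ 0) (hq' : q ^ 2 - 1 ≠ 0) : E.kacE 1 * E.kacE 1 = 0 := by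
  have h₁ := E.k_f 1
  have h₂ := E.l_f hq 1
  simp only [cartan, Matrix.of_apply, Matrix.cons_val_zero, Matrix.cons_val_one,
    Matrix.cons_val_fin_one, zpow_neg] at h₁ h₂
  ext a b
  fin_cases a <;> fin_cases b <;>
    simp [kacE, Matrix.mul_apply, Fin.sum_univ_four, assoc_rule h₁, assoc_rule h₂, mul_sub,
      sub_mul, mul_assoc, E.k_l, E.l_k]
  all_goals match_scalars <;> (try field_simp) <;> (try ring)

theorem kacF_sq : E.kacF 1 * E.kacF 1 = 0 := by
  ext a b
  fin_cases a <;> fin_cases b <;> simp [kacF, Matrix.mul_apply, Fin.sum_univ_four]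

theorem serre_kacF (hq : q ≠ 0) : IsSerre q (E.kacF 0) (E.kacF 1) := by
  unfold IsSerre
  ext a b
  fin_cases a <;> fin_cases b <;> simp [kacF, Matrix.mul_apply, Fin.sum_univ_four]
  all_goals (match_scalars; (try field_simp); (try ring))

/-- The matrix is D + N with D = e₁ · 1 and N the off-diagonal entry k₁. They q-commute with
parameter q^{-2}, so the ℓ-th power is N^ℓ + D^ℓ; here D^ℓ = 0, and N² = 0 suffices because ℓ ≥ 2.
The argument for `kacF_pow` is the same. -/
theorem kacE_pow (hq : q ≠ 0) (hζ : IsPrimitiveRoot (q ^ 2)⁻¹ ℓ) (hℓ : 1 < ℓ) :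
    E.kacE 0 ^ ℓ = 0 := by
  set N : Matrix (Fin 4) (Fin 4) A := Matrix.single 1 2 (E.k 0)
  set D : Matrix (Fin 4) (Fin 4) A := Matrix.diagonal fun _ => E.e
  have hN : N ^ 2 = 0 := by rw [pow_two]; exact Matrix.single_mul_single_of_ne _ _ _ _ (by decide) _
  have hD : D ^ ℓ = 0 := by
    rw [Matrix.diagonal_pow]
    ext i j
    simp [Matrix.diagonal_apply, E.e_pow]
  have hND : D * N = (q ^ 2)⁻¹ • (N * D) := by
    have := E.k_e 0
    simp [cartan] at this
    ext i j
    simp [D, N, Matrix.diagonal_mul, Matrix.mul_diagonal, Matrix.single_apply]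
    split_ifs <;> simp [this, smul_smul, hq]
  have h : E.kacE 0 = N + D := by
    ext a b
    fin_cases a <;> fin_cases b <;> simp [kacE, N, D]
  rw [h, add_pow_of_qcomm_primitiveRoot hζ (by omega) hND, hD, add_zero]
  exact pow_eq_zero_of_le hℓ hN

theorem kacF_pow (hq : q ≠ 0) (hζ : IsPrimitiveRoot (q ^ 2)⁻¹ ℓ) (hℓ : 1 < ℓ) :
    E.kacF 0 ^ ℓ = 0 := by
  set N : Matrix (Fin 4) (Fin 4) A := Matrix.single 2 1 1
  set D : Matrix (Fin 4) (Fin 4) A := Matrix.diagonal fun i => (![1, q⁻¹, q, 1] i) • E.f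
  have hN : N ^ 2 = 0 := by rw [pow_two]; exact Matrix.single_mul_single_of_ne _ _ _ _ (by decide) _
  have hD : D ^ ℓ = 0 := by
    rw [Matrix.diagonal_pow]
    ext i j
    simp [Matrix.diagonal_apply, smul_pow, E.f_pow]
  have hND : N * D = (q ^ 2)⁻¹ • (D * N) := by
    ext i j
    simp [D, N, Matrix.diagonal_mul, Matrix.mul_diagonal, Matrix.single_apply]
    split_ifs with h
    · obtain ⟨rfl, rfl⟩ := h
      simp [smul_smul, pow_two, hq]
    · simp
  have h : E.kacF 0 = D + N := by
    ext a b
    fin_cases a <;> fin_cases b <;> simp [kacF, N, D]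
  rw [h, add_pow_of_qcomm_primitiveRoot hζ (by omega) hND, hD, zero_add]
  exact pow_eq_zero_of_le hℓ hN

end EvenRealization

end QuantumSL21

namespace QuantumSL21

namespace EvenRealization

variable {q : ℂ} {ℓ : ℕ} {A : Type*} [Ring A] [Algebra ℂ A] (E : EvenRealization q ℓ A)

theorem serre_kacE (hq : q ≠ 0) (hq' : q ^ 2 - 1 ≠ 0) : IsSerre q (E.kacE 0) (E.kacE 1) := by
  have h₁ : E.k 0 * E.f = (q ^ 2)⁻¹ • (E.f * E.k 0) := by simpa [cartan] using E.k_f 0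
  have h₂ : E.k 0 * E.e = (q ^ 2) • (E.e * E.k 0) := by simpa [cartan] using E.k_e 0
  have h₃ : E.k 1 * E.e = q⁻¹ • (E.e * E.k 1) := by simpa [cartan] using E.k_e 1
  have h₄ : E.l 1 * E.e = q • (E.e * E.l 1) := by simpa [cartan] using E.l_e hq 1
  have h₅ : E.k 1 * E.k 0 = E.k 0 * E.k 1 := E.k_comm.symm
  have h₆ := E.l_k_comm
  have h₇ := assoc_comm_rule h₆
  have h₈ (x : A) : E.e * (E.f * x) = E.f * (E.e * x) +
      (q - q⁻¹)⁻¹ • (E.k 0 * x - E.l 0 * x) := by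
    rw [← mul_assoc, E.e_f, add_mul, smul_mul_assoc, sub_mul, mul_assoc]
  have h₉ := assoc_rule h₄
  have h₁₀ := assoc_rule h₃
  have h₁₁ := assoc_rule h₂
  have h₁₂ := assoc_rule h₁
  have h₁₃ : E.l 0 * E.e = (q ^ 2)⁻¹ • (E.e * E.l 0) := by simpa [cartan] using E.l_e hq 0
  have h₁₄ := assoc_rule h₁₃
  have h₁₅ (i : Fin 2) := assoc_one_rule (E.k_l i)
  have h₁₆ (i : Fin 2) := assoc_one_rule (E.l_k i)
  -- What remains is an identity in A for each matrix entry; the rules above bring both sides to the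
  -- order f, e, torus.
  unfold IsSerre
  ext a b
  fin_cases a <;> fin_cases b <;>
    simp [kacE, Matrix.mul_apply, Fin.sum_univ_four, mul_assoc, mul_add, mul_sub, sub_mul,
      h₂, h₃, h₄, h₅, h₆, h₈, h₉, h₁₀, h₁₁, h₁₄]
  all_goals match_scalars <;> (try field_simp) <;> (try ring)

theorem kacS_sq {ε : ℂ} (hε : ε * ε = 1) : kacS A ε * kacS A ε = 1 := by
  rw [kacS, Matrix.diagonal_mul_diagonal, ← Matrix.diagonal_one]
  congr 1
  funext i
  fin_cases i <;> simp [← map_mul, hε]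

theorem kacS_kacE (ε : ℂ) (i : Fin 2) :
    kacS A ε * E.kacE i = ((-1 : ℂ) ^ deg i) • (E.kacE i * kacS A ε) := by
  fin_cases i <;> ext a b <;> fin_cases a <;> fin_cases b <;>
    simp [kacS, kacE, Matrix.diagonal_mul, Matrix.vecMul_diagonal, deg,
      ← Algebra.smul_def, Algebra.algebraMap_eq_smul_one]
  all_goals rw [smul_comm]

theorem kacS_kacF (ε : ℂ) (i : Fin 2) :
    kacS A ε * E.kacF i = ((-1 : ℂ) ^ deg i) • (E.kacF i * kacS A ε) := by
  fin_cases i <;> ext a b <;> fin_cases a <;> fin_cases b <;>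
    simp [kacS, kacF, Matrix.diagonal_mul, Matrix.vecMul_diagonal, deg,
      ← Algebra.smul_def, Algebra.algebraMap_eq_smul_one]
  all_goals rw [smul_comm]

theorem kacK_comm : E.kacK 0 * E.kacK 1 = E.kacK 1 * E.kacK 0 := by
  simp only [kacK, Matrix.cons_val_zero, Matrix.cons_val_one, Matrix.cons_val_fin_one,
    Matrix.diagonal_mul_diagonal]
  congr 1
  funext i
  fin_cases i <;> simp [E.k_comm, smul_smul, mul_comm]

theorem kacS_kacK (ε : ℂ) (i : Fin 2) : kacS A ε * E.kacK i = E.kacK i * kacS A ε := by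
  fin_cases i <;>
  · simp only [kacS, kacK]
    simp only [Fin.zero_eta, Fin.mk_one, Matrix.cons_val_zero, Matrix.cons_val_one,
      Matrix.cons_val_fin_one, Matrix.diagonal_mul_diagonal, Algebra.commutes]

/-- The realization on the module induced from a realization of the even part, on which `e₂`
acts by zero and `σ` by the sign `ε`. -/
def kac (hq : q ≠ 0) (hq' : q ^ 2 - 1 ≠ 0) (hζ : IsPrimitiveRoot (q ^ 2)⁻¹ ℓ) (hℓ : 1 < ℓ)
    {ε : ℂ} (hε : ε * ε = 1) : Realization q ℓ (Matrix (Fin 4) (Fin 4) A) where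
  e := E.kacE
  f := E.kacF
  k := E.kacK
  l := E.kacL
  s := kacS A ε
  k_comm := E.kacK_comm
  k_l := E.kacK_kacL hq
  l_k := E.kacL_kacK hq
  k_e := E.kacK_kacE hq
  k_f := E.kacK_kacF hq
  e_f_even := E.kacE_kacF_even hq hq'
  e_f_odd := E.kacE_kacF_odd
  e_f_01 := E.kacE_kacF_01
  e_f_10 := E.kacE_kacF_10 hq hq'
  e_sq := E.kacE_sq hq hq'
  f_sq := E.kacF_sq
  serre_e := E.serre_kacE hq hq'
  serre_f := E.serre_kacF hq
  e_pow := E.kacE_pow hq hζ hℓ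
  f_pow := E.kacF_pow hq hζ hℓ
  s_s := kacS_sq hε
  s_e := E.kacS_kacE ε
  s_f := E.kacS_kacF ε
  s_k := E.kacS_kacK ε

end EvenRealization

end QuantumSL21

/-! ### The ℓ-dimensional Verma module of the even part -/

namespace QuantumSL21

section EvenVerma

variable (q : ℂ) (ℓ : ℕ) (ν : Fin 2 → ℂ)

/-- The value of a function on `Fin ℓ` at a natural number, zero outside the range. -/
def extendZero {ℓ : ℕ} (u : Fin ℓ → ℂ) (n : ℕ) : ℂ := if h : n < ℓ then u ⟨n, h⟩ else 0

/-- The scalar by which `e₁` maps the `n`-th basis vector of the Verma module to the previous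
one. -/
def vermaCoeff (n : ℕ) : ℂ :=
  -- With ν 0 = q^λ this is the usual product of quantum integers [n][λ - n + 1].
  (q - q⁻¹)⁻¹ * (q - q⁻¹)⁻¹ * (q ^ n - (q ^ n)⁻¹) * (ν 0 * q * (q ^ n)⁻¹ - (ν 0)⁻¹ * q⁻¹ * q ^ n)

/-- The weights of `k_i` on the basis of the Verma module. -/
def vermaWeight (i : Fin 2) (n : ℕ) : ℂ := ν i * (![(q ^ 2)⁻¹, q] i) ^ n

/-- The operator `e₁` on the Verma module. -/
def vermaE : Module.End ℂ (Fin ℓ → ℂ) where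
  toFun u n := vermaCoeff q ν (n + 1) * extendZero u (n + 1)
  map_add' u v := by
    funext n
    simp only [extendZero, Pi.add_apply]
    split_ifs <;> ring
  map_smul' c u := by
    funext n
    simp only [extendZero, Pi.smul_apply, smul_eq_mul, RingHom.id_apply]
    split_ifs <;> ring

/-- The operator `f₁` on the Verma module. -/
def vermaF : Module.End ℂ (Fin ℓ → ℂ) where
  toFun u n := if (n : ℕ) = 0 then 0 else extendZero u (n - 1)
  map_add' u v := by
    funext n
    simp only [extendZero, Pi.add_apply]
    split_ifs <;> ring
  map_smul' c u := by
    funext n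
    simp only [extendZero, Pi.smul_apply, smul_eq_mul, RingHom.id_apply]
    split_ifs <;> ring

/-- A diagonal operator on functions on `Fin ℓ`. -/
def diagOp (d : ℕ → ℂ) : Module.End ℂ (Fin ℓ → ℂ) where
  toFun u n := d n * u n
  map_add' u v := by
    funext n
    simp only [Pi.add_apply]
    ring
  map_smul' c u := by
    funext n
    simp only [Pi.smul_apply, smul_eq_mul, RingHom.id_apply]
    ring

variable {q ℓ ν}

theorem extendZero_of_lt {u : Fin ℓ → ℂ} {n : ℕ} (h : n < ℓ) : extendZero u n = u ⟨n, h⟩ :=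
  dif_pos h

theorem extendZero_of_le {u : Fin ℓ → ℂ} {n : ℕ} (h : ℓ ≤ n) : extendZero u n = 0 :=
  dif_neg (by omega)

theorem vermaE_apply (u : Fin ℓ → ℂ) (n : Fin ℓ) :
    vermaE q ℓ ν u n = vermaCoeff q ν (n + 1) * extendZero u (n + 1) := rfl

theorem vermaF_apply (u : Fin ℓ → ℂ) (n : Fin ℓ) :
    vermaF ℓ u n = if (n : ℕ) = 0 then 0 else extendZero u (n - 1) := rfl

theorem diagOp_apply (d : ℕ → ℂ) (u : Fin ℓ → ℂ) (n : Fin ℓ) : diagOp ℓ d u n = d n * u n := rfl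

theorem diagOp_mul (c d : ℕ → ℂ) : diagOp ℓ c * diagOp ℓ d = diagOp ℓ fun n => c n * d n := by
  refine LinearMap.ext fun u => funext fun n => ?_
  rw [Module.End.mul_apply, diagOp_apply, diagOp_apply, diagOp_apply, mul_assoc]

theorem diagOp_one : diagOp ℓ (fun _ => 1) = 1 := by
  refine LinearMap.ext fun u => funext fun n => ?_
  rw [diagOp_apply, one_mul, Module.End.one_apply]

theorem vermaE_pow : vermaE q ℓ ν ^ ℓ = 0 := by
  have key (m : ℕ) (u : Fin ℓ → ℂ) (n : Fin ℓ) (h : ℓ ≤ n + m) : (vermaE q ℓ ν ^ m) u n = 0 := by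
    induction m generalizing n with
    | zero => omega
    | succ m ih =>
      rw [pow_succ', Module.End.mul_apply, vermaE_apply]
      rcases lt_or_ge ((n : ℕ) + 1) ℓ with h' | h'
      · rw [extendZero_of_lt h', ih ⟨n + 1, h'⟩ (by simp; omega), mul_zero]
      · rw [extendZero_of_le h', mul_zero]
  refine LinearMap.ext fun u => funext fun n => key ℓ u n (by omega)

theorem vermaF_pow : vermaF ℓ ^ ℓ = 0 := by
  have key (m : ℕ) (u : Fin ℓ → ℂ) (n : Fin ℓ) (h : (n : ℕ) < m) : (vermaF ℓ ^ m) u n = 0 := by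
    induction m generalizing n with
    | zero => omega
    | succ m ih =>
      rw [pow_succ', Module.End.mul_apply, vermaF_apply]
      split_ifs with h'
      · rfl
      · rw [extendZero_of_lt (by omega), ih ⟨n - 1, by omega⟩ (by simp; omega)]
  refine LinearMap.ext fun u => funext fun n => key ℓ u n (by omega)

theorem diagOp_vermaE {c : ℂ} {d : ℕ → ℂ} (h : ∀ n, d n = c * d (n + 1)) :
    diagOp ℓ d * vermaE q ℓ ν = c • (vermaE q ℓ ν * diagOp ℓ d) := by
  refine LinearMap.ext fun u => funext fun n => ?_
  simp only [Module.End.mul_apply, LinearMap.smul_apply, Pi.smul_apply, diagOp_apply,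
    vermaE_apply, smul_eq_mul]
  rcases lt_or_ge ((n : ℕ) + 1) ℓ with h' | h'
  · rw [extendZero_of_lt h', extendZero_of_lt h', diagOp_apply, h]
    ring
  · rw [extendZero_of_le h', extendZero_of_le h']
    ring

theorem diagOp_vermaF {c : ℂ} {d : ℕ → ℂ} (h : ∀ n, d (n + 1) = c * d n) :
    diagOp ℓ d * vermaF ℓ = c • (vermaF ℓ * diagOp ℓ d) := by
  refine LinearMap.ext fun u => funext fun n => ?_
  simp only [Module.End.mul_apply, LinearMap.smul_apply, Pi.smul_apply, diagOp_apply,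
    vermaF_apply, smul_eq_mul]
  split_ifs with h'
  · ring
  · obtain ⟨m, hm⟩ : ∃ m, (n : ℕ) = m + 1 := ⟨n - 1, by omega⟩
    rw [hm, Nat.add_sub_cancel, extendZero_of_lt (by omega), extendZero_of_lt (by omega),
      diagOp_apply, h]
    ring

/-- This is the relation [e₁, f₁] = (k₁ - k₁⁻¹)/(q - q⁻¹) evaluated on the n-th basis vector, on
which e₁f₁ and f₁e₁ act by consecutive coefficients. -/
theorem vermaCoeff_succ (hq : q ≠ 0) (hq' : q ^ 2 - 1 ≠ 0) (hν : ν 0 ≠ 0) (n : ℕ) :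
    vermaCoeff q ν (n + 1) = vermaCoeff q ν n +
      (q - q⁻¹)⁻¹ * (vermaWeight q ν 0 n - (vermaWeight q ν 0 n)⁻¹) := by
  have hn := pow_ne_zero n hq
  have h : (q ^ 2) ^ n = (q ^ n) ^ 2 := by rw [← pow_mul, ← pow_mul, mul_comm]
  simp only [vermaCoeff, vermaWeight, Matrix.cons_val_zero, inv_pow, h, pow_succ q n]
  generalize q ^ n = x at *
  field_simp
  ring

theorem vermaE_vermaF (hq : q ≠ 0) (hq' : q ^ 2 - 1 ≠ 0) (hν : ν 0 ≠ 0) (hqℓ : q ^ ℓ = 1) :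
    vermaE q ℓ ν * vermaF ℓ = vermaF ℓ * vermaE q ℓ ν +
      (q - q⁻¹)⁻¹ • (diagOp ℓ (vermaWeight q ν 0) - diagOp ℓ fun n => (vermaWeight q ν 0 n)⁻¹) := by
  have h0 : vermaCoeff q ν 0 = 0 := by simp [vermaCoeff]
  -- Here q^ℓ = 1 enters. On the last basis vector f₁ is zero, so e₁f₁ vanishes there, and the
  -- coefficient with index ℓ has to vanish too. At the other end `h0` plays the same role for f₁e₁.
  have hl : vermaCoeff q ν ℓ = 0 := by simp [vermaCoeff, hqℓ]
  refine LinearMap.ext fun u => funext fun n => ?_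
  simp only [Module.End.mul_apply, LinearMap.add_apply, LinearMap.smul_apply, LinearMap.sub_apply,
    Pi.add_apply, Pi.smul_apply, Pi.sub_apply, diagOp_apply, vermaE_apply, vermaF_apply,
    smul_eq_mul]
  have h₁ : vermaCoeff q ν (n + 1) * extendZero (vermaF ℓ u) (n + 1) =
      vermaCoeff q ν (n + 1) * u n := by
    rcases lt_or_ge ((n : ℕ) + 1) ℓ with h' | h'
    · rw [extendZero_of_lt h', vermaF_apply, if_neg (Nat.succ_ne_zero _), Nat.add_sub_cancel,
        extendZero_of_lt n.2]
    · rw [show (n : ℕ) + 1 = ℓ by omega, hl, zero_mul, zero_mul]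
  have h₂ : (if (n : ℕ) = 0 then 0 else extendZero (vermaE q ℓ ν u) (n - 1)) =
      vermaCoeff q ν n * u n := by
    split_ifs with h'
    · rw [h', h0, zero_mul]
    · rw [extendZero_of_lt (by omega), vermaE_apply, Nat.sub_add_cancel (by omega),
        extendZero_of_lt n.2]
  rw [h₁, h₂, vermaCoeff_succ hq hq' hν]
  ring

/-- The realization of the even part on its `ℓ`-dimensional Verma module. -/
def evenVerma (hq : q ≠ 0) (hq' : q ^ 2 - 1 ≠ 0) (hν : ∀ i, ν i ≠ 0) (hqℓ : q ^ ℓ = 1) :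
    EvenRealization q ℓ (Module.End ℂ (Fin ℓ → ℂ)) where
  e := vermaE q ℓ ν
  f := vermaF ℓ
  k i := diagOp ℓ (vermaWeight q ν i)
  l i := diagOp ℓ fun n => (vermaWeight q ν i n)⁻¹
  k_comm := by simp only [diagOp_mul, mul_comm]
  k_l i := by
    rw [diagOp_mul, ← diagOp_one]
    congr 1
    funext n
    exact mul_inv_cancel₀ (mul_ne_zero (hν i) (pow_ne_zero _ (by fin_cases i <;> simp [hq])))
  l_k i := by
    rw [diagOp_mul, ← diagOp_one]
    congr 1
    funext n
    exact inv_mul_cancel₀ (mul_ne_zero (hν i) (pow_ne_zero _ (by fin_cases i <;> simp [hq])))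
  k_e i := diagOp_vermaE fun n => by
    fin_cases i
    · simp [vermaWeight, cartan, pow_succ]
      field_simp
    · simp [vermaWeight, cartan, pow_succ]
      field_simp
  k_f i := diagOp_vermaF fun n => by
    fin_cases i
    · simp [vermaWeight, cartan, pow_succ]
      ring
    · simp [vermaWeight, cartan, pow_succ]
      ring
  e_f := vermaE_vermaF hq hq' (hν 0) hqℓ
  e_pow := vermaE_pow
  f_pow := vermaF_pow

theorem vermaF_single {n : ℕ} (hn : n + 1 < ℓ) :
    vermaF ℓ (Pi.single ⟨n, by omega⟩ 1) = Pi.single ⟨n + 1, hn⟩ 1 := by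
  funext m
  rw [vermaF_apply]
  split_ifs with h
  · rw [Pi.single_eq_of_ne]
    rintro rfl
    simp at h
  · rw [extendZero_of_lt (by omega)]
    simp only [Pi.single_apply, Fin.ext_iff]
    congr 1
    simp; omega

theorem vermaE_single_zero (hℓ : 0 < ℓ) : vermaE q ℓ ν (Pi.single ⟨0, hℓ⟩ 1) = 0 := by
  funext n
  rw [vermaE_apply]
  rcases lt_or_ge ((n : ℕ) + 1) ℓ with h' | h'
  · rw [extendZero_of_lt h', Pi.single_eq_of_ne (by simp), mul_zero, Pi.zero_apply]
  · rw [extendZero_of_le h', mul_zero, Pi.zero_apply]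

theorem diagOp_single (d : ℕ → ℂ) (n : Fin ℓ) :
    diagOp ℓ d (Pi.single n 1) = d n • Pi.single n 1 := by
  funext m
  rw [diagOp_apply, Pi.smul_apply, smul_eq_mul]
  rcases eq_or_ne m n with rfl | h
  · rfl
  · rw [Pi.single_eq_of_ne h, mul_zero, mul_zero]

theorem eq_top_of_vermaF_mem (hℓ : 0 < ℓ) {W : Submodule ℂ (Fin ℓ → ℂ)}
    (h0 : Pi.single ⟨0, hℓ⟩ 1 ∈ W) (hf : ∀ u ∈ W, vermaF ℓ u ∈ W) : W = ⊤ := by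
  have key (n : ℕ) (hn : n < ℓ) : Pi.single ⟨n, hn⟩ 1 ∈ W := by
    induction n with
    | zero => exact h0
    | succ n ih =>
      rw [← vermaF_single hn]
      exact hf _ (ih _)
  rw [eq_top_iff, ← (Pi.basisFun ℂ (Fin ℓ)).span_eq, Submodule.span_le]
  rintro _ ⟨n, rfl⟩
  rw [Pi.basisFun_apply]
  exact key n n.2

end EvenVerma

end QuantumSL21

/-! ### Tensor products of highest weight and lowest weight modules -/

namespace QuantumSL21

variable {q : ℂ} {ℓ : ℕ}

section Cyclic

variable {V W : Type*} [AddCommGroup V] [Module ℂ V] [AddCommGroup W] [Module ℂ W]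

/-- The vector `v` is a highest weight vector of weight `(ν, ε)`, and it generates the module. -/
structure IsHighestWeight (R : Realization q ℓ (Module.End ℂ V)) (v : V) (ν : Fin 2 → ℂ)
    (ε : ℂ) : Prop where
  e_apply (i : Fin 2) : R.e i v = 0
  k_apply (i : Fin 2) : R.k i v = ν i • v
  s_apply : R.s v = ε • v
  eq_top (S : Submodule ℂ V) (hv : v ∈ S) (hf : ∀ i, ∀ u ∈ S, R.f i u ∈ S) : S = ⊤

/-- The vector `w` is a lowest weight vector of weight `(ν, ε)`, and it generates the module. -/
structure IsLowestWeight (R : Realization q ℓ (Module.End ℂ W)) (w : W) (ν : Fin 2 → ℂ)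
    (ε : ℂ) : Prop where
  f_apply (i : Fin 2) : R.f i w = 0
  k_apply (i : Fin 2) : R.k i w = ν i • w
  s_apply : R.s w = ε • w
  eq_top (S : Submodule ℂ W) (hw : w ∈ S) (he : ∀ i, ∀ u ∈ S, R.e i u ∈ S) : S = ⊤

namespace Realization

theorem l_apply_of_k_apply (R : Realization q ℓ (Module.End ℂ V)) {v : V} {i : Fin 2} {c : ℂ}
    (hc : c ≠ 0) (h : R.k i v = c • v) : R.l i v = c⁻¹ • v := by
  have h₁ : R.l i (R.k i v) = v := DFunLike.congr_fun (R.l_k i) v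
  rw [h, map_smul] at h₁
  rw [← h₁, smul_smul, inv_mul_cancel₀ hc, one_smul, h₁]

theorem _root_.QuantumSL21.IsHighestWeight.chevalley (hq : q ≠ 0) {R : Realization q ℓ (Module.End ℂ V)} {v : V}
    {ν : Fin 2 → ℂ} {ε : ℂ} (hν : ∀ i, ν i ≠ 0) (h : IsHighestWeight R v ν ε) :
    IsLowestWeight (R.chevalley hq) v (fun i => (ν i)⁻¹) ε where
  f_apply := h.e_apply
  k_apply i := R.l_apply_of_k_apply (hν i) (h.k_apply i)
  s_apply := h.s_apply
  eq_top S hv he := h.eq_top S hv fun i u hu => by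
    have := S.smul_mem ((-1 : ℂ) ^ deg i) (he i u hu)
    change ((-1 : ℂ) ^ deg i) • ((-1 : ℂ) ^ deg i) • R.f i u ∈ S at this
    rwa [smul_smul, ← mul_pow, neg_one_mul, neg_neg, one_pow, one_smul] at this

/-- The realization on the tensor product of two modules. -/
def tensorEnd (R : Realization q ℓ (Module.End ℂ V)) (T : Realization q ℓ (Module.End ℂ W))
    (hq : q ≠ 0) (hζ : IsPrimitiveRoot (q ^ 2)⁻¹ ℓ) (hℓ : 0 < ℓ) :
    Realization q ℓ (Module.End ℂ (V ⊗[ℂ] W)) :=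
  (R.tensor T hq hζ hℓ).map (Module.endTensorEndAlgHom (R := ℂ) (S := ℂ) (A := ℂ))

variable (R : Realization q ℓ (Module.End ℂ V)) (T : Realization q ℓ (Module.End ℂ W))
  (hq : q ≠ 0) (hζ : IsPrimitiveRoot (q ^ 2)⁻¹ ℓ) (hℓ : 0 < ℓ)

theorem tensorEnd_e_tmul (i : Fin 2) (y : V) (z : W) : (R.tensorEnd T hq hζ hℓ).e i (y ⊗ₜ z) =
    R.e i y ⊗ₜ z + R.l i ((R.s ^ deg i) y) ⊗ₜ T.e i z := by
  change Module.endTensorEndAlgHom (R := ℂ) (S := ℂ) (A := ℂ)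
    (R.e i ⊗ₜ 1 + (R.l i * R.s ^ deg i) ⊗ₜ T.e i) (y ⊗ₜ z) = _
  rw [map_add]
  rfl

theorem tensorEnd_f_tmul (i : Fin 2) (y : V) (z : W) : (R.tensorEnd T hq hζ hℓ).f i (y ⊗ₜ z) =
    R.f i y ⊗ₜ T.k i z + (R.s ^ deg i) y ⊗ₜ T.f i z := by
  change Module.endTensorEndAlgHom (R := ℂ) (S := ℂ) (A := ℂ)
    (R.f i ⊗ₜ T.k i + (R.s ^ deg i) ⊗ₜ T.f i) (y ⊗ₜ z) = _
  rw [map_add]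
  rfl

theorem tensorEnd_k_tmul (i : Fin 2) (y : V) (z : W) : (R.tensorEnd T hq hζ hℓ).k i (y ⊗ₜ z) =
    R.k i y ⊗ₜ T.k i z := rfl

theorem tensorEnd_k_pow_tmul (i : Fin 2) (n : ℕ) (y : V) (z : W) :
    ((R.tensorEnd T hq hζ hℓ).k i ^ n) (y ⊗ₜ z) = (R.k i ^ n) y ⊗ₜ (T.k i ^ n) z := by
  induction n with
  | zero => simp
  | succ n ih => rw [pow_succ', Module.End.mul_apply, ih, tensorEnd_k_tmul, pow_succ', pow_succ',
      Module.End.mul_apply, Module.End.mul_apply]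

theorem tensorEnd_s_tmul (y : V) (z : W) : (R.tensorEnd T hq hζ hℓ).s (y ⊗ₜ z) =
    R.s y ⊗ₜ T.s z := rfl

variable {R T}

/-- The tensor product of a highest weight and a lowest weight module is generated by the tensor
product of the generators. -/
theorem tensorEnd_eq_top {v : V} {w : W} {ν μ : Fin 2 → ℂ} {ε δ : ℂ} (hν : ∀ i, ν i ≠ 0)
    (hε : ε * ε = 1) (hv : IsHighestWeight R v ν ε) (hw : IsLowestWeight T w μ δ)
    (S : Submodule ℂ (V ⊗[ℂ] W)) (hvw : v ⊗ₜ w ∈ S)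
    (he : ∀ i, ∀ x ∈ S, (R.tensorEnd T hq hζ hℓ).e i x ∈ S)
    (hf : ∀ i, ∀ x ∈ S, (R.tensorEnd T hq hζ hℓ).f i x ∈ S) : S = ⊤ := by
  have hε0 : ε ≠ 0 := fun h => by simp [h] at hε
  have hs (n : ℕ) : (R.s ^ n) v = ε ^ n • v := by
    induction n with
    | zero => simp
    | succ n ih => rw [pow_succ', Module.End.mul_apply, ih, map_smul, hv.s_apply, smul_smul,
        ← pow_succ]
  -- As e_i kills v, applying e_i to v ⊗ z gives a nonzero multiple of v ⊗ e_i z. Hence the z with v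
  -- ⊗ z ∈ S form an e-stable subspace containing w.
  have h₁ (z : W) : v ⊗ₜ z ∈ S := by
    have : S.comap (TensorProduct.mk ℂ V W v) = ⊤ := by
      refine hw.eq_top _ hvw fun i z hz => ?_
      have := he i _ (Submodule.mem_comap.1 hz)
      rw [TensorProduct.mk_apply, tensorEnd_e_tmul, hv.e_apply, TensorProduct.zero_tmul, zero_add,
        hs, map_smul, R.l_apply_of_k_apply (hν i) (hv.k_apply i), smul_smul,
        ← TensorProduct.smul_tmul'] at this
      exact (S.smul_mem_iff (mul_ne_zero (pow_ne_zero _ hε0) (inv_ne_zero (hν i)))).1 this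
    exact (this ▸ Submodule.mem_top : z ∈ S.comap (TensorProduct.mk ℂ V W v))
  let Q : Submodule ℂ V := ⨅ z : W, S.comap ((TensorProduct.mk ℂ V W).flip z)
  have hQ (y : V) : y ∈ Q ↔ ∀ z, y ⊗ₜ z ∈ S := Submodule.mem_iInf _
  -- Applying f_i to y ⊗ k_i⁻¹z gives f_i y ⊗ z plus a term whose first factor is σ^{deg i} y. That
  -- term lies in S once σ^{deg i} y is in Q.
  have hfQ (i : Fin 2) (y : V) (hy : y ∈ Q) (hsy : (R.s ^ deg i) y ∈ Q) : R.f i y ∈ Q := by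
    rw [hQ] at hy hsy ⊢
    intro z
    have hz : T.k i (T.l i z) = z := DFunLike.congr_fun (T.k_l i) z
    have h₃ := hf i _ (hy (T.l i z))
    rw [tensorEnd_f_tmul, hz] at h₃
    exact (S.add_mem_iff_left (hsy _)).1 h₃
  have hss (y : V) : R.s (R.s y) = y := DFunLike.congr_fun R.s_s y
  have hsf (i : Fin 2) (y : V) : R.s (R.f i y) = ((-1 : ℂ) ^ deg i) • R.f i (R.s y) :=
    DFunLike.congr_fun (R.s_f i) y
  have h₂ (y : V) (z : W) : y ⊗ₜ z ∈ S := by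
    -- Stability of Q under f₂ needs σy ∈ Q as well, so Q is replaced by its largest σ-stable
    -- subspace.
    have : Q ⊓ Q.comap R.s = ⊤ := by
      refine hv.eq_top _ ⟨(hQ v).2 h₁, ?_⟩ fun i y hy => ?_
      · change R.s v ∈ Q
        rw [hv.s_apply]
        exact Q.smul_mem _ ((hQ v).2 h₁)
      · obtain ⟨hy, hsy⟩ := hy
        change R.s y ∈ Q at hsy
        refine ⟨hfQ i y hy ?_, ?_⟩
        · fin_cases i
          · exact hy
          · exact hsy
        · change R.s (R.f i y) ∈ Q
          rw [hsf]
          refine Q.smul_mem _ (hfQ i _ hsy ?_)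
          fin_cases i
          · exact hsy
          · change R.s (R.s y) ∈ Q
            rwa [hss]
    have hy : y ∈ Q ⊓ Q.comap R.s := this ▸ Submodule.mem_top
    exact (hQ y).1 hy.1 z
  rw [eq_top_iff, ← TensorProduct.span_tmul_eq_top, Submodule.span_le]
  rintro _ ⟨y, z, rfl⟩
  exact h₂ y z

end Realization

end Cyclic

end QuantumSL21

/-! ### The highest weight modules of dimension 4ℓ -/

namespace QuantumSL21

variable {q : ℂ} {ℓ : ℕ}

section Kac

/-- The algebra homomorphism by which matrices of endomorphisms act on vectors. -/
def matrixEnd (M : Type*) [AddCommGroup M] [Module ℂ M] :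
    Matrix (Fin 4) (Fin 4) (Module.End ℂ M) →ₐ[ℂ] Module.End ℂ (Fin 4 → M) :=
  (endVecAlgEquivMatrixEnd (Fin 4) ℂ ℂ M).symm.toAlgHom

theorem matrixEnd_apply {M : Type*} [AddCommGroup M] [Module ℂ M]
    (X : Matrix (Fin 4) (Fin 4) (Module.End ℂ M)) (u : Fin 4 → M) (i : Fin 4) :
    matrixEnd M X u i = ∑ j, X i j (u j) := by
  change (endVecAlgEquivMatrixEnd (Fin 4) ℂ ℂ M).symm X u i = _
  simp

/-- The generator of the Verma module. -/
def vermaVector (hℓ : 1 < ℓ) : Fin 4 → Fin ℓ → ℂ :=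
  Pi.single 0 (Pi.single ⟨0, by omega⟩ 1)

variable (hq : q ≠ 0) (hq' : q ^ 2 - 1 ≠ 0) (hqℓ : q ^ ℓ = 1) (hζ : IsPrimitiveRoot (q ^ 2)⁻¹ ℓ)
  (hℓ : 1 < ℓ) {ν : Fin 2 → ℂ} (hν : ∀ i, ν i ≠ 0) {ε : ℂ} (hε : ε * ε = 1)

/-- The Verma module of the quotient `U_ξ sl(2|1) / (e₁^ℓ, f₁^ℓ)`, of dimension `4 ℓ`. -/
def verma : Realization q ℓ (Module.End ℂ (Fin 4 → Fin ℓ → ℂ)) :=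
  ((evenVerma hq hq' hν hqℓ).kac hq hq' hζ hℓ hε).map (matrixEnd _)

theorem matrixEnd_single {M : Type*} [AddCommGroup M] [Module ℂ M]
    (X : Matrix (Fin 4) (Fin 4) (Module.End ℂ M)) (u : M) (j : Fin 4) :
    matrixEnd M X (Pi.single j u) = fun i => X i j u := by
  funext i
  rw [matrixEnd_apply, Finset.sum_eq_single j]
  · rw [Pi.single_eq_same]
  · intro k _ hk
    rw [Pi.single_eq_of_ne hk, map_zero]
  · simp

theorem verma_isHighestWeight :
    IsHighestWeight (verma hq hq' hqℓ hζ hℓ hν hε) (vermaVector hℓ) ν ε where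
  e_apply i := by
    change matrixEnd _ ((evenVerma hq hq' hν hqℓ).kacE i) _ = 0
    rw [vermaVector, matrixEnd_single]
    funext j
    fin_cases i <;> fin_cases j <;> simp [EvenRealization.kacE]
    exact vermaE_single_zero _
  k_apply i := by
    change matrixEnd _ ((evenVerma hq hq' hν hqℓ).kacK i) _ = _
    rw [vermaVector, matrixEnd_single]
    funext j
    have h (i : Fin 2) : (evenVerma hq hq' hν hqℓ).k i (Pi.single ⟨0, by omega⟩ 1) =
        ν i • Pi.single ⟨0, by omega⟩ 1 := by
      refine (diagOp_single _ _).trans ?_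
      simp [vermaWeight]
    fin_cases i <;> fin_cases j <;> simp [EvenRealization.kacK, h]
  s_apply := by
    change matrixEnd _ (EvenRealization.kacS _ ε) _ = _
    rw [vermaVector, matrixEnd_single]
    funext j
    fin_cases j <;> simp [EvenRealization.kacS, Module.algebraMap_end_apply]
  eq_top S hv hf := by
    have hF (i : Fin 2) (u) (hu : u ∈ S) :
        matrixEnd _ ((evenVerma hq hq' hν hqℓ).kacF i) u ∈ S := hf i u hu
    have h₀ (u : Fin ℓ → ℂ) : Pi.single 0 u ∈ S := by
      have : S.comap (LinearMap.single ℂ (fun _ : Fin 4 => Fin ℓ → ℂ) 0) = ⊤ := by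
        refine eq_top_of_vermaF_mem (by omega) hv fun u hu => ?_
        have := hF 0 _ hu
        rw [LinearMap.coe_single, matrixEnd_single] at this
        rw [Submodule.mem_comap, LinearMap.coe_single]
        convert this using 1
        funext i
        fin_cases i <;> simp [EvenRealization.kacF] <;> rfl
      exact (this ▸ Submodule.mem_top :
        u ∈ S.comap (LinearMap.single ℂ (fun _ : Fin 4 => Fin ℓ → ℂ) 0))
    have h₁ (u : Fin ℓ → ℂ) : Pi.single 1 u ∈ S := by
      have := hF 1 _ (h₀ u)
      rw [matrixEnd_single] at this
      convert this using 1
      funext i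
      fin_cases i <;> simp [EvenRealization.kacF]
    have h₂ (u : Fin ℓ → ℂ) : Pi.single 2 u ∈ S := by
      have := hF 0 _ (h₁ u)
      rw [matrixEnd_single] at this
      -- From f₁f₂ = f₃ + q⁻¹f₂f₁, the component along f₃ is f₁ applied to the f₂ component, minus a
      -- vector already obtained.
      have h := S.sub_mem this (h₁ (q⁻¹ • (evenVerma hq hq' hν hqℓ).f u))
      convert h using 1
      funext i
      fin_cases i <;> simp [EvenRealization.kacF]
    have h₃ (u : Fin ℓ → ℂ) : Pi.single 3 u ∈ S := by
      have := hF 1 _ (h₂ u)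
      rw [matrixEnd_single] at this
      convert this using 1
      funext i
      fin_cases i <;> simp [EvenRealization.kacF]
    refine eq_top_iff.2 fun u _ => ?_
    rw [← Finset.univ_sum_single u, Fin.sum_univ_four]
    exact S.add_mem (S.add_mem (S.add_mem (h₀ _) (h₁ _)) (h₂ _)) (h₃ _)

theorem diagOp_pow (d : ℕ → ℂ) (n : ℕ) : diagOp ℓ d ^ n = diagOp ℓ fun m => d m ^ n := by
  induction n with
  | zero => simp [diagOp_one]
  | succ n ih => simp only [pow_succ, ih, diagOp_mul]

/-- All weights of k_i differ from ν_i by powers of q, and these disappear in the ℓ-th power. -/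
theorem verma_k_pow (i : Fin 2) :
    (verma hq hq' hqℓ hζ hℓ hν hε).k i ^ ℓ = algebraMap ℂ _ (ν i ^ ℓ) := by
  have h (i : Fin 2) : (evenVerma hq hq' hν hqℓ).k i ^ ℓ = algebraMap ℂ _ (ν i ^ ℓ) := by
    refine (diagOp_pow _ _).trans ?_
    refine LinearMap.ext fun u => funext fun n => ?_
    rw [diagOp_apply, Module.algebraMap_end_apply, Pi.smul_apply, smul_eq_mul]
    congr 1
    have : (![(q ^ 2)⁻¹, q] i) ^ ℓ = 1 := by
      fin_cases i
      · exact hζ.pow_eq_one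
      · exact hqℓ
    rw [vermaWeight, mul_pow, ← pow_mul, mul_comm (n : ℕ), pow_mul, this, one_pow, mul_one]
  change matrixEnd _ ((evenVerma hq hq' hν hqℓ).kacK i) ^ ℓ = _
  rw [← map_pow, ← AlgHom.commutes (matrixEnd (Fin ℓ → ℂ))]
  congr 1
  rw [Matrix.algebraMap_eq_diagonal]
  fin_cases i
  · simp only [EvenRealization.kacK, Fin.zero_eta, Matrix.cons_val_zero, Matrix.diagonal_pow]
    congr 1
    funext j
    fin_cases j <;> simp [smul_pow, h, hqℓ]
  · simp only [EvenRealization.kacK, Fin.mk_one, Matrix.cons_val_one, Matrix.cons_val_fin_one,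
      Matrix.diagonal_pow]
    congr 1
    funext j
    fin_cases j <;> simp [smul_pow, h, hqℓ]

end Kac

end QuantumSL21

/-! ### Separation of weights and the lower bound for the dimension -/

namespace QuantumSL21

section Separation

variable {A M X : Type*} [Ring A] [Algebra ℂ A] [AddCommGroup M] [Module ℂ M] [Finite X]

/-- Finitely many cyclic representations, generated by joint eigenvectors with distinct systems of
eigenvalues, are jointly cyclic. -/
theorem surjective_of_separated_weights [DecidableEq X] (ρ : X → A →ₐ[ℂ] Module.End ℂ M) (m : M)
    {I : Type*} (a : I → A) (c : I → X → ℂ) (hac : ∀ i χ, ρ χ (a i) m = c i χ • m)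
    (hsep : ∀ χ χ', χ ≠ χ' → ∃ i, c i χ ≠ c i χ')
    (hgen : ∀ χ (S : Submodule ℂ M), m ∈ S → (∀ x, ∀ u ∈ S, ρ χ x u ∈ S) → S = ⊤) :
    Function.Surjective
      (LinearMap.pi fun χ => (LinearMap.applyₗ m).comp (ρ χ).toLinearMap : A →ₗ[ℂ] X → M) := by
  cases nonempty_fintype X
  set L : A →ₗ[ℂ] X → M := LinearMap.pi fun χ => (LinearMap.applyₗ m).comp (ρ χ).toLinearMap
  have hL (x : A) (χ : X) : L x χ = ρ χ x m := rfl
  -- Lagrange interpolation: p is a product of factors (a_i - c_i(ψ)) / (c_i(χ) - c_i(ψ)), one for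
  -- each ψ ∈ F, with i chosen to separate χ from ψ. It acts on m by 1 at χ and by 0 at every ψ ∈ F.
  have hp (χ : X) (F : Finset X) (hF : χ ∉ F) : ∃ (p : A) (d : X → ℂ),
      (∀ χ', ρ χ' p m = d χ' • m) ∧ d χ = 1 ∧ ∀ χ' ∈ F, d χ' = 0 := by
    induction F using Finset.induction_on with
    | empty => exact ⟨1, 1, fun χ' => by simp, rfl, by simp⟩
    | insert ψ F _ ih =>
      rw [Finset.mem_insert, not_or] at hF
      obtain ⟨p, d, hpd, hd, hd'⟩ := ih hF.2
      obtain ⟨i, hi⟩ := hsep χ ψ hF.1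
      refine ⟨(c i χ - c i ψ)⁻¹ • ((a i - algebraMap ℂ A (c i ψ)) * p),
        fun χ' => (c i χ - c i ψ)⁻¹ * ((c i χ' - c i ψ) * d χ'), fun χ' => ?_, ?_, fun χ' h => ?_⟩
      · rw [map_smul, map_mul, map_sub, AlgHom.commutes, LinearMap.smul_apply,
          Module.End.mul_apply, hpd, map_smul, LinearMap.sub_apply, hac,
          Module.algebraMap_end_apply]
        module
      · dsimp only
        rw [hd, mul_one, inv_mul_cancel₀ (sub_ne_zero.2 hi)]
      · dsimp only
        rcases Finset.mem_insert.1 h with rfl | h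
        · rw [sub_self, zero_mul, mul_zero]
        · rw [hd' _ h, mul_zero, mul_zero]
  have hsingle (χ : X) : Pi.single χ m ∈ LinearMap.range L := by
    obtain ⟨p, d, hpd, hd, hd'⟩ := hp χ (Finset.univ.erase χ) (by simp)
    refine ⟨p, funext fun χ' => ?_⟩
    rw [hL, hpd]
    rcases eq_or_ne χ' χ with rfl | h
    · rw [hd, one_smul, Pi.single_eq_same]
    · rw [hd' _ (by simpa using h), zero_smul, Pi.single_eq_of_ne h]
  -- The range of L is stable under the diagonal action of A, so the vectors concentrated at χ that
  -- it contains form a subspace stable under `ρ χ` and containing m.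
  have hall (χ : X) (u : M) : Pi.single χ u ∈ LinearMap.range L := by
    have : (LinearMap.range L).comap (LinearMap.single ℂ (fun _ : X => M) χ) = ⊤ := by
      refine hgen χ _ (hsingle χ) fun x u hu => ?_
      obtain ⟨y, hy⟩ := hu
      refine ⟨x * y, funext fun χ' => ?_⟩
      rw [hL, map_mul, Module.End.mul_apply, ← hL, hy, LinearMap.coe_single]
      rcases eq_or_ne χ' χ with rfl | h
      · rw [Pi.single_eq_same, Pi.single_eq_same]
      · rw [Pi.single_eq_of_ne h, Pi.single_eq_of_ne h, map_zero]
    exact (this ▸ Submodule.mem_top :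
      u ∈ (LinearMap.range L).comap (LinearMap.single ℂ (fun _ : X => M) χ))
  rw [← LinearMap.range_eq_top, eq_top_iff]
  intro u _
  rw [← Finset.univ_sum_single u]
  exact Submodule.sum_mem _ fun χ _ => hall χ _

end Separation

theorem xi_sq_sub_one_ne_zero {ℓ : ℕ} (hℓ : 3 ≤ ℓ) : xi ℓ ^ 2 - 1 ≠ 0 :=
  sub_ne_zero.2 ((xi_isPrimitiveRoot hℓ).pow_ne_one_of_pos_of_lt (by omega) (by omega))

theorem xi_pow (ℓ : ℕ) (hℓ : 3 ≤ ℓ) : xi ℓ ^ ℓ = 1 := (xi_isPrimitiveRoot hℓ).pow_eq_one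

theorem exists_pow_eq_xiPowEll {ℓ : ℕ} (hℓ : 3 ≤ ℓ) (a : ℂ ⧸ AddSubgroup.zmultiples (1 : ℂ)) :
    ∃ t : ℂ, t ≠ 0 ∧ t ^ ℓ = xiPowEll ℓ a := by
  induction a using QuotientAddGroup.induction_on with
  | H z =>
    refine ⟨xiPow ℓ z, Complex.exp_ne_zero _, ?_⟩
    rw [xiPowEll_mk, xiPow, xiPow, ← Complex.exp_nat_mul]
    congr 1
    ring

theorem Realization.l_pow_of_k_pow {q : ℂ} {ℓ : ℕ} {B : Type*} [Ring B] [Algebra ℂ B]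
    (R : Realization q ℓ B) {i : Fin 2} (h : R.k i ^ ℓ = 1) : R.l i ^ ℓ = 1 := by
  have hc : Commute (R.k i) (R.l i) := (R.k_l i).trans (R.l_k i).symm
  have := hc.mul_pow ℓ
  rwa [R.k_l, one_pow, h, one_mul, eq_comm] at this

section LowerBound

variable {ℓ : ℕ} (hℓ : 3 ≤ ℓ) (hodd : Odd ℓ)

/-- The tensor product of the Verma module of highest weight `(ν, ε)` with the lowest weight
Verma module of weight `(1, 1)`. -/
def vermaTensor {ν : Fin 2 → ℂ} (hν : ∀ i, ν i ≠ 0) {ε : ℂ} (hε : ε * ε = 1) :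
    Realization (xi ℓ) ℓ (Module.End ℂ ((Fin 4 → Fin ℓ → ℂ) ⊗[ℂ] (Fin 4 → Fin ℓ → ℂ))) :=
  (verma (xi_ne_zero ℓ) (xi_sq_sub_one_ne_zero hℓ) (xi_pow ℓ hℓ)
    (xi_sq_inv_isPrimitiveRoot hℓ hodd) (by omega) hν hε).tensorEnd
  ((verma (xi_ne_zero ℓ) (xi_sq_sub_one_ne_zero hℓ) (xi_pow ℓ hℓ)
    (xi_sq_inv_isPrimitiveRoot hℓ hodd) (by omega) (ν := 1) (fun _ => one_ne_zero)
    (one_mul (1 : ℂ))).chevalley (xi_ne_zero ℓ))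
  (xi_ne_zero ℓ) (xi_sq_inv_isPrimitiveRoot hℓ hodd) (by omega)

/-- The tensor product of the generators of the two factors. -/
def vermaTensorVector : (Fin 4 → Fin ℓ → ℂ) ⊗[ℂ] (Fin 4 → Fin ℓ → ℂ) :=
  vermaVector (show 1 < ℓ by omega) ⊗ₜ vermaVector (show 1 < ℓ by omega)

variable {ν : Fin 2 → ℂ} (hν : ∀ i, ν i ≠ 0) {ε : ℂ} (hε : ε * ε = 1)

/-- The ℓ-th power acts factor by factor, and on the lowest weight factor it is 1 because that
factor has weight 1. So tensoring does not change which quotient U_α acts. -/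
theorem vermaTensor_k_pow (i : Fin 2) :
    (vermaTensor hℓ hodd hν hε).k i ^ ℓ = algebraMap ℂ _ (ν i ^ ℓ) := by
  let V := verma (xi_ne_zero ℓ) (xi_sq_sub_one_ne_zero hℓ) (xi_pow ℓ hℓ)
    (xi_sq_inv_isPrimitiveRoot hℓ hodd) (by omega) hν hε
  let W := verma (xi_ne_zero ℓ) (xi_sq_sub_one_ne_zero hℓ) (xi_pow ℓ hℓ)
    (xi_sq_inv_isPrimitiveRoot hℓ hodd) (by omega) (ν := 1) (fun _ => one_ne_zero)
    (one_mul (1 : ℂ))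
  have hW : W.l i ^ ℓ = 1 := W.l_pow_of_k_pow (by
    refine (verma_k_pow _ _ _ _ _ _ _ i).trans ?_
    rw [Pi.one_apply, one_pow, map_one])
  have hV : V.k i ^ ℓ = algebraMap ℂ _ (ν i ^ ℓ) := verma_k_pow _ _ _ _ _ _ _ i
  refine TensorProduct.ext' fun y z => ?_
  refine (Realization.tensorEnd_k_pow_tmul V (W.chevalley (xi_ne_zero ℓ)) _ _ _ i ℓ y z).trans ?_
  change (V.k i ^ ℓ) y ⊗ₜ (W.l i ^ ℓ) z = _
  rw [hV, hW, Module.algebraMap_end_apply, Module.algebraMap_end_apply, Module.End.one_apply,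
    TensorProduct.smul_tmul']

theorem vermaTensor_k_apply (i : Fin 2) : (vermaTensor hℓ hodd hν hε).k i (vermaTensorVector hℓ) =
    ν i • vermaTensorVector hℓ := by
  have hV := (verma_isHighestWeight (xi_ne_zero ℓ) (xi_sq_sub_one_ne_zero hℓ) (xi_pow ℓ hℓ)
    (xi_sq_inv_isPrimitiveRoot hℓ hodd) (by omega) hν hε).k_apply i
  have hW := ((verma_isHighestWeight (xi_ne_zero ℓ) (xi_sq_sub_one_ne_zero hℓ) (xi_pow ℓ hℓ)
    (xi_sq_inv_isPrimitiveRoot hℓ hodd) (by omega) (ν := 1) (fun _ => one_ne_zero)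
    (one_mul (1 : ℂ))).chevalley (xi_ne_zero ℓ) (fun _ => one_ne_zero)).k_apply i
  rw [inv_one, one_smul] at hW
  rw [vermaTensor, vermaTensorVector, Realization.tensorEnd_k_tmul, hV, hW,
    TensorProduct.smul_tmul']

theorem vermaTensor_s_apply : (vermaTensor hℓ hodd hν hε).s (vermaTensorVector hℓ) =
    ε • vermaTensorVector hℓ := by
  have hV := (verma_isHighestWeight (xi_ne_zero ℓ) (xi_sq_sub_one_ne_zero hℓ) (xi_pow ℓ hℓ)
    (xi_sq_inv_isPrimitiveRoot hℓ hodd) (by omega) hν hε).s_apply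
  have hW := ((verma_isHighestWeight (xi_ne_zero ℓ) (xi_sq_sub_one_ne_zero hℓ) (xi_pow ℓ hℓ)
    (xi_sq_inv_isPrimitiveRoot hℓ hodd) (by omega) (ν := 1) (fun _ => one_ne_zero)
    (one_mul (1 : ℂ))).chevalley (xi_ne_zero ℓ) (fun _ => one_ne_zero)).s_apply
  rw [one_smul] at hW
  rw [vermaTensor, vermaTensorVector, Realization.tensorEnd_s_tmul, hV, hW,
    TensorProduct.smul_tmul']

theorem vermaTensor_eq_top
    (S : Submodule ℂ ((Fin 4 → Fin ℓ → ℂ) ⊗[ℂ] (Fin 4 → Fin ℓ → ℂ)))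
    (hv : vermaTensorVector hℓ ∈ S) (he : ∀ i, ∀ x ∈ S, (vermaTensor hℓ hodd hν hε).e i x ∈ S)
    (hf : ∀ i, ∀ x ∈ S, (vermaTensor hℓ hodd hν hε).f i x ∈ S) : S = ⊤ :=
  Realization.tensorEnd_eq_top _ _ _ hν hε
    (verma_isHighestWeight (xi_ne_zero ℓ) (xi_sq_sub_one_ne_zero hℓ) (xi_pow ℓ hℓ)
      (xi_sq_inv_isPrimitiveRoot hℓ hodd) (by omega) hν hε)
    ((verma_isHighestWeight (xi_ne_zero ℓ) (xi_sq_sub_one_ne_zero hℓ) (xi_pow ℓ hℓ)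
      (xi_sq_inv_isPrimitiveRoot hℓ hodd) (by omega) (ν := 1) (fun _ => one_ne_zero)
      (one_mul (1 : ℂ))).chevalley (xi_ne_zero ℓ) (fun _ => one_ne_zero)) S hv he hf

-- The index set enumerates the compatible weights: exponents a_i ∈ {0, …, ℓ - 1}, giving ν_i = t_i
-- ξ^{a_i} for a fixed ℓ-th root t_i of ξ^{ℓα_i}, and a sign ε. Each module is generated by v ⊗ w,
-- and the eigenvalues of the k_i and σ separate the 2ℓ² of them.
include hℓ hodd in
theorem Ualpha.exists_surjective (α : G) :
    ∃ L : Ualpha ℓ α →ₗ[ℂ] ((Fin 2 → Fin ℓ) × Fin 2 →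
      (Fin 4 → Fin ℓ → ℂ) ⊗[ℂ] (Fin 4 → Fin ℓ → ℂ)), Function.Surjective L := by
  choose t ht0 ht using fun i => exists_pow_eq_xiPowEll hℓ (α i)
  let ν (χ : (Fin 2 → Fin ℓ) × Fin 2) (i : Fin 2) : ℂ := t i * xi ℓ ^ (χ.1 i : ℕ)
  have hν (χ) (i) : ν χ i ≠ 0 := mul_ne_zero (ht0 i) (pow_ne_zero _ (xi_ne_zero ℓ))
  let ε (χ : (Fin 2 → Fin ℓ) × Fin 2) : ℂ := (-1) ^ (χ.2 : ℕ)
  have hε (χ) : ε χ * ε χ = 1 := by rw [← mul_pow, neg_one_mul, neg_neg, one_pow]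
  let T (χ) := vermaTensor hℓ hodd (hν χ) (hε χ)
  let ρ (χ) : Ualpha ℓ α →ₐ[ℂ] _ := Ualpha.lift (T χ).lift fun i => by
    rw [Realization.lift_k, vermaTensor_k_pow]
    congr 1
    rw [mul_pow, ht, ← pow_mul, mul_comm (χ.1 i : ℕ), pow_mul, xi_pow ℓ hℓ, one_pow, mul_one]
  have hρ (χ) (x : Usigma ℓ) : ρ χ (proj ℓ α x) = (T χ).lift x := Ualpha.lift_proj _ _ x
  refine ⟨_, surjective_of_separated_weights ρ (vermaTensorVector hℓ)
    -- The separating operators are σ, indexed by `none`, and the k_i.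
    (fun i : Option (Fin 2) => i.elim (proj ℓ α (Usigma.σ ℓ)) fun i => proj ℓ α (Usigma.k ℓ i))
    (fun i χ => i.elim (ε χ) (ν χ)) (fun i χ => ?_) (fun χ χ' h => ?_) fun χ S hv hS => ?_⟩
  · cases i with
    | none => 
      rw [Option.elim, Option.elim, hρ, Realization.lift_σ]
      exact vermaTensor_s_apply _ _ _ _
    | some i =>
      rw [Option.elim, Option.elim, hρ, Realization.lift_k]
      exact vermaTensor_k_apply _ _ _ _ i
  · by_contra! hc
    apply h
    refine Prod.ext (funext fun i => ?_) ?_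
    · have := mul_left_cancel₀ (ht0 i) (hc (some i))
      exact Fin.ext ((xi_isPrimitiveRoot hℓ).pow_inj (χ.1 i).2 (χ'.1 i).2 this)
    · have hp : IsPrimitiveRoot (-1 : ℂ) 2 := IsPrimitiveRoot.neg_one 0 (by norm_num)
      exact Fin.ext (hp.pow_inj χ.2.2 χ'.2.2 (hc none))
  · refine vermaTensor_eq_top hℓ hodd (hν χ) (hε χ) S hv (fun i x hx => ?_) fun i x hx => ?_
    · have := hS (proj ℓ α (Usigma.e ℓ i)) x hx
      rwa [hρ, Realization.lift_e] at this
    · have := hS (proj ℓ α (Usigma.f ℓ i)) x hx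
      rwa [hρ, Realization.lift_f] at this

-- The target of the surjection has dimension 2ℓ² · (4ℓ)² = 32ℓ⁴.
include hℓ hodd in
theorem Ualpha.le_finrank (α : G) [Module.Finite ℂ (Ualpha ℓ α)] :
    32 * ℓ ^ 4 ≤ Module.finrank ℂ (Ualpha ℓ α) := by
  obtain ⟨L, hL⟩ := Ualpha.exists_surjective hℓ hodd α
  refine le_trans (le_of_eq ?_) (LinearMap.finrank_le_finrank_of_surjective (f := L) hL)
  rw [Module.finrank_pi_fintype]
  simp only [Module.finrank_tensorProduct, Module.finrank_pi_fintype, Module.finrank_self,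
    Finset.sum_const, Finset.card_univ, Fintype.card_prod, Fintype.card_pi, Fintype.card_fin,
    smul_eq_mul, Finset.prod_const]
  ring

end LowerBound

end QuantumSL21

/-! ### Spanning sets of the nilpotent parts and of the torus -/

namespace QuantumSL21

section Spanning

open Algebra Submodule

variable {B : Type*} [Ring B] [Algebra ℂ B]

/-- A subspace that contains `1` and is stable under left multiplication by the elements of `X`
contains the subalgebra generated by `X`. -/
theorem adjoin_le_of_mul_mem {X : Set B} {S : Submodule ℂ B} (h₁ : 1 ∈ S)
    (h : ∀ x ∈ X, ∀ y ∈ S, x * y ∈ S) : Subalgebra.toSubmodule (adjoin ℂ X) ≤ S := by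
  intro z hz
  have key : ∀ y ∈ S, z * y ∈ S := by
    induction hz using adjoin_induction with
    | mem x hx => exact h x hx
    | algebraMap r =>
      intro y hy
      rw [← Algebra.smul_def]
      exact S.smul_mem r hy
    | add u v _ _ hu hv =>
      intro y hy
      rw [add_mul]
      exact S.add_mem (hu y hy) (hv y hy)
    | mul u v _ _ hu hv =>
      intro y hy
      rw [mul_assoc]
      exact hu _ (hv y hy)
  simpa using key 1 h₁

/-- A criterion for `x * z ∈ Q` for all `x ∈ X` and all `z` in the subalgebra generated by `Y`, by
induction on `z`. -/
theorem mul_mem_of_mem_adjoin {X Y : Set B} {Q : Submodule ℂ B} (hX : ∀ x ∈ X, x ∈ Q)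
    (h : ∀ y ∈ Y, ∀ z ∈ adjoin ℂ Y, (∀ x ∈ X, x * z ∈ Q) → ∀ x ∈ X, x * (y * z) ∈ Q)
    {x : B} (hx : x ∈ X) {z : B} (hz : z ∈ adjoin ℂ Y) : x * z ∈ Q := by
  let S : Submodule ℂ B := Subalgebra.toSubmodule (adjoin ℂ Y) ⊓
    ⨅ x : X, Q.comap (LinearMap.mulLeft ℂ (x : B))
  have hS (z : B) : z ∈ S ↔ z ∈ adjoin ℂ Y ∧ ∀ x ∈ X, x * z ∈ Q := by
    simp [S]
  have : z ∈ S := adjoin_le_of_mul_mem ((hS 1).2 ⟨one_mem _, by simpa using hX⟩)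
    (fun y hy u hu => by
      rw [hS] at hu ⊢
      exact ⟨mul_mem (subset_adjoin hy) hu.1, h y hy u hu.1 hu.2⟩) hz
  exact ((hS z).1 this).2 x hx

theorem mul_mem_of_gen_mem {F : Set B} {S : Submodule ℂ B} {x : B} (h : ∀ y ∈ F, x * y ∈ S)
    {z : B} (hz : z ∈ span ℂ F) : x * z ∈ S := by
  have : span ℂ F ≤ S.comap (LinearMap.mulLeft ℂ x) := span_le.2 h
  exact this hz

/-- With c = ab - q⁻¹ba the Serre relation becomes ac = q ca, and c² = 0 follows from b² = 0. The
monomials b^i c^j a^n with i, j < 2 and n < ℓ then span: left multiplication by a is straightened by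
ab = c + q⁻¹ba and ac = q ca. It serves both for the e_i and for the f_i. -/
theorem exists_finset_adjoin_serre {q : ℂ} {ℓ : ℕ} (hq : q ≠ 0) (hq' : q + q⁻¹ ≠ 0) {a b : B}
    (hab : IsSerre q a b) (hb : b * b = 0) (ha : a ^ ℓ = 0) :
    ∃ F : Finset B, F.card ≤ 4 * ℓ ∧
      Subalgebra.toSubmodule (adjoin ℂ {a, b}) ≤ span ℂ (F : Set B) := by
  classical
  let c : B := a * b - q⁻¹ • (b * a)
  have hab' : a * b = c + q⁻¹ • (b * a) := by simp [c]
  have hb' := assoc_zero_rule hb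
  have hac : a * c = q • (c * a) := by
    unfold IsSerre at hab
    simp only [c, mul_sub, sub_mul, mul_smul_comm, smul_mul_assoc, mul_assoc, hab]
    match_scalars <;> field_simp <;> ring
  -- Multiplying the Serre relation by b on the left and on the right expresses ba²b as (q + q⁻¹)
  -- baba and as (q + q⁻¹) abab. As q + q⁻¹ ≠ 0, abab = baba, and this is what c² = 0 amounts to.
  have h₁ : b * (a * (a * b)) = (q + q⁻¹) • (b * (a * (b * a))) := by
    have := congrArg (b * ·) hab
    simpa only [mul_sub, mul_smul_comm, hb', sub_zero] using this
  have h₂ : b * (a * (a * b)) = (q + q⁻¹) • (a * (b * (a * b))) := by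
    have := congrArg (· * b) hab
    simp only [sub_mul, smul_mul_assoc, mul_assoc, hb, mul_zero] at this
    exact (sub_eq_zero.1 this.symm).symm
  have h₃ : a * (b * (a * b)) = b * (a * (b * a)) :=
    smul_right_injective B hq' (h₂.symm.trans h₁)
  have hcc : c * c = 0 := by
    simp only [c, mul_sub, sub_mul, mul_smul_comm, smul_mul_assoc, mul_assoc, hb', mul_zero, h₁, h₃]
    match_scalars <;> field_simp <;> ring
  let m (i j n : ℕ) : B := b ^ i * (c ^ j * a ^ n)
  let F : Finset B := Finset.univ.image fun x : Fin 2 × Fin 2 × Fin ℓ => m x.1 x.2.1 x.2.2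
  have hm (i j n : ℕ) : m i j n ∈ span ℂ (F : Set B) := by
    by_cases hi : i < 2
    · by_cases hj : j < 2
      · by_cases hn : n < ℓ
        · exact subset_span (Finset.mem_coe.2 (Finset.mem_image.2
            ⟨(⟨i, hi⟩, ⟨j, hj⟩, ⟨n, hn⟩), Finset.mem_univ _, rfl⟩))
        · have : m i j n = 0 := by
            simp only [m]
            rw [pow_eq_zero_of_le (not_lt.1 hn) ha, mul_zero, mul_zero]
          exact this ▸ zero_mem _
      · have : m i j n = 0 := by
          simp only [m]
          rw [pow_eq_zero_of_le (not_lt.1 hj) ((sq c).trans hcc), zero_mul, mul_zero]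
        exact this ▸ zero_mem _
    · have : m i j n = 0 := by
        simp only [m]
        rw [pow_eq_zero_of_le (not_lt.1 hi) ((sq b).trans hb), zero_mul]
      exact this ▸ zero_mem _
  have hac' (j n : ℕ) : a * (c ^ j * a ^ n) = q ^ j • (c ^ j * a ^ (n + 1)) := by
    induction j with
    | zero => simp [pow_succ']
    | succ j ih =>
      rw [pow_succ' c, mul_assoc, assoc_rule hac, ih, mul_smul_comm, smul_smul, ← pow_succ',
        mul_assoc]
  refine ⟨F, ?_, adjoin_le_of_mul_mem ?_ ?_⟩
  · refine Finset.card_image_le.trans (le_of_eq ?_)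
    simp
    ring
  · simpa [m] using hm 0 0 0
  · rintro x hx y hy
    refine mul_mem_of_gen_mem (fun y hy => ?_) hy
    obtain ⟨⟨i, j, n⟩, -, rfl⟩ := Finset.mem_image.1 (Finset.mem_coe.1 hy)
    obtain rfl | rfl := hx
    · fin_cases i
      · have : x * m 0 j n = q ^ (j : ℕ) • m 0 j (n + 1) := by
          simp only [m, pow_zero, one_mul, hac']
        exact this ▸ smul_mem _ _ (hm _ _ _)
      · have : x * m 1 j n = m 0 (j + 1) n + (q⁻¹ * q ^ (j : ℕ)) • m 1 j (n + 1) := by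
          simp only [m, pow_zero, one_mul, pow_one]
          rw [← mul_assoc, hab', add_mul, smul_mul_assoc, mul_assoc b, hac', mul_smul_comm,
            smul_smul, pow_succ' c, mul_assoc]
        exact this ▸ add_mem (hm _ _ _) (smul_mem _ _ (hm _ _ _))
    · have : x * m i j n = m (i + 1) j n := by
        simp only [m, pow_succ', mul_assoc]
      exact this ▸ hm _ _ _

end Spanning

section Torus

open Algebra Submodule

variable {q : ℂ} {ℓ : ℕ} {B : Type*} [Ring B] [Algebra ℂ B] (R : Realization q ℓ B)

/-- The generators `k_i`, `k_i⁻¹` and `σ`. -/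
def Realization.torus : Set B := Set.range R.k ∪ Set.range R.l ∪ {R.s}

/-- The generators commute, k_i^ℓ is a scalar and σ² = 1, so exponents can be reduced modulo ℓ, ℓ
and 2. -/
theorem Realization.exists_finset_adjoin_torus (hℓ : 0 < ℓ) {d : Fin 2 → ℂ} (hd : ∀ i, d i ≠ 0)
    (hkd : ∀ i, R.k i ^ ℓ = algebraMap ℂ B (d i)) :
    ∃ F : Finset B, F.card ≤ 2 * ℓ ^ 2 ∧
      Subalgebra.toSubmodule (adjoin ℂ R.torus) ≤ span ℂ (F : Set B) := by
  classical
  let m (a b c : ℕ) : B := R.k 0 ^ a * (R.k 1 ^ b * R.s ^ c)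
  let F : Finset B := Finset.univ.image fun x : Fin ℓ × Fin ℓ × Fin 2 => m x.1 x.2.1 x.2.2
  have hk (i : Fin 2) (a : ℕ) : R.k i ^ a = (d i ^ (a / ℓ)) • R.k i ^ (a % ℓ) := by
    conv_lhs => rw [← Nat.div_add_mod a ℓ, pow_add, pow_mul, hkd, ← map_pow, ← Algebra.smul_def]
  have hs (c : ℕ) : R.s ^ c = R.s ^ (c % 2) := by
    conv_lhs => rw [← Nat.div_add_mod c 2, pow_add, pow_mul, sq, R.s_s, one_pow, one_mul]
  have hm (a b c : ℕ) : m a b c ∈ span ℂ (F : Set B) := by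
    have : m a b c = (d 0 ^ (a / ℓ) * d 1 ^ (b / ℓ)) • m (a % ℓ) (b % ℓ) (c % 2) := by
      simp only [m]
      rw [hk 0 a, hk 1 b, hs c, smul_mul_assoc, smul_mul_assoc, mul_smul_comm, smul_smul]
    rw [this]
    exact smul_mem _ _ (subset_span (Finset.mem_coe.2 (Finset.mem_image.2
      ⟨(⟨a % ℓ, Nat.mod_lt _ hℓ⟩, ⟨b % ℓ, Nat.mod_lt _ hℓ⟩, ⟨c % 2, Nat.mod_lt _ two_pos⟩),
        Finset.mem_univ _, rfl⟩)))
  have hkF (i : Fin 2) (y : B) (hy : y ∈ span ℂ (F : Set B)) :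
      R.k i * y ∈ span ℂ (F : Set B) := by
    refine mul_mem_of_gen_mem (fun y hy => ?_) hy
    obtain ⟨⟨a, b, c⟩, -, rfl⟩ := Finset.mem_image.1 (Finset.mem_coe.1 hy)
    fin_cases i
    · have : R.k 0 * m a b c = m (a + 1) b c := by simp only [m, pow_succ', mul_assoc]
      exact this ▸ hm _ _ _
    · have : R.k 1 * m a b c = m a (b + 1) c := by
        simp only [m, ← mul_assoc, pow_succ']
        rw [((show Commute (R.k 1) (R.k 0) from R.k_comm.symm).pow_right a).eq, mul_assoc (_ ^ _)]
      exact this ▸ hm _ _ _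
  have hkpow (i : Fin 2) (n : ℕ) (y : B) (hy : y ∈ span ℂ (F : Set B)) :
      R.k i ^ n * y ∈ span ℂ (F : Set B) := by
    induction n with
    | zero => simpa using hy
    | succ n ih =>
      rw [pow_succ', mul_assoc]
      exact hkF i _ ih
  refine ⟨F, ?_, adjoin_le_of_mul_mem ?_ ?_⟩
  · refine Finset.card_image_le.trans (le_of_eq ?_)
    simp
    ring
  · simpa [m] using hm 0 0 0
  · rintro x ((⟨i, rfl⟩ | ⟨i, rfl⟩) | rfl) y hy
    · exact hkF i y hy
    -- As k_i^ℓ is a nonzero scalar, the inverse of k_i is a multiple of a positive power and needs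
    -- no monomials of its own.
    · have : R.l i = (d i)⁻¹ • R.k i ^ (ℓ - 1) := by
        have h : R.k i * R.k i ^ (ℓ - 1) = algebraMap ℂ B (d i) := by
          rw [← pow_succ', Nat.sub_add_cancel hℓ, hkd]
        rw [← one_mul (R.k i ^ (ℓ - 1)), ← R.l_k i, mul_assoc, h, ← Algebra.commutes,
          ← Algebra.smul_def, smul_smul, inv_mul_cancel₀ (hd i), one_smul]
      rw [this, smul_mul_assoc]
      exact smul_mem _ _ (hkpow i _ y hy)
    · refine mul_mem_of_gen_mem (fun y hy => ?_) hy
      obtain ⟨⟨a, b, c⟩, -, rfl⟩ := Finset.mem_image.1 (Finset.mem_coe.1 hy)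
      have : R.s * m a b c = m a b (c + 1) := by
        simp only [m]
        rw [← mul_assoc, ((show Commute R.s (R.k 0) from R.s_k 0).pow_right a).eq, mul_assoc,
          ← mul_assoc R.s, ((show Commute R.s (R.k 1) from R.s_k 1).pow_right b).eq, mul_assoc,
          pow_succ']
      exact this ▸ hm _ _ _

end Torus

end QuantumSL21

/-! ### The triangular decomposition and the upper bound for the dimension -/

namespace QuantumSL21

section UpperBound

open Algebra Submodule

variable {q : ℂ} {ℓ : ℕ} {B : Type*} [Ring B] [Algebra ℂ B] (R : Realization q ℓ B)

namespace Realization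

/-- The span of the products `x h` with `x` in the subalgebra generated by the `f_i` and `h` in the
one generated by the `k_i`, their inverses and `σ`. -/
def lowerBorel : Submodule ℂ B :=
  Subalgebra.toSubmodule (adjoin ℂ {R.f 0, R.f 1}) * Subalgebra.toSubmodule (adjoin ℂ R.torus)

theorem f_mem (i : Fin 2) : R.f i ∈ adjoin ℂ {R.f 0, R.f 1} := by
  fin_cases i
  · exact subset_adjoin (Set.mem_insert _ _)
  · exact subset_adjoin (Set.mem_insert_of_mem _ rfl)

theorem e_mem (i : Fin 2) : R.e i ∈ adjoin ℂ {R.e 0, R.e 1} := by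
  fin_cases i
  · exact subset_adjoin (Set.mem_insert _ _)
  · exact subset_adjoin (Set.mem_insert_of_mem _ rfl)

theorem k_mem_torus (i : Fin 2) : R.k i ∈ R.torus := Or.inl (Or.inl ⟨i, rfl⟩)
theorem l_mem_torus (i : Fin 2) : R.l i ∈ R.torus := Or.inl (Or.inr ⟨i, rfl⟩)
theorem s_mem_torus : R.s ∈ R.torus := Or.inr rfl

theorem exists_torus_mul_f (hq : q ≠ 0) {x : B} (hx : x ∈ R.torus) (j : Fin 2) :
    ∃ c : ℂ, x * R.f j = c • (R.f j * x) := by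
  obtain ((⟨i, rfl⟩ | ⟨i, rfl⟩) | rfl) := hx
  · exact ⟨_, R.k_f i j⟩
  · exact ⟨_, R.l_f hq i j⟩
  · exact ⟨_, R.s_f j⟩

theorem exists_e_mul_torus (hq : q ≠ 0) {x : B} (hx : x ∈ R.torus) (j : Fin 2) :
    ∃ c : ℂ, R.e j * x = c • (x * R.e j) := by
  obtain ((⟨i, rfl⟩ | ⟨i, rfl⟩) | rfl) := hx
  · exact ⟨_, R.e_k hq j i⟩
  · exact ⟨_, R.e_l hq j i⟩
  · refine ⟨(-1) ^ deg j, ?_⟩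
    rw [R.s_e, smul_smul, ← mul_pow, neg_one_mul, neg_neg, one_pow, one_smul]

theorem f_mul_mem_of_left {N : Submodule ℂ B} (j : Fin 2) {y : B}
    (hy : y ∈ Subalgebra.toSubmodule (adjoin ℂ {R.f 0, R.f 1}) * N) :
    R.f j * y ∈ Subalgebra.toSubmodule (adjoin ℂ {R.f 0, R.f 1}) * N := by
  have h := Submodule.mul_mem_mul (M := Subalgebra.toSubmodule (adjoin ℂ {R.f 0, R.f 1}))
    (R.f_mem j) hy
  rwa [← mul_assoc, (Subalgebra.isIdempotentElem_toSubmodule _).eq] at h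

/-- Torus generators commute with each f_j up to a scalar, so they can be pulled through a word in
the f_j from left to right. -/
theorem torus_mul_mem (hq : q ≠ 0) {x y : B} (hx : x ∈ R.torus)
    (hy : y ∈ adjoin ℂ {R.f 0, R.f 1}) : x * y ∈ R.lowerBorel := by
  refine mul_mem_of_mem_adjoin (X := R.torus) (fun x hx => ?_) (fun f hf z hz h x hx => ?_) hx hy
  · have := Submodule.mul_mem_mul (M := Subalgebra.toSubmodule (adjoin ℂ {R.f 0, R.f 1}))
      (N := Subalgebra.toSubmodule (adjoin ℂ R.torus)) (one_mem (adjoin ℂ {R.f 0, R.f 1}))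
      (subset_adjoin hx)
    rwa [one_mul] at this
  · have key (j : Fin 2) : x * (R.f j * z) ∈ R.lowerBorel := by
      obtain ⟨c, hc⟩ := R.exists_torus_mul_f hq hx j
      rw [assoc_rule hc]
      exact smul_mem _ _ (R.f_mul_mem_of_left j (h x hx))
    obtain rfl | rfl := hf
    · exact key 0
    · exact key 1

/-- The span of `e_1` and `e_2`. -/
def eSpan : Submodule ℂ B := span ℂ (Set.range R.e)

theorem e_mul_mem_torus (hq : q ≠ 0) (j : Fin 2) {h : B} (hh : h ∈ adjoin ℂ R.torus) :
    R.e j * h ∈ Subalgebra.toSubmodule (adjoin ℂ R.torus) * R.eSpan := by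
  refine mul_mem_of_mem_adjoin (X := Set.range R.e) ?_ (fun x hx z hz h => ?_) ⟨j, rfl⟩ hh
  · rintro _ ⟨i, rfl⟩
    have := Submodule.mul_mem_mul (M := Subalgebra.toSubmodule (adjoin ℂ R.torus))
      (N := R.eSpan) (one_mem (adjoin ℂ R.torus)) (subset_span ⟨i, rfl⟩)
    rwa [one_mul] at this
  · rintro _ ⟨i, rfl⟩
    obtain ⟨c, hc⟩ := R.exists_e_mul_torus hq hx i
    rw [assoc_rule hc]
    refine smul_mem _ _ ?_
    have := Submodule.mul_mem_mul (M := Subalgebra.toSubmodule (adjoin ℂ R.torus))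
      (subset_adjoin hx) (h _ ⟨i, rfl⟩)
    rwa [← mul_assoc, (Subalgebra.isIdempotentElem_toSubmodule _).eq] at this

theorem exists_e_mul_f (i j : Fin 2) : ∃ c d : ℂ,
    R.e i * R.f j = c • (R.f j * R.e i) + d • (R.k i - R.l i) := by
  fin_cases i <;> fin_cases j
  · exact ⟨1, (q - q⁻¹)⁻¹, by rw [one_smul]; exact R.e_f_even⟩
  · exact ⟨1, 0, by rw [one_smul, zero_smul, add_zero]; exact R.e_f_01⟩
  · exact ⟨1, 0, by rw [one_smul, zero_smul, add_zero]; exact R.e_f_10⟩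
  · exact ⟨-1, (q - q⁻¹)⁻¹, by rw [neg_one_smul]; exact R.e_f_odd⟩

/-- Pulling e_i through a word in the f_j either carries it to the right end or replaces it on the
way by k_i - k_i⁻¹, which is then moved right by `torus_mul_mem`. Both outcomes are recorded by the
supremum. -/
theorem e_mul_mem (hq : q ≠ 0) (i : Fin 2) {y : B} (hy : y ∈ adjoin ℂ {R.f 0, R.f 1}) :
    R.e i * y ∈ R.lowerBorel ⊔
      Subalgebra.toSubmodule (adjoin ℂ {R.f 0, R.f 1}) * R.eSpan := by
  refine mul_mem_of_mem_adjoin (X := Set.range R.e) ?_ (fun f hf z hz h => ?_) ⟨i, rfl⟩ hy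
  · rintro _ ⟨i, rfl⟩
    have := Submodule.mul_mem_mul (M := Subalgebra.toSubmodule (adjoin ℂ {R.f 0, R.f 1}))
      (N := R.eSpan) (one_mem (adjoin ℂ {R.f 0, R.f 1})) (subset_span ⟨i, rfl⟩)
    rw [one_mul] at this
    exact mem_sup_right this
  · rintro _ ⟨i, rfl⟩
    have key (j : Fin 2) : R.e i * (R.f j * z) ∈ R.lowerBorel ⊔
        Subalgebra.toSubmodule (adjoin ℂ {R.f 0, R.f 1}) * R.eSpan := by
      obtain ⟨c, d, hcd⟩ := R.exists_e_mul_f i j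
      rw [← mul_assoc, hcd, add_mul, smul_mul_assoc, smul_mul_assoc, sub_mul, mul_assoc]
      refine add_mem (smul_mem _ _ ?_) (smul_mem _ _ (mem_sup_left (sub_mem
        (R.torus_mul_mem hq (R.k_mem_torus i) hz) (R.torus_mul_mem hq (R.l_mem_torus i) hz))))
      have := h _ ⟨i, rfl⟩
      rw [lowerBorel, ← Submodule.mul_sup] at this ⊢
      exact R.f_mul_mem_of_left j this
    obtain rfl | rfl := hf
    · exact key 0
    · exact key 1

/-- The product N_f · T · N_e contains 1 and is stable under left multiplication by every generator,
hence contains the subalgebra they generate. Only the e_i have to cross both other factors. -/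
theorem mul_lowerBorel_mul_eq_top (hq : q ≠ 0)
    (hgen : adjoin ℂ (Set.range R.e ∪ Set.range R.f ∪ R.torus) = ⊤) :
    R.lowerBorel * Subalgebra.toSubmodule (adjoin ℂ {R.e 0, R.e 1}) = ⊤ := by
  set Nf := Subalgebra.toSubmodule (adjoin ℂ {R.f 0, R.f 1}) with hNf
  set N := Subalgebra.toSubmodule (adjoin ℂ R.torus) with hN
  set Ne := Subalgebra.toSubmodule (adjoin ℂ {R.e 0, R.e 1}) with hNe
  have hb : R.lowerBorel = Nf * N := rfl
  have hEe : R.eSpan * Ne ≤ Ne := by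
    refine le_trans (mul_le_mul' ?_ le_rfl)
      (Subalgebra.isIdempotentElem_toSubmodule (adjoin ℂ {R.e 0, R.e 1})).le
    rw [eSpan, span_le]
    rintro _ ⟨i, rfl⟩
    exact R.e_mem i
  have hNN : R.lowerBorel * N = R.lowerBorel := by
    rw [hb, mul_assoc, (Subalgebra.isIdempotentElem_toSubmodule _).eq]
  have hEN : R.eSpan * N ≤ N * R.eSpan := by
    rw [Submodule.mul_le]
    intro x hx h hh
    have : R.eSpan ≤ (N * R.eSpan).comap (LinearMap.mulRight ℂ h) := by
      rw [eSpan, span_le]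
      rintro _ ⟨i, rfl⟩
      exact R.e_mul_mem_torus hq i hh
    exact this hx
  have hT {x : B} (hx : x ∈ R.torus) : span ℂ {x} * (R.lowerBorel * Ne) ≤ R.lowerBorel * Ne := by
    rw [← mul_assoc]
    refine mul_le_mul' ?_ le_rfl
    conv_rhs => rw [← hNN]
    rw [hb, ← mul_assoc]
    refine mul_le_mul' ?_ le_rfl
    rw [Submodule.mul_le]
    intro z hz y hy
    obtain ⟨c, rfl⟩ := mem_span_singleton.1 hz
    rw [smul_mul_assoc]
    exact smul_mem _ _ (R.torus_mul_mem hq hx hy)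
  have hF (j : Fin 2) {y : B} (hy : y ∈ R.lowerBorel * Ne) : R.f j * y ∈ R.lowerBorel * Ne := by
    rw [hb, mul_assoc] at hy ⊢
    exact R.f_mul_mem_of_left j hy
  have hE (i : Fin 2) : span ℂ {R.e i} * (R.lowerBorel * Ne) ≤ R.lowerBorel * Ne := by
    have h₁ : span ℂ {R.e i} * Nf ≤ R.lowerBorel ⊔ Nf * R.eSpan := by
      rw [Submodule.mul_le]
      intro z hz y hy
      obtain ⟨c, rfl⟩ := mem_span_singleton.1 hz
      rw [smul_mul_assoc]
      exact smul_mem _ _ (R.e_mul_mem hq i hy)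
    -- After e_i has crossed N_f, the part in N_f · T absorbs T by `hNN`; the part still ending in
    -- some e_j crosses T by `hEN` and is absorbed by N_e through `hEe`.
    calc span ℂ {R.e i} * (R.lowerBorel * Ne)
        = span ℂ {R.e i} * Nf * (N * Ne) := by rw [hb]; simp only [mul_assoc]
      _ ≤ (R.lowerBorel ⊔ Nf * R.eSpan) * (N * Ne) := mul_le_mul' h₁ le_rfl
      _ = R.lowerBorel * N * Ne ⊔ Nf * (R.eSpan * N * Ne) := by
        rw [Submodule.sup_mul]; simp only [mul_assoc]
      _ ≤ R.lowerBorel * Ne := by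
        rw [hNN]
        refine sup_le le_rfl ?_
        calc Nf * (R.eSpan * N * Ne) ≤ Nf * (N * R.eSpan * Ne) :=
              mul_le_mul' le_rfl (mul_le_mul' hEN le_rfl)
          _ = Nf * N * (R.eSpan * Ne) := by simp only [mul_assoc]
          _ ≤ R.lowerBorel * Ne := mul_le_mul' le_rfl hEe
  have h := adjoin_le_of_mul_mem (X := Set.range R.e ∪ Set.range R.f ∪ R.torus)
    (S := R.lowerBorel * Ne) ?_ ?_
  · rw [hgen, Algebra.top_toSubmodule] at h
    exact top_le_iff.1 h
  · rw [← one_mul (1 : B)]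
    refine Submodule.mul_mem_mul ?_ (one_mem (adjoin ℂ {R.e 0, R.e 1}))
    rw [← one_mul (1 : B)]
    exact Submodule.mul_mem_mul (one_mem (adjoin ℂ {R.f 0, R.f 1})) (one_mem (adjoin ℂ R.torus))
  · rintro x ((⟨i, rfl⟩ | ⟨i, rfl⟩) | hx) y hy
    · exact hE i (Submodule.mul_mem_mul (mem_span_singleton_self _) hy)
    · exact hF i hy
    · exact hT hx (Submodule.mul_mem_mul (mem_span_singleton_self _) hy)

theorem finite_and_finrank_le (hq : q ≠ 0) (hq' : q + q⁻¹ ≠ 0) (hℓ : 0 < ℓ) {d : Fin 2 → ℂ}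
    (hd : ∀ i, d i ≠ 0) (hkd : ∀ i, R.k i ^ ℓ = algebraMap ℂ B (d i))
    (hgen : adjoin ℂ (Set.range R.e ∪ Set.range R.f ∪ R.torus) = ⊤) :
    Module.Finite ℂ B ∧ Module.finrank ℂ B ≤ 32 * ℓ ^ 4 := by
  classical
  obtain ⟨F₁, hF₁, h₁⟩ := exists_finset_adjoin_serre hq hq' R.serre_f R.f_sq R.f_pow
  obtain ⟨F₂, hF₂, h₂⟩ := R.exists_finset_adjoin_torus hℓ hd hkd
  obtain ⟨F₃, hF₃, h₃⟩ := exists_finset_adjoin_serre hq hq' R.serre_e R.e_sq R.e_pow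
  open scoped Pointwise in
  have htop : span ℂ ((F₁ * F₂ * F₃ : Finset B) : Set B) = ⊤ := by
    rw [_root_.eq_top_iff, ← R.mul_lowerBorel_mul_eq_top hq hgen, Finset.coe_mul, Finset.coe_mul,
      ← span_mul_span, ← span_mul_span]
    exact mul_le_mul' (mul_le_mul' h₁ h₂) h₃
  refine ⟨⟨⟨_, htop⟩⟩, ?_⟩
  rw [← finrank_top, ← htop]
  refine (finrank_span_finset_le_card _).trans ?_
  calc _ ≤ F₁.card * F₂.card * F₃.card :=
        Finset.card_mul_le.trans (Nat.mul_le_mul_right _ Finset.card_mul_le)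
    _ ≤ 4 * ℓ * (2 * ℓ ^ 2) * (4 * ℓ) := Nat.mul_le_mul (Nat.mul_le_mul hF₁ hF₂) hF₃
    _ = 32 * ℓ ^ 4 := by ring

end Realization

/-- Otherwise ξ² = -1, and raising to the odd power ℓ would give 1 = -1. -/
theorem xi_add_inv_ne_zero {ℓ : ℕ} (hℓ : 3 ≤ ℓ) (hodd : Odd ℓ) : xi ℓ + (xi ℓ)⁻¹ ≠ 0 := by
  intro h
  have h0 := xi_ne_zero ℓ
  have h₂ : xi ℓ ^ 2 = -1 := by
    field_simp at h
    linear_combination h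
  have h₄ : (xi ℓ ^ 2) ^ ℓ = 1 := by
    rw [← pow_mul, mul_comm, pow_mul, (xi_isPrimitiveRoot hℓ).pow_eq_one, one_pow]
  rw [h₂, hodd.neg_one_pow] at h₄
  norm_num at h₄

theorem Ualpha.finite_and_finrank_le {ℓ : ℕ} (hℓ : 3 ≤ ℓ) (hodd : Odd ℓ) (α : G) :
    Module.Finite ℂ (Ualpha ℓ α) ∧ Module.finrank ℂ (Ualpha ℓ α) ≤ 32 * ℓ ^ 4 := by
  let R := (Usigma.realization ℓ).map (proj ℓ α)
  refine R.finite_and_finrank_le (xi_ne_zero ℓ) (xi_add_inv_ne_zero hℓ hodd) (by omega)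
    (fun i => xiPowEll_ne_zero ℓ (α i)) (proj_k_pow ℓ α) ?_
  set S := adjoin ℂ (Set.range R.e ∪ Set.range R.f ∪ R.torus) with hS
  have h : S.comap (proj ℓ α) = ⊤ := Usigma.subalgebra_eq_top
    (fun i => subset_adjoin (Or.inl (Or.inl ⟨i, rfl⟩)))
    (fun i => subset_adjoin (Or.inl (Or.inr ⟨i, rfl⟩)))
    (fun i => subset_adjoin (Or.inr (R.k_mem_torus i)))
    (fun i => subset_adjoin (Or.inr (R.l_mem_torus i)))
    (subset_adjoin (Or.inr R.s_mem_torus))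
  refine _root_.eq_top_iff.2 fun x _ => ?_
  obtain ⟨y, rfl⟩ := proj_surjective ℓ α x
  exact (h ▸ Algebra.mem_top : y ∈ S.comap (proj ℓ α))

end UpperBound

end QuantumSL21

end

theorem mainTheorem5 (ℓ : ℕ) (hℓ : 3 ≤ ℓ) (hodd : Odd ℓ) :
    ∃ (𝓗 : QuantumSL21.HopfStructure (QuantumSL21.Usigma ℓ))
      (𝓖 : QuantumSL21.HopfGroupCoalgebra (QuantumSL21.Ualpha ℓ)),
      QuantumSL21.IsBosonizedHopf ℓ 𝓗 ∧
      QuantumSL21.IsInduced 𝓗 𝓖 ∧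
      𝓖.IsFiniteType ∧
      ∀ α : QuantumSL21.G, Module.finrank ℂ (QuantumSL21.Ualpha ℓ α) = 32 * ℓ ^ 4 := by
  refine ⟨QuantumSL21.Usigma.hopfStructure ℓ hℓ hodd,
    QuantumSL21.Ualpha.hopfGroupCoalgebra ℓ hℓ hodd,
    QuantumSL21.Usigma.isBosonizedHopf ℓ hℓ hodd, QuantumSL21.Ualpha.isInduced ℓ hℓ hodd,
    fun α => (QuantumSL21.Ualpha.finite_and_finrank_le hℓ hodd α).1, fun α => ?_⟩
  have h := QuantumSL21.Ualpha.finite_and_finrank_le hℓ hodd α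
  have := h.1
  exact le_antisymm h.2 (QuantumSL21.Ualpha.le_finrank hℓ hodd α)
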